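/- Let $(M,\omega)$ be a compact Hermitian manifold of complex dimension $n\ge 2$, $\chi$ a smooth real $(1,1)$-form on $M$, $\psi$ a smooth positive real function on $M$, and $\alpha$ an integer with $1\le\alpha\le n$. Write locally $\omega=\frac{\sqrt{-1}}2\sum g_{i\bar j}\,dz^i\wedge d\bar z^j$ and $\chi=\frac{\sqrt{-1}}2\sum\chi_{i\bar j}\,dz^i\wedge d\bar z^j$; for $v\in C^2(M)$ real-valued put $\chi_v=\chi+\frac{\sqrt{-1}}2\partial\bar\partial v$, and let $\Delta v=\sum g^{i\bar j}v_{i\bar j}$ and $\operatorname{tr}\chi=\sum g^{i\bar j}\chi_{i\bar j}$, where $v_{i\bar j}=\partial^2v/\partial z^i\partial\bar z^j$ and $\sum_j g^{i\bar j}g_{k\bar j}=\delta_{ik}$. Assume the cone condition: there is $\underline u\in C^2(M)$ with $\chi_{\underline u}>0$ and $$n\,\chi_{\underline u}^{\,n-1}>(n-\alpha)\,\psi\,\chi_{\underline u}^{\,n-\alpha-1}\wedge\omega^\alpha$$ as $(n-1,n-1)$-forms (for $\alpha=n$ the right-hand side is $0$), i.e. the difference of the two sides has positive wedge product with $\frac{\sqrt{-1}}2\xi\wedge\bar\xi$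 for every nonzero $(1,0)$-covector $\xi$. Then there are constants $C>0$ and $A>0$, depending only on the given data $(M,\omega,\chi,\psi,\alpha)$, such that for every $u\in C^4(M)$ with $$\chi_u^{\,n}=\psi\,\chi_u^{\,n-\alpha}\wedge\omega^\alpha,\qquad \chi_u>0,\qquad \sup_M u=0,$$ the function $w=\Delta u+\operatorname{tr}\chi$ satisfies $$w(x)\le C\,e^{A\left(u(x)-\inf_M u\right)}\qquad\text{for all }x\in M.$$ -/

import Mathlib

open scoped Manifold ContDiff ComplexConjugate ComplexOrder

noncomputable section

namespace HermitianPDE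

/-- The model space `ℂⁿ`. -/
abbrev Cn (n : ℕ) : Type := EuclideanSpace ℂ (Fin n)

/-! ### Wirtinger calculus on `ℂⁿ` -/

/-- `∂f/∂zⁱ = ½ (∂f/∂xⁱ - √-1 ∂f/∂yⁱ)`, where `zⁱ = xⁱ + √-1 yⁱ`. -/
def dZ {n : ℕ} (i : Fin n) (f : Cn n → ℂ) (z : Cn n) : ℂ :=
  (1 / 2 : ℂ) * (fderiv ℝ f z (EuclideanSpace.single i 1)
    - Complex.I * fderiv ℝ f z (EuclideanSpace.single i Complex.I))

/-- `∂f/∂z̄ʲ = ½ (∂f/∂xʲ + √-1 ∂f/∂yʲ)`. -/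
def dZbar {n : ℕ} (j : Fin n) (f : Cn n → ℂ) (z : Cn n) : ℂ :=
  (1 / 2 : ℂ) * (fderiv ℝ f z (EuclideanSpace.single j 1)
    + Complex.I * fderiv ℝ f z (EuclideanSpace.single j Complex.I))

/-! ### Forms at a point, in coordinates

The algebra of complex-valued exterior forms at a point is the exterior algebra on the vector
space with basis `dz¹, …, dzⁿ, dz̄¹, …, dz̄ⁿ`; its product is the wedge product. -/

/-- Complex-valued exterior forms at a point of `ℂⁿ`. -/
abbrev Forms (n : ℕ) : Type := ExteriorAlgebra ℂ (Fin n ⊕ Fin n → ℂ)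

/-- The covector `dzⁱ`. -/
def dz {n : ℕ} (i : Fin n) : Forms n :=
  ExteriorAlgebra.ι ℂ (Pi.single (Sum.inl i) 1)

/-- The covector `dz̄ʲ`. -/
def dzbar {n : ℕ} (j : Fin n) : Forms n :=
  ExteriorAlgebra.ι ℂ (Pi.single (Sum.inr j) 1)

/-- The `(1,1)`-form `(√-1/2) ∑ H_{i j̄} dzⁱ ∧ dz̄ʲ` with coefficient matrix `H`. -/
def toForm {n : ℕ} (H : Matrix (Fin n) (Fin n) ℂ) : Forms n :=
  (Complex.I / 2) • ∑ i, ∑ j, H i j • (dz i * dzbar j)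

/-- An `(n,n)`-form at a point is positive if it is a positive multiple of the `n`-th power of
the standard form `(√-1/2) ∑ dzⁱ ∧ dz̄ⁱ` (which is `n!` times the Euclidean volume form). -/
def IsPosTop {n : ℕ} (Θ : Forms n) : Prop :=
  ∃ c : ℝ, 0 < c ∧ Θ = (c : ℂ) • toForm (1 : Matrix (Fin n) (Fin n) ℂ) ^ n

/-- An `(n-1,n-1)`-form `Θ` at a point is (strictly) positive if
`Θ ∧ (√-1/2) ξ ∧ ξ̄` is a positive `(n,n)`-form for every nonzero `ξ = ∑ ξᵢ dzⁱ`. -/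
def IsPosCodimOne {n : ℕ} (Θ : Forms n) : Prop :=
  ∀ ξ : Fin n → ℂ, ξ ≠ 0 → IsPosTop (Θ * toForm (Matrix.vecMulVec ξ (star ξ)))

/-! ### Complex manifolds -/

section Manifold

variable (n : ℕ) (M : Type*) [TopologicalSpace M] [ChartedSpace (Cn n) M]

/-- The holomorphic coordinate charts of `M`. -/
abbrev holCharts : Set (OpenPartialHomeomorph M (Cn n)) :=
  IsManifold.maximalAtlas 𝓘(ℂ, Cn n) ω M

variable {n M}

/-- The Jacobian matrix `∂wᵏ/∂zⁱ` (row `k`, column `i`) at `x` of the change of coordinates from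
`z` (given by the chart `e`) to `w` (given by the chart `e'`). -/
def jac (e e' : OpenPartialHomeomorph M (Cn n)) (x : M) : Matrix (Fin n) (Fin n) ℂ :=
  fun k i => (fderiv ℂ (fun z => e' (e.symm z)) (e x) (EuclideanSpace.single i 1)) k

/-- A smooth real `(1,1)`-form `χ = (√-1/2) ∑ χ_{i j̄} dzⁱ ∧ dz̄ʲ` on `M`, given in each
holomorphic chart `e` by the Hermitian matrix `coeff e x = (χ_{i j̄}(x))` at the points `x` of the
domain of `e`, smoothly in `x`, and with the transformation law
`χ_{i j̄} = ∑ (∂wᵏ/∂zⁱ) χ'_{k l̄} conj (∂wˡ/∂zʲ)`. Values of `coeff` at other arguments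
carry no meaning. -/
structure RealOneOneForm (n : ℕ) (M : Type*) [TopologicalSpace M] [ChartedSpace (Cn n) M] where
  coeff : OpenPartialHomeomorph M (Cn n) → M → Matrix (Fin n) (Fin n) ℂ
  isHermitian : ∀ e ∈ holCharts n M, ∀ x ∈ e.source, (coeff e x).IsHermitian
  smooth : ∀ e ∈ holCharts n M, ∀ i j,
    ContDiffOn ℝ ∞ (fun z => coeff e (e.symm z) i j) e.target
  transform : ∀ e ∈ holCharts n M, ∀ e' ∈ holCharts n M, ∀ x ∈ e.source ∩ e'.source,
    coeff e x = (jac e e' x).transpose * coeff e' x * (jac e e' x).map conj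

/-- A smooth Hermitian metric, identified with its fundamental form
`ω = (√-1/2) ∑ g_{i j̄} dzⁱ ∧ dz̄ʲ`: a positive smooth real `(1,1)`-form. -/
structure HermitianMetric (n : ℕ) (M : Type*) [TopologicalSpace M] [ChartedSpace (Cn n) M]
    extends RealOneOneForm n M where
  posDef : ∀ e ∈ holCharts n M, ∀ x ∈ e.source, (coeff e x).PosDef

/-- The complex Hessian `u_{i j̄} = ∂²u/∂zⁱ∂z̄ʲ` at `x` in the chart `e`. -/
def complexHessian (u : M → ℝ) (e : OpenPartialHomeomorph M (Cn n)) (x : M) :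
    Matrix (Fin n) (Fin n) ℂ :=
  fun i j => dZbar j (dZ i (fun z => (u (e.symm z) : ℂ))) (e x)

/-- The coefficients `χ_{i j̄} + u_{i j̄}` of `χ_u = χ + (√-1/2) ∂∂̄u` at `x` in the chart `e`. -/
def perturb (χ : RealOneOneForm n M) (u : M → ℝ) (e : OpenPartialHomeomorph M (Cn n)) (x : M) :
    Matrix (Fin n) (Fin n) ℂ :=
  χ.coeff e x + complexHessian u e x

/-- The trace `tr χ = ∑ g^{i j̄} χ_{i j̄}` of a real `(1,1)`-form with respect to the metric, where
`∑ⱼ g^{i j̄} g_{k j̄} = δ_{ik}`. The value does not depend on the chart. -/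
def traceForm (g : HermitianMetric n M) (χ : RealOneOneForm n M) (x : M) : ℝ :=
  (Matrix.trace ((g.coeff (chartAt (Cn n) x) x)⁻¹ * χ.coeff (chartAt (Cn n) x) x)).re

/-- The Laplacian `Δu = ∑ g^{i j̄} u_{i j̄}` of the Chern connection. The value does not depend on
the chart. -/
def laplacian (g : HermitianMetric n M) (u : M → ℝ) (x : M) : ℝ :=
  (Matrix.trace
    ((g.coeff (chartAt (Cn n) x) x)⁻¹ * complexHessian u (chartAt (Cn n) x) x)).re

/-- `χ_u > 0` everywhere on `M`. -/
def IsPositive (χ : RealOneOneForm n M) (u : M → ℝ) : Prop :=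
  ∀ e ∈ holCharts n M, ∀ x ∈ e.source, (perturb χ u e x).PosDef

/-- The cone condition `χ ∈ 𝒞_α(ψ)`: there is `χ' = χ_v`, `v ∈ C²(M)`, with `χ' > 0` and
`n χ'^{n-1} > (n-α) ψ χ'^{n-α-1} ∧ ω^α`, the inequality being in the sense of positivity of
`(n-1,n-1)`-forms. (For `α = n` the right-hand side is `0`.) -/
def ConeCondition (g : HermitianMetric n M) (χ : RealOneOneForm n M) (α : ℕ) (ψ : M → ℝ) : Prop :=
  ∃ v : M → ℝ, ContMDiff 𝓘(ℝ, Cn n) 𝓘(ℝ, ℝ) 2 v ∧ IsPositive χ v ∧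
    ∀ e ∈ holCharts n M, ∀ x ∈ e.source,
      IsPosCodimOne ((n : ℂ) • toForm (perturb χ v e x) ^ (n - 1)
        - (((n : ℂ) - (α : ℂ)) * (ψ x : ℂ)) •
          (toForm (perturb χ v e x) ^ (n - α - 1) * toForm (g.coeff e x) ^ α))

/-- `u` solves `χ_u^n = ψ χ_u^{n-α} ∧ ω^α`, `χ_u > 0`, `sup_M u = 0`. -/
structure IsSolution (g : HermitianMetric n M) (χ : RealOneOneForm n M) (α : ℕ) (ψ u : M → ℝ) :
    Prop where
  equation : ∀ e ∈ holCharts n M, ∀ x ∈ e.source,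
    toForm (perturb χ u e x) ^ n
      = (ψ x : ℂ) • (toForm (perturb χ u e x) ^ (n - α) * toForm (g.coeff e x) ^ α)
  positive : IsPositive χ u
  sup_eq_zero : ⨆ x, u x = 0

end Manifold

end HermitianPDE

end

/-!
The estimate is proved by the maximum principle, applied to the largest eigenvalue of `χ_u` with
respect to `ω` instead of the trace; the eigenvalue dominates the trace up to the factor `n`.

*The equation.* For a positive matrix `H`, let `mixedDet k H G` be the coefficient of `s ^ k` in
`det (H + s G)`. In coordinates the equation reads `mixedDet α H G = h det H` with
`h = (n choose α) / ψ` (`mixedDet_of_toForm_eq`), i.e. the elementary symmetric function `σ_α` of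
the eigenvalues of `H⁻¹ G` equals `h`. The cone condition says that, for each direction `ξ`, adding
a large multiple of `ξ ⊗ ξ̄` to `χ_v` makes this quantity smaller than `h`
(`exists_mixedDet_lt_of_isPosCodimOne`).

*The lower bound that replaces concavity.* If `M* G M = diag δ` and `M`, `Y` are unipotent upper
triangular, a Fischer type inequality gives
`σ_k(H⁻¹ G) ≥ ∑_{|J| = k} ∏_{i ∈ J} δᵢ / (Y* H Y)ᵢᵢ` (`det_mul_sum_prod_le_mixedDet`), with equality
when everything is diagonal. Along a solution and a curve of matrices `Y` this bounds `h` from below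
by an explicit function of diagonal entries, with equality at the base point. The second derivative
of this comparison (`second_variation_line`, `second_variation`) is the twice differentiated
equation, including the good quadratic term in the first derivatives of `H`. Applied at a single
point, the same inequality turns the cone condition into a linear inequality for the diagonal
entries of `χ_v` in the frame diagonalising `χ_u` (`add_le_sum_esymAt_mul_of_mixedDet_le`).

*The maximum point.* Put `s = u - v - m ≥ 0`. Let `c` be the least constant with
`exp(-A s + exp(-s)) χ_u ≤ c ω` on `M`, and take a point and a vector where equality holds
(`exists_optimal_isBelow`, `exists_frame_of_touching`). In a constant frame starting with that
vector, `log H₀₀ - log G₀₀ - A s + exp(-s)` has a local maximum. Derivatives of `u` commute, so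
`∂ᵢ∂ᵢ̄ H₀₀` and `∂₀∂₀̄ Hᵢᵢ` differ by derivatives of `χ` only, and so do `∂ᵢ H₀₀` and `∂₀ Hᵢ₀`. The
second variation therefore controls all third order terms except a torsion term, which the
convexity of `exp(-s)` absorbs as soon as the eigenvalue exceeds a multiple of `exp(s / 2)`
(`torsion_absorb`, `max_point_inequality`). The remaining inequality contradicts the cone condition
if `A` is large (`max_point_bound`). So the eigenvalue at the maximum point is at most
`C exp(s / 2)`, whence `c` is bounded, and the definition of `c` gives the estimate everywhere.

*Uniformity.* All constants are uniform near each point (`exists_local_bound`), since the cone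
condition persists with uniform constants (`exists_cone_constants`); compactness of `M` makes them
global. The comparison `a χ_u ≤ c ω` does not depend on the chart because the complex Hessian
transforms as a form (`lev_comp`), which is what makes the touching argument meaningful on `M`.
-/

noncomputable section

namespace HermitianPDE

/-! ### Mixed discriminants -/

/-- The matrix whose rows with index in `J` are those of `G`, and whose other rows are those
of `H`. -/
def replaceRows {n : ℕ} (J : Finset (Fin n)) (G H : Matrix (Fin n) (Fin n) ℂ) :
    Matrix (Fin n) (Fin n) ℂ :=
  Matrix.of fun i j => if i ∈ J then G i j else H i j

lemma replaceRows_apply {n : ℕ} (J : Finset (Fin n)) (G H : Matrix (Fin n) (Fin n) ℂ)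
    (i j : Fin n) : replaceRows J G H i j = if i ∈ J then G i j else H i j := rfl

lemma det_replaceRows_diagonal_mul {n : ℕ} (J : Finset (Fin n)) (x : Fin n → ℂ)
    (G H : Matrix (Fin n) (Fin n) ℂ) :
    (replaceRows J (Matrix.diagonal x * G) H).det = (∏ i ∈ J, x i) * (replaceRows J G H).det := by
  have h : replaceRows J (Matrix.diagonal x * G) H
      = Matrix.diagonal (J.piecewise x fun _ => 1) * replaceRows J G H := by
    ext i j
    by_cases hi : i ∈ J <;> simp [replaceRows_apply, Matrix.diagonal_mul, hi]
  rw [h, Matrix.det_mul, Matrix.det_diagonal, Finset.prod_piecewise]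
  simp

/-- The mixed discriminant of `n - k` copies of `H` and `k` copies of `G`, normalised to be the
coefficient of `s ^ k` in `det (H + s G)`. For `H` invertible, dividing it by `det H` gives the
`k`-th elementary symmetric function of the eigenvalues of `H⁻¹ G`. -/
def mixedDet {n : ℕ} (k : ℕ) (H G : Matrix (Fin n) (Fin n) ℂ) : ℂ :=
  ∑ J ∈ Finset.univ.powersetCard k, (replaceRows J G H).det

lemma det_add_smul_eq_sum {n : ℕ} (H G : Matrix (Fin n) (Fin n) ℂ) (s : ℂ) :
    (H + s • G).det = ∑ k ∈ Finset.range (n + 1), s ^ k * mixedDet k H G := by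
  have h1 : (H + s • G).det = ∑ J : Finset (Fin n), s ^ J.card * (replaceRows J G H).det := by
    rw [add_comm]
    refine ((Matrix.detRowAlternating (n := Fin n) (R := ℂ)).toMultilinearMap.map_add_univ
      (s • G) H).trans (Finset.sum_congr rfl fun J _ => ?_)
    rw [← Finset.prod_const, ← det_replaceRows_diagonal_mul J fun _ => s]
    change Matrix.det _ = _
    congr 1
    ext i j
    by_cases hi : i ∈ J <;> simp [Finset.piecewise, hi, replaceRows_apply, Matrix.diagonal_mul]
  rw [h1, ← Finset.powerset_univ, Finset.sum_powerset]
  simp only [Finset.card_univ, Fintype.card_fin, mixedDet, Finset.mul_sum]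
  refine Finset.sum_congr rfl fun k _ => Finset.sum_congr rfl fun J hJ => ?_
  rw [(Finset.mem_powersetCard.1 hJ).2]

lemma coeff_eq_of_forall_sum_pow {n : ℕ} {a b : ℕ → ℂ}
    (h : ∀ s : ℂ, ∑ k ∈ Finset.range (n + 1), s ^ k * a k
      = ∑ k ∈ Finset.range (n + 1), s ^ k * b k) {k : ℕ} (hk : k ≤ n) : a k = b k := by
  have hp : (∑ k ∈ Finset.range (n + 1), Polynomial.monomial k (a k))
      = ∑ k ∈ Finset.range (n + 1), Polynomial.monomial k (b k) := by
    refine Polynomial.funext fun s => ?_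
    simpa [Polynomial.eval_finsetSum, mul_comm] using h s
  have := congrArg (fun p => Polynomial.coeff p k) hp
  simpa [Polynomial.finsetSum_coeff, Polynomial.coeff_monomial, Nat.lt_succ_iff, hk] using this

/-- Mixed discriminants transform like determinants under a change of basis. -/
lemma mixedDet_conj {n k : ℕ} (hk : k ≤ n) (H G P Q : Matrix (Fin n) (Fin n) ℂ) :
    mixedDet k (P * H * Q) (P * G * Q) = P.det * Q.det * mixedDet k H G := by
  refine coeff_eq_of_forall_sum_pow (n := n) (a := fun k => mixedDet k (P * H * Q) (P * G * Q))
    (b := fun k => P.det * Q.det * mixedDet k H G) (fun s => ?_) hk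
  have h1 : P * H * Q + s • (P * G * Q) = P * (H + s • G) * Q := by
    simp [Matrix.mul_add, Matrix.add_mul]
  rw [← det_add_smul_eq_sum, h1, Matrix.det_mul, Matrix.det_mul, det_add_smul_eq_sum,
    Finset.mul_sum, Finset.sum_mul]
  exact Finset.sum_congr rfl fun _ _ => by ring

/-! ### Powers of `(1,1)`-forms -/

section Forms

variable {n : ℕ}

lemma commute_ι_mul_ι (a b : Fin n ⊕ Fin n → ℂ) (z : Forms n) :
    Commute (ExteriorAlgebra.ι ℂ a * ExteriorAlgebra.ι ℂ b) z := by
  induction z using ExteriorAlgebra.induction with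
  | algebraMap r => exact (Algebra.commutes r _).symm
  | ι c =>
    have hab (x y : Fin n ⊕ Fin n → ℂ) : ExteriorAlgebra.ι ℂ x * ExteriorAlgebra.ι ℂ y
        = - (ExteriorAlgebra.ι ℂ y * ExteriorAlgebra.ι ℂ x) :=
      eq_neg_of_add_eq_zero_left (ExteriorAlgebra.ι_add_mul_swap x y)
    change _ * _ * _ = _ * (_ * _)
    rw [mul_assoc, hab b c, mul_neg, ← mul_assoc, hab a c, neg_mul, neg_neg, mul_assoc]
  | mul x y hx hy => exact hx.mul_right hy
  | add x y hx hy => exact hx.add_right hy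

lemma ι_mul_ι_sq (a b : Fin n ⊕ Fin n → ℂ) :
    (ExteriorAlgebra.ι ℂ a * ExteriorAlgebra.ι ℂ b)
      * (ExteriorAlgebra.ι ℂ a * ExteriorAlgebra.ι ℂ b) = 0 := by
  rw [← mul_assoc, (commute_ι_mul_ι a b _).eq, ← mul_assoc, ExteriorAlgebra.ι_sq_zero]
  simp

/-- The `2`-form `dzⁱ ∧ ∑ cⱼ dz̄ʲ`, as an element of the centre of the exterior algebra. -/
def rowForm (i : Fin n) : (Fin n → ℂ) →ₗ[ℂ] Subalgebra.center ℂ (Forms n) where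
  toFun c := ⟨dz i * ExteriorAlgebra.ι ℂ (Sum.elim (fun _ => (0 : ℂ)) c),
    Subalgebra.mem_center_iff.2 fun z => (commute_ι_mul_ι _ _ z).eq.symm⟩
  map_add' c d := by
    ext
    have : (Sum.elim (fun _ => (0 : ℂ)) (c + d) : Fin n ⊕ Fin n → ℂ)
        = Sum.elim (fun _ => (0 : ℂ)) c + Sum.elim (fun _ => (0 : ℂ)) d := by
      ext (i | i) <;> simp
    simp [this, mul_add]
  map_smul' r c := by
    ext
    have : (Sum.elim (fun _ => (0 : ℂ)) (r • c) : Fin n ⊕ Fin n → ℂ)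
        = r • Sum.elim (fun _ => (0 : ℂ)) c := by
      ext (i | i) <;> simp
    simp [this]

lemma rowForm_mul_self (i j : Fin n) (c : Fin n → ℂ) : rowForm i c * rowForm j c = 0 := by
  ext
  change (dz i * _) * (dz j * _) = 0
  unfold dz
  rw [← mul_assoc, (commute_ι_mul_ι _ _ _).eq, mul_assoc, mul_assoc (ExteriorAlgebra.ι ℂ _),
    ExteriorAlgebra.ι_sq_zero]
  simp

lemma rowForm_mul_self_index (i : Fin n) (c d : Fin n → ℂ) : rowForm i c * rowForm i d = 0 := by
  ext
  change (dz i * _) * (dz i * _) = 0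
  unfold dz
  rw [← mul_assoc, (commute_ι_mul_ι _ _ _).eq, ← mul_assoc, ExteriorAlgebra.ι_sq_zero]
  simp

lemma toForm_eq_sum_rowForm (H : Matrix (Fin n) (Fin n) ℂ) :
    toForm H = (((Complex.I / 2) • ∑ i, rowForm i (H i) : Subalgebra.center ℂ (Forms n)) :
      Forms n) := by
  have h (i : Fin n) : ExteriorAlgebra.ι ℂ (Sum.elim (fun _ => (0 : ℂ)) (H i) : Fin n ⊕ Fin n → ℂ)
      = ∑ j, H i j • dzbar j := by
    have : (Sum.elim (fun _ => (0 : ℂ)) (H i) : Fin n ⊕ Fin n → ℂ)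
        = ∑ j, H i j • Pi.single (Sum.inr j) (1 : ℂ) := by
      ext (k | k) <;> simp [Finset.sum_apply, Pi.single_apply]
    simp [this, map_sum, dzbar]
  simp only [toForm, SetLike.val_smul, AddSubmonoidClass.coe_finsetSum]
  congr 1
  refine Finset.sum_congr rfl fun i _ => ?_
  change _ = dz i * _
  rw [h, Finset.mul_sum]
  simp

lemma sum_pow_card_of_sq_zero {R ι : Type*} [CommRing R] (s : Finset ι) (a : ι → R)
    (ha : ∀ i, a i * a i = 0) :
    (∑ i ∈ s, a i) ^ s.card = (s.card.factorial : R) * ∏ i ∈ s, a i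
      ∧ (∑ i ∈ s, a i) ^ (s.card + 1) = 0 := by
  classical
  have key (x y : R) (hx : x * x = 0) (k : ℕ) :
      (x + y) ^ (k + 1) = y ^ (k + 1) + (k + 1 : ℕ) * x * y ^ k := by
    induction k with
    | zero => simp; ring
    | succ k ih =>
      rw [pow_succ, ih]; push_cast
      linear_combination ((k : R) + 1) * y ^ k * hx
  induction s using Finset.induction_on with
  | empty => simp
  | insert i s hi ih =>
    rw [Finset.sum_insert hi, Finset.prod_insert hi, Finset.card_insert_of_notMem hi,
      key _ _ (ha i), key _ _ (ha i), ih.2, pow_succ, ih.2, ih.1, Nat.factorial_succ]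
    refine ⟨by push_cast; ring, by ring⟩

/-- The product of the row forms is an alternating function of the rows. -/
def prodRowForm (n : ℕ) : (Fin n → ℂ) [⋀^Fin n]→ₗ[ℂ] Subalgebra.center ℂ (Forms n) where
  toMultilinearMap :=
    (MultilinearMap.mkPiAlgebra ℂ (Fin n) (Subalgebra.center ℂ (Forms n))).compLinearMap rowForm
  map_eq_zero_of_eq' v i j hv hij := by
    change ∏ k, rowForm k (v k) = 0
    rw [← Finset.mul_prod_erase _ _ (Finset.mem_univ i), ← Finset.mul_prod_erase _ _
      (Finset.mem_erase.2 ⟨hij.symm, Finset.mem_univ j⟩), ← mul_assoc, hv, rowForm_mul_self,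
      zero_mul]

lemma toForm_pow_eq (H : Matrix (Fin n) (Fin n) ℂ) :
    toForm H ^ n = (((Complex.I / 2) ^ n * n.factorial) • prodRowForm n H :
      Subalgebra.center ℂ (Forms n)) := by
  rw [toForm_eq_sum_rowForm, ← SubmonoidClass.coe_pow, smul_pow]
  have h := (sum_pow_card_of_sq_zero Finset.univ (fun i => rowForm i (H i))
    fun i => rowForm_mul_self_index i _ _).1
  rw [Finset.card_univ, Fintype.card_fin] at h
  rw [h, mul_smul]
  congr 2

lemma prodRowForm_eq_det_smul (H : Matrix (Fin n) (Fin n) ℂ) :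
    prodRowForm n H = H.det • prodRowForm n (1 : Matrix (Fin n) (Fin n) ℂ) := by
  let e := Pi.basisFun ℂ (Fin n)
  have h : prodRowForm n = (LinearMap.toSpanSingleton ℂ _ (prodRowForm n
      (1 : Matrix (Fin n) (Fin n) ℂ))).compAlternatingMap Matrix.detRowAlternating := by
    refine Module.Basis.ext_alternating e fun i hi => ?_
    let σ : Equiv.Perm (Fin n) := Equiv.ofBijective i (Finite.injective_iff_bijective.1 hi)
    have he : (⇑e : Fin n → Fin n → ℂ) = (1 : Matrix (Fin n) (Fin n) ℂ) := by
      ext j k; simp [e, Matrix.one_apply, Pi.single_apply, eq_comm]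
    have h1 (f : (Fin n → ℂ) [⋀^Fin n]→ₗ[ℂ] Subalgebra.center ℂ (Forms n)) :
        f (fun j => e (i j)) = Equiv.Perm.sign σ • f e := f.map_perm e σ
    rw [h1, h1, he]
    congr 1
    have hdet : Matrix.detRowAlternating (1 : Matrix (Fin n) (Fin n) ℂ) = 1 := Matrix.det_one
    refine (one_smul ℂ _).symm.trans ?_
    rw [← hdet]
    rfl
  exact congrArg (fun f => f H) h

lemma toForm_pow (H : Matrix (Fin n) (Fin n) ℂ) :
    toForm H ^ n = H.det • toForm (1 : Matrix (Fin n) (Fin n) ℂ) ^ n := by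
  rw [toForm_pow_eq, toForm_pow_eq, prodRowForm_eq_det_smul]
  simp only [SetLike.val_smul, smul_smul]
  ring_nf

/-- The wedge product of a list that enumerates the standard basis is nonzero, being detected by
the determinant. -/
lemma list_prod_ι_ne_zero (l : List (Fin n ⊕ Fin n)) (hl : l.Nodup) (hl' : ∀ x, x ∈ l) :
    (l.map fun x => ExteriorAlgebra.ι ℂ (Pi.single x (1 : ℂ) : Fin n ⊕ Fin n → ℂ)).prod ≠ 0 := by
  let e := hl.getEquivOfForallMemList l hl'
  let b := (Pi.basisFun ℂ (Fin n ⊕ Fin n)).reindex e.symm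
  have h1 : (l.map fun x => ExteriorAlgebra.ι ℂ (Pi.single x (1 : ℂ) : Fin n ⊕ Fin n → ℂ)).prod
      = ExteriorAlgebra.ιMulti ℂ l.length b := by
    rw [ExteriorAlgebra.ιMulti_apply]
    congr 1
    refine List.ext_get (by simp) fun i h1 h2 => ?_
    simp [b, e]
  intro h0
  have h2 := ExteriorAlgebra.liftAlternating_apply_ιMulti (R := ℂ) (N := ℂ)
    (fun i => if h : i = l.length then h ▸ b.det else 0) b
  rw [← h1, h0] at h2
  simp only [dite_true, map_zero] at h2
  exact zero_ne_one (h2.trans b.det_self)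

lemma toForm_one_pow_ne_zero : toForm (1 : Matrix (Fin n) (Fin n) ℂ) ^ n ≠ 0 := by
  have h1 : ((prodRowForm n (1 : Matrix (Fin n) (Fin n) ℂ) : Subalgebra.center ℂ (Forms n)) :
      Forms n) = (((List.finRange n).flatMap fun i => [Sum.inl i, Sum.inr i]).map
        fun x => ExteriorAlgebra.ι ℂ (Pi.single x (1 : ℂ) : Fin n ⊕ Fin n → ℂ)).prod := by
    change ((∏ k, rowForm k ((1 : Matrix (Fin n) (Fin n) ℂ) k) :
      Subalgebra.center ℂ (Forms n)) : Forms n) = _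
    rw [← List.prod_ofFn, List.ofFn_eq_map]
    have := map_list_prod (Subalgebra.center ℂ (Forms n)).val
      ((List.finRange n).map fun k => rowForm k ((1 : Matrix (Fin n) (Fin n) ℂ) k))
    refine this.trans ?_
    rw [List.map_flatMap, List.flatMap_def, List.prod_flatten, List.map_map, List.map_map]
    congr 1
    refine List.map_congr_left fun i _ => ?_
    change dz i * ExteriorAlgebra.ι ℂ _ = _
    have : (Sum.elim (fun _ => (0 : ℂ)) ((1 : Matrix (Fin n) (Fin n) ℂ) i) : Fin n ⊕ Fin n → ℂ)
        = Pi.single (Sum.inr i) 1 := by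
      ext (k | k) <;> simp [Pi.single_apply, Matrix.one_apply, eq_comm]
    simp [this, dz]
  rw [toForm_pow_eq, SetLike.val_smul, h1]
  refine smul_ne_zero (mul_ne_zero (pow_ne_zero _ (by simp)) (by positivity)) ?_
  refine list_prod_ι_ne_zero _ ?_ ?_
  · refine List.nodup_flatMap.2 ⟨by simp, ?_⟩
    refine (List.nodup_finRange n).imp fun {a b} hab => ?_
    simp [hab, List.disjoint_left]
  · rintro (i | i) <;> simp

lemma toForm_add (A B : Matrix (Fin n) (Fin n) ℂ) : toForm (A + B) = toForm A + toForm B := by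
  simp [toForm, add_smul, Finset.sum_add_distrib]

lemma toForm_smul (s : ℂ) (A : Matrix (Fin n) (Fin n) ℂ) : toForm (s • A) = s • toForm A := by
  simp only [toForm, Matrix.smul_apply, smul_eq_mul, mul_smul, ← Finset.smul_sum]
  rw [smul_comm]

lemma commute_toForm (A : Matrix (Fin n) (Fin n) ℂ) (z : Forms n) : Commute (toForm A) z := by
  rw [toForm_eq_sum_rowForm]
  exact (Subalgebra.mem_center_iff.1 (Subtype.prop _) z).symm

/-- A linear functional reading off the coefficient of an `(n,n)`-form. -/
lemma exists_topCoeff (n : ℕ) : ∃ l : Forms n →ₗ[ℂ] ℂ,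
    l (toForm (1 : Matrix (Fin n) (Fin n) ℂ) ^ n) = 1 := by
  obtain ⟨l, hl⟩ := Module.Projective.exists_dual_ne_zero ℂ (toForm_one_pow_ne_zero (n := n))
  exact ⟨(l (toForm (1 : Matrix (Fin n) (Fin n) ℂ) ^ n))⁻¹ • l, by simp [hl]⟩

lemma topCoeff_toForm_pow {l : Forms n →ₗ[ℂ] ℂ}
    (hl : l (toForm (1 : Matrix (Fin n) (Fin n) ℂ) ^ n) = 1) (H : Matrix (Fin n) (Fin n) ℂ) :
    l (toForm H ^ n) = H.det := by
  rw [toForm_pow, map_smul, hl, smul_eq_mul, mul_one]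

lemma mixedDet_eq_topCoeff {l : Forms n →ₗ[ℂ] ℂ}
    (hl : l (toForm (1 : Matrix (Fin n) (Fin n) ℂ) ^ n) = 1) (H G : Matrix (Fin n) (Fin n) ℂ)
    {k : ℕ} (hk : k ≤ n) :
    mixedDet k H G = n.choose k * l (toForm H ^ (n - k) * toForm G ^ k) := by
  refine coeff_eq_of_forall_sum_pow (n := n) (a := fun k => mixedDet k H G)
    (b := fun k => n.choose k * l (toForm H ^ (n - k) * toForm G ^ k)) (fun s => ?_) hk
  rw [← det_add_smul_eq_sum, ← topCoeff_toForm_pow hl, add_comm, toForm_add, toForm_smul,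
    (commute_toForm _ _ |>.smul_left s).add_pow, map_sum]
  refine Finset.sum_congr rfl fun k _ => ?_
  rw [smul_pow, smul_mul_assoc, smul_mul_assoc, map_smul, smul_eq_mul, ← nsmul_eq_mul', map_nsmul,
    nsmul_eq_mul, ((commute_toForm G _).pow_left k).eq]

lemma toForm_vecMulVec_sq (ξ : Fin n → ℂ) :
    toForm (Matrix.vecMulVec ξ (star ξ)) * toForm (Matrix.vecMulVec ξ (star ξ)) = 0 := by
  have h : toForm (Matrix.vecMulVec ξ (star ξ)) = (Complex.I / 2) •
      (ExteriorAlgebra.ι ℂ (∑ i, ξ i • Pi.single (Sum.inl i) 1 : Fin n ⊕ Fin n → ℂ)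
        * ExteriorAlgebra.ι ℂ (∑ j, star (ξ j) • Pi.single (Sum.inr j) 1 : Fin n ⊕ Fin n → ℂ)) := by
    simp only [toForm, map_sum, Finset.sum_mul_sum, map_smul, Matrix.vecMulVec_apply, dz, dzbar,
      Pi.star_apply, smul_mul_smul_comm]
  rw [h, smul_mul_smul_comm, ι_mul_ι_sq, smul_zero]

lemma add_pow_of_sq_zero {R : Type*} [Ring R] {x r : R} (h : Commute x r) (hr : r * r = 0)
    (k : ℕ) : (x + r) ^ k = x ^ k + (k : R) * (x ^ (k - 1) * r) := by
  induction k with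
  | zero => simp
  | succ k ih =>
    rw [pow_succ, ih, add_mul, mul_add, mul_add, mul_assoc (k : R), mul_assoc (k : R),
      mul_assoc _ r r, hr, mul_zero, mul_zero, add_zero, mul_assoc _ r x, ← h.eq, ← mul_assoc _ x r,
      ← pow_succ, ← pow_succ]
    rcases k with _ | k
    · simp
    · simp only [Nat.add_sub_cancel, Nat.cast_add, Nat.cast_one, add_mul, one_mul]
      abel

/-- The equation `χ_u ^ n = ψ χ_u ^ (n - α) ∧ ω ^ α` in terms of mixed discriminants. -/
lemma mixedDet_of_toForm_eq {α : ℕ} (hα : α ≤ n) {H G : Matrix (Fin n) (Fin n) ℂ} {c : ℝ}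
    (hc : 0 < c) (h : toForm H ^ n = (c : ℂ) • (toForm H ^ (n - α) * toForm G ^ α)) :
    mixedDet α H G = ((n.choose α / c : ℝ) : ℂ) * H.det := by
  obtain ⟨l, hl⟩ := exists_topCoeff n
  have := congrArg l h
  rw [topCoeff_toForm_pow hl, map_smul, smul_eq_mul] at this
  rw [this, mixedDet_eq_topCoeff hl _ _ hα]
  have : (c : ℂ) ≠ 0 := by exact_mod_cast hc.ne'
  push_cast
  field_simp

/-- The two sides of the equation are affine functions of `s` along `B + s ξ ξ*`, because
`ξ ∧ ξ̄` has square zero; the cone condition says that the slope of their difference is positive. -/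
lemma exists_mixedDet_lt_of_isPosCodimOne {α : ℕ} (hα : α ≤ n)
    {B G : Matrix (Fin n) (Fin n) ℂ} {c : ℝ} (hc : 0 < c)
    (h : IsPosCodimOne ((n : ℂ) • toForm B ^ (n - 1)
      - (((n : ℂ) - (α : ℂ)) * (c : ℂ)) • (toForm B ^ (n - α - 1) * toForm G ^ α)))
    {ξ : Fin n → ℂ} (hξ : ξ ≠ 0) :
    ∃ s : ℝ, 0 < s ∧ 0 < (((n.choose α / c : ℝ) : ℂ)
        * (B + (s : ℂ) • Matrix.vecMulVec ξ (star ξ)).det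
      - mixedDet α (B + (s : ℂ) • Matrix.vecMulVec ξ (star ξ)) G).re := by
  obtain ⟨l, hl⟩ := exists_topCoeff n
  obtain ⟨d, hd, hd'⟩ := h ξ hξ
  set R := Matrix.vecMulVec ξ (star ξ)
  have hd2 := congrArg l hd'
  rw [map_smul, hl, sub_mul, map_sub, smul_mul_assoc, smul_mul_assoc, map_smul, map_smul] at hd2
  simp only [smul_eq_mul, mul_one] at hd2
  have hN : (0 : ℝ) < n.choose α := by exact_mod_cast Nat.choose_pos hα
  have hcN : 0 < (n.choose α / c : ℝ) := by positivity
  have key (s : ℝ) : ((n.choose α / c : ℝ) : ℂ) * (B + (s : ℂ) • R).det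
      - mixedDet α (B + (s : ℂ) • R) G
      = (((n.choose α / c : ℝ) : ℂ) * B.det - mixedDet α B G)
        + ((s * (n.choose α / c * d) : ℝ) : ℂ) := by
    have hsq : ((s : ℂ) • toForm R) * ((s : ℂ) • toForm R) = 0 := by
      rw [smul_mul_smul_comm, toForm_vecMulVec_sq, smul_zero]
    have hcomm : Commute (toForm B) ((s : ℂ) • toForm R) := commute_toForm _ _
    have hnα : ((n - α : ℕ) : ℂ) = (n : ℂ) - α := by push_cast [hα]; ring
    have e1 : l ((toForm B + (s : ℂ) • toForm R) ^ n)
        = l (toForm B ^ n) + n * s * l (toForm B ^ (n - 1) * toForm R) := by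
      rw [add_pow_of_sq_zero hcomm hsq, map_add, ← nsmul_eq_mul, map_nsmul, mul_smul_comm,
        map_smul, nsmul_eq_mul, smul_eq_mul, mul_assoc]
    have e2 : l ((toForm B + (s : ℂ) • toForm R) ^ (n - α) * toForm G ^ α)
        = l (toForm B ^ (n - α) * toForm G ^ α)
          + (n - α) * s * l (toForm B ^ (n - α - 1) * toForm G ^ α * toForm R) := by
      rw [add_pow_of_sq_zero hcomm hsq, add_mul, map_add, ← nsmul_eq_mul, smul_mul_assoc,
        map_nsmul, mul_smul_comm, smul_mul_assoc, map_smul, nsmul_eq_mul, smul_eq_mul, hnα,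
        mul_assoc (toForm B ^ _), (commute_toForm R _).eq, ← mul_assoc (toForm B ^ _)]
      ring
    rw [← topCoeff_toForm_pow hl, ← topCoeff_toForm_pow hl, mixedDet_eq_topCoeff hl _ _ hα,
      mixedDet_eq_topCoeff hl _ _ hα, toForm_add, toForm_smul, e1, e2]
    have : (c : ℂ) ≠ 0 := by exact_mod_cast hc.ne'
    push_cast
    rw [← hd2]
    field_simp
    ring
  set a := (((n.choose α / c : ℝ) : ℂ) * B.det - mixedDet α B G).re
  refine ⟨(|a| + 1) / (n.choose α / c * d), by positivity, ?_⟩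
  rw [key, Complex.add_re, Complex.ofReal_re, div_mul_cancel₀ _ (by positivity)]
  change 0 < a + (|a| + 1)
  linarith [neg_abs_le a]

end Forms

/-! ### Triangular lower bounds for mixed discriminants -/

section Fischer

variable {n : ℕ}

lemma conjTranspose_mul_mul_apply (H Y : Matrix (Fin n) (Fin n) ℂ) (i j : Fin n) :
    (Y.conjTranspose * H * Y) i j = star (Y.col i) ⬝ᵥ H.mulVec (Y.col j) := by
  rw [Matrix.mul_assoc, Matrix.mul_apply]
  rfl

/-- Cauchy–Schwarz for a positive matrix `H`, normalised by `w* H y = 1`. -/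
lemma one_le_mul_of_posDef {H : Matrix (Fin n) (Fin n) ℂ} (hH : H.PosDef) {w y : Fin n → ℂ}
    {r : ℝ} (hr : 0 < r) (hy : star y ⬝ᵥ H.mulVec y = r) (hwy : star w ⬝ᵥ H.mulVec y = 1) :
    1 ≤ r * (star w ⬝ᵥ H.mulVec w).re := by
  have hyw : star y ⬝ᵥ H.mulVec w = 1 := by
    have h1 : star (star w ⬝ᵥ H.mulVec y) = 1 := by rw [hwy, star_one]
    rwa [← Matrix.star_dotProduct_star, star_star, Matrix.star_mulVec, hH.isHermitian.eq,
      ← Matrix.dotProduct_mulVec] at h1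
  have h0 := (Complex.le_def.1 (hH.posSemidef.dotProduct_mulVec_nonneg
    (w - ((1 / r : ℝ) : ℂ) • y))).1
  have h2 : star (w - ((1 / r : ℝ) : ℂ) • y) ⬝ᵥ H.mulVec (w - ((1 / r : ℝ) : ℂ) • y)
      = star w ⬝ᵥ H.mulVec w - ((1 / r : ℝ) : ℂ) := by
    simp only [star_sub, star_smul, Matrix.mulVec_sub, Matrix.mulVec_smul, sub_dotProduct,
      dotProduct_sub, smul_dotProduct, dotProduct_smul, hy, hwy, hyw, smul_eq_mul,
      Complex.star_def, Complex.conj_ofReal]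
    have : (r : ℂ) ≠ 0 := by exact_mod_cast hr.ne'
    push_cast
    field_simp
    ring
  rw [h2, Complex.sub_re, Complex.ofReal_re] at h0
  have := mul_le_mul_of_nonneg_left (sub_nonneg.1 h0) hr.le
  simpa [hr.ne'] using this

/-- Replacing one more row of `H` by the corresponding row of the identity multiplies the
determinant by a positive number `y`, namely a diagonal entry of the inverse. Every value
`w* H w` with `wᵢ = 1` and `w` supported off the rows replaced before is at least `1 / y`. -/
lemma exists_det_insert_eq {H : Matrix (Fin n) (Fin n) ℂ} (hH : H.PosDef) {J : Finset (Fin n)}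
    {i : Fin n} (hi : i ∉ J)
    (hJ : (replaceRows J 1 H).det ≠ 0) :
    ∃ r : ℝ, 0 < r ∧ (replaceRows (insert i J) 1 H).det
        = (replaceRows J 1 H).det * r ∧
      ∀ w : Fin n → ℂ, w i = 1 → (∀ k ∈ J, w k = 0) → 1 ≤ r * (star w ⬝ᵥ H.mulVec w).re := by
  set R : Matrix (Fin n) (Fin n) ℂ := replaceRows J 1 H with hR
  have hu : IsUnit R.det := isUnit_iff_ne_zero.2 hJ
  set y : Fin n → ℂ := R⁻¹.mulVec (Pi.single i 1) with hy
  have hRy : R.mulVec y = Pi.single i 1 := by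
    rw [hy, Matrix.mulVec_mulVec, Matrix.mul_nonsing_inv _ hu, Matrix.one_mulVec]
  have hin (k : Fin n) (hk : k ∈ J) : R.mulVec y k = y k := by
    simp [hR, Matrix.mulVec, dotProduct, replaceRows_apply, hk, Matrix.one_apply]
  have hout (k : Fin n) (hk : k ∉ J) : R.mulVec y k = H.mulVec y k := by
    simp [hR, Matrix.mulVec, dotProduct, replaceRows_apply, hk]
  have hyin (k : Fin n) (hk : k ∈ J) : y k = 0 := by
    rw [← hin k hk, hRy, Pi.single_eq_of_ne]
    rintro rfl; exact hi hk
  have hyout (k : Fin n) (hk : k ∉ J) : H.mulVec y k = (Pi.single i 1 : Fin n → ℂ) k := by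
    rw [← hRy, hout k hk]
  have hw (w : Fin n → ℂ) (hwJ : ∀ k ∈ J, w k = 0) : star w ⬝ᵥ H.mulVec y = star (w i) := by
    rw [← Pi.star_apply, ← dotProduct_single_one (star w) i]
    refine Finset.sum_congr rfl fun k _ => ?_
    by_cases hk : k ∈ J
    · simp [hwJ k hk]
    · rw [hyout k hk]
  have hy0 : y ≠ 0 := by
    intro h
    have := congrFun hRy i
    simp [h] at this
  have hpos : 0 < star (y i) := by
    rw [← hw y hyin]
    exact hH.dotProduct_mulVec_pos hy0
  obtain ⟨hre, him⟩ := Complex.lt_def.1 hpos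
  have hyi : y i = ((y i).re : ℂ) := by
    apply Complex.ext
    · simp
    · simpa using him
  refine ⟨(y i).re, by simpa using hre, ?_, fun w hwi hwJ => ?_⟩
  · have h1 : replaceRows (insert i J) 1 H = R.updateRow i (Pi.single i 1) := by
      ext k l
      by_cases hk : k = i
      · subst hk
        simp [replaceRows_apply, Matrix.one_apply, Pi.single_apply, eq_comm]
      · simp [replaceRows_apply, hk, hR]
    have h2 : y i = R⁻¹ i i := by rw [hy, Matrix.mulVec_single_one]; rfl
    rw [h1, ← Matrix.adjugate_apply, ← hyi, h2, Matrix.inv_def, Matrix.smul_apply, smul_eq_mul,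
      ← mul_assoc, Ring.mul_inverse_cancel _ hu, one_mul]
  · refine one_le_mul_of_posDef hH (y := y) (by simpa using hre) ?_ (by rw [hw w hwJ, hwi, star_one])
    rw [hw y hyin, ← hyi]
    nth_rewrite 1 [hyi]
    rw [Complex.star_def, Complex.conj_ofReal, ← hyi]

lemma det_replaceRows_one_pos {H : Matrix (Fin n) (Fin n) ℂ} (hH : H.PosDef) (J : Finset (Fin n)) :
    0 < (replaceRows J 1 H).det := by
  induction J using Finset.induction_on with
  | empty =>
    have : replaceRows ∅ 1 H = H := by ext; simp [replaceRows_apply]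
    rw [this]
    exact hH.det_pos
  | insert i J hi ih =>
    obtain ⟨r, hr, h, -⟩ := exists_det_insert_eq hH hi ih.ne'
    rw [h]
    exact mul_pos ih (by exact_mod_cast hr)

/-- A matrix is unipotent upper triangular. -/
def IsUnipotentUpper (Y : Matrix (Fin n) (Fin n) ℂ) : Prop :=
  (∀ i, Y i i = 1) ∧ ∀ i j, j < i → Y i j = 0

lemma isUnipotentUpper_one : IsUnipotentUpper (1 : Matrix (Fin n) (Fin n) ℂ) :=
  ⟨fun i => Matrix.one_apply_eq i, fun _ _ h => Matrix.one_apply_ne h.ne'⟩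

lemma IsUnipotentUpper.blockTriangular {Y : Matrix (Fin n) (Fin n) ℂ} (hY : IsUnipotentUpper Y) :
    Y.BlockTriangular id := fun i j h => hY.2 i j h

lemma IsUnipotentUpper.det {Y : Matrix (Fin n) (Fin n) ℂ} (hY : IsUnipotentUpper Y) :
    Y.det = 1 := by
  rw [Matrix.det_of_isUpperTriangular hY.blockTriangular]
  exact Finset.prod_eq_one fun i _ => hY.1 i

lemma IsUnipotentUpper.inv_mul {M Y : Matrix (Fin n) (Fin n) ℂ} (hM : IsUnipotentUpper M)
    (hY : IsUnipotentUpper Y) : IsUnipotentUpper (M⁻¹ * Y) := by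
  have hu : IsUnit M.det := by rw [hM.det]; exact isUnit_one
  let := M.invertibleOfIsUnitDet hu
  have hT : (M⁻¹ * Y).BlockTriangular id :=
    (Matrix.blockTriangular_inv_of_blockTriangular hM.blockTriangular).mul hY.blockTriangular
  refine ⟨fun i => ?_, fun i j h => hT h⟩
  have h1 : (M * (M⁻¹ * Y)) i i = 1 := by
    rw [← Matrix.mul_assoc, Matrix.mul_nonsing_inv _ hu, Matrix.one_mul, hY.1]
  rw [Matrix.mul_apply, Finset.sum_eq_single i, hM.1, one_mul] at h1
  · exact h1
  · intro k _ hk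
    rcases lt_or_gt_of_ne hk with h | h
    · rw [hM.2 i k h, zero_mul]
    · rw [hT h, mul_zero]
  · simp

lemma posDef_conj {H Y : Matrix (Fin n) (Fin n) ℂ} (hH : H.PosDef) (hY : Y.det ≠ 0) :
    (Y.conjTranspose * H * Y).PosDef := by
  refine hH.conjTranspose_mul_mul_same ?_
  exact Matrix.mulVec_injective_of_isUnit
    ((Matrix.isUnit_iff_isUnit_det _).2 (isUnit_iff_ne_zero.2 hY))

lemma posDef_diag_pos {H : Matrix (Fin n) (Fin n) ℂ} (hH : H.PosDef) (i : Fin n) :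
    0 < (H i i).re := (Complex.lt_def.1 hH.diag_pos).1

/-- Fischer's inequality in triangular form. -/
lemma det_le_det_replaceRows_mul_prod {H T : Matrix (Fin n) (Fin n) ℂ} (hH : H.PosDef)
    (hT : IsUnipotentUpper T) (J : Finset (Fin n)) :
    H.det.re ≤ ((replaceRows J 1 H).det).re
      * ∏ i ∈ J, ((T.conjTranspose * H * T) i i).re := by
  induction J using Finset.induction_on_min with
  | empty =>
    have : replaceRows ∅ 1 H = H := by ext; simp [replaceRows_apply]
    simp [this]
  | insert i J hlt ih =>
    have hi : i ∉ J := fun h => lt_irrefl _ (hlt i h)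
    -- rows are replaced in decreasing order, so `T eᵢ` vanishes at the rows replaced before
    obtain ⟨r, hr, h, hw⟩ := exists_det_insert_eq hH hi (det_replaceRows_one_pos hH J).ne'
    have h1 := hw (T.col i) (hT.1 i) fun k hk => hT.2 k i (hlt k hk)
    rw [← conjTranspose_mul_mul_apply] at h1
    rw [Finset.prod_insert hi, h, Complex.re_mul_ofReal]
    refine ih.trans ?_
    have h2 : 0 ≤ ((replaceRows J 1 H).det).re
        * ∏ i ∈ J, ((T.conjTranspose * H * T) i i).re :=
      mul_nonneg (Complex.lt_def.1 (det_replaceRows_one_pos hH J)).1.le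
        (Finset.prod_nonneg fun k _ =>
          (posDef_diag_pos (posDef_conj hH (by rw [hT.det]; exact one_ne_zero)) k).le)
    nlinarith

/-- The lower bound behind all estimates: if `M* G M = diag δ` with `M` unipotent upper
triangular, then `σ_k(H⁻¹ G)` is at least the `k`-th elementary symmetric function of the
quotients of `δᵢ` by the diagonal entries of `Y* H Y`, for any unipotent upper triangular `Y`. -/
lemma det_mul_sum_prod_le_mixedDet {k : ℕ} (hk : k ≤ n) {H G M Y : Matrix (Fin n) (Fin n) ℂ}
    {δ : Fin n → ℝ} (hH : H.PosDef) (hM : IsUnipotentUpper M) (hY : IsUnipotentUpper Y)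
    (hδ : ∀ i, 0 < δ i)
    (hG : M.conjTranspose * G * M = Matrix.diagonal fun i => (δ i : ℂ)) :
    H.det.re * ∑ J ∈ Finset.univ.powersetCard k,
        ∏ i ∈ J, δ i / ((Y.conjTranspose * H * Y) i i).re ≤ (mixedDet k H G).re := by
  set H' := M.conjTranspose * H * M
  have hH' : H'.PosDef := posDef_conj hH (by rw [hM.det]; exact one_ne_zero)
  have hdet : H'.det = H.det := by
    simp [H', Matrix.det_mul, Matrix.det_conjTranspose, hM.det]
  have hmix : mixedDet k H G = mixedDet k H' (Matrix.diagonal fun i => (δ i : ℂ)) := by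
    rw [← hG, mixedDet_conj hk, Matrix.det_conjTranspose, hM.det]; simp
  have hT := hM.inv_mul hY
  have hu : IsUnit M.det := by rw [hM.det]; exact isUnit_one
  have hconj : (M⁻¹ * Y).conjTranspose * H' * (M⁻¹ * Y) = Y.conjTranspose * H * Y := by
    have h1 : M * (M⁻¹ * Y) = Y := by
      rw [← Matrix.mul_assoc, Matrix.mul_nonsing_inv _ hu, Matrix.one_mul]
    calc _ = (M * (M⁻¹ * Y)).conjTranspose * H * (M * (M⁻¹ * Y)) := by
          rw [Matrix.conjTranspose_mul M]; simp only [H', Matrix.mul_assoc]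
      _ = _ := by rw [h1]
  have hd (i : Fin n) : 0 < ((Y.conjTranspose * H * Y) i i).re :=
    posDef_diag_pos (posDef_conj hH (by rw [hY.det]; exact one_ne_zero)) i
  rw [hmix, mixedDet, Complex.re_sum, Finset.mul_sum]
  refine Finset.sum_le_sum fun J _ => ?_
  have h1 := det_le_det_replaceRows_mul_prod hH' hT J
  rw [hconj, hdet] at h1
  rw [← Matrix.mul_one (Matrix.diagonal _), det_replaceRows_diagonal_mul,
    ← Complex.ofReal_prod, Complex.re_ofReal_mul, Finset.prod_div_distrib]
  have hp : 0 < ∏ i ∈ J, ((Y.conjTranspose * H * Y) i i).re := Finset.prod_pos fun i _ => hd i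
  rw [mul_div_assoc', div_le_iff₀ hp]
  have := mul_le_mul_of_nonneg_left h1 (Finset.prod_nonneg fun i (_ : i ∈ J) => (hδ i).le)
  linarith

end Fischer

/-! ### Diagonalisation by triangular matrices -/

section LDL

variable {n : ℕ}

lemma exists_unipotentUpper_conj_eq_diagonal {G : Matrix (Fin n) (Fin n) ℂ} (hG : G.PosDef) :
    ∃ (M : Matrix (Fin n) (Fin n) ℂ) (δ : Fin n → ℝ), IsUnipotentUpper M ∧ (∀ i, 0 < δ i) ∧
      M.conjTranspose * G * M = Matrix.diagonal fun i => (δ i : ℂ) := by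
  set L := LDL.lowerInv hG
  have hLtri : L.BlockTriangular OrderDual.toDual := fun i j h => LDL.lowerInv_triangular hG h
  have hLdet : L.det ≠ 0 := by
    let := LDL.invertibleLowerInv hG
    exact (Matrix.isUnit_det_of_invertible L).ne_zero
  have hLii (i : Fin n) : L i i ≠ 0 := by
    rw [Matrix.det_of_isLowerTriangular _ hLtri] at hLdet
    exact Finset.prod_ne_zero_iff.1 hLdet i (Finset.mem_univ i)
  set M : Matrix (Fin n) (Fin n) ℂ :=
    (Matrix.diagonal (fun i => (L i i)⁻¹) * L).conjTranspose with hM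
  have hMu : IsUnipotentUpper M := by
    refine ⟨fun i => ?_, fun i j h => ?_⟩
    · simp [hM, Matrix.conjTranspose_apply, hLii]
    · have : L j i = 0 := LDL.lowerInv_triangular hG h
      rw [hM, Matrix.conjTranspose_apply, Matrix.diagonal_mul, this]
      simp
  have hP : (M.conjTranspose * G * M).PosDef :=
    posDef_conj hG (by rw [hMu.det]; exact one_ne_zero)
  refine ⟨M, fun i => ((M.conjTranspose * G * M) i i).re, hMu, fun i => posDef_diag_pos hP i, ?_⟩
  have hdiag : M.conjTranspose * G * M = Matrix.diagonal (fun i => (L i i)⁻¹) * LDL.diag hG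
      * (Matrix.diagonal (fun i => (L i i)⁻¹)).conjTranspose := by
    rw [LDL.diag_eq_lowerInv_conj, hM, Matrix.conjTranspose_conjTranspose,
      Matrix.conjTranspose_mul]
    simp only [Matrix.mul_assoc, L]
  ext i j
  by_cases hij : i = j
  · subst hij
    rw [Matrix.diagonal_apply_eq]
    have := hP.isHermitian.apply i i
    exact (Complex.conj_eq_iff_re.1 this).symm
  · rw [Matrix.diagonal_apply_ne _ hij, hdiag, LDL.diag, Matrix.diagonal_conjTranspose,
      Matrix.diagonal_mul_diagonal, Matrix.diagonal_mul_diagonal, Matrix.diagonal_apply_ne _ hij]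

/-- A Hermitian form that differs from the identity by `ε` has, on vectors with `i`-th
coordinate `1`, values at least its value on `eᵢ` up to an error quadratic in `ε`. -/
lemma diag_sub_le_dotProduct_mulVec {G : Matrix (Fin n) (Fin n) ℂ}
    {ε : ℝ} (hε : 0 ≤ ε) (hnε : n * ε ≤ 1 / 2)
    (hG1 : ∀ i j, ‖G i j - (1 : Matrix (Fin n) (Fin n) ℂ) i j‖ ≤ ε) (y : Fin n → ℂ) (i : Fin n)
    (hy : y i = 1) :
    (G i i).re - 2 * n * ε ^ 2 ≤ (star y ⬝ᵥ G.mulVec y).re := by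
  set v : Fin n → ℂ := y - Pi.single i 1 with hv
  have hvi : v i = 0 := by simp [hv, hy]
  have hyv : y = Pi.single i 1 + v := by simp [hv]
  set E := G - 1 with hE
  have hGE : G = 1 + E := by simp [hE]
  have hEb (a b : Fin n) : ‖E a b‖ ≤ ε := hG1 a b
  set S := ∑ k, ‖v k‖ with hS
  have hS2 : S ^ 2 ≤ n * ∑ k, ‖v k‖ ^ 2 := by
    simpa using sq_sum_le_card_mul_sum_sq (s := (Finset.univ : Finset (Fin n))) (f := fun k => ‖v k‖)
  have e1 : star y ⬝ᵥ G.mulVec y = G i i + ((star v ⬝ᵥ E.mulVec (Pi.single i 1))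
      + ((star (Pi.single i 1) ⬝ᵥ E.mulVec v) + (star v ⬝ᵥ E.mulVec v))) + star v ⬝ᵥ v := by
    rw [hyv, hGE]
    have h1 : star (Pi.single i (1 : ℂ) : Fin n → ℂ) = Pi.single i 1 := by
      rw [Pi.star_def]; ext k; by_cases h : k = i
      · subst h; simp
      · simp [h]
    have h2 : (1 + E).col i = Pi.single i 1 + E.col i := by
      ext k; simp [Matrix.one_apply, Pi.single_apply]
    have h3 : star v ⬝ᵥ (Pi.single i 1 : Fin n → ℂ) = 0 := by
      rw [dotProduct_single_one, Pi.star_apply, hvi, star_zero]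
    simp only [Matrix.add_mulVec, Matrix.one_mulVec, Matrix.mulVec_add, star_add, add_dotProduct,
      dotProduct_add, h1, h2, h3, single_one_dotProduct, Matrix.add_apply,
      Matrix.one_apply_eq, Matrix.mulVec_single_one, hvi, Matrix.col_apply]
    rw [Pi.single_eq_same]
    ring
  have b1 : ‖star v ⬝ᵥ E.mulVec (Pi.single i 1)‖ ≤ ε * S := by
    rw [Matrix.mulVec_single_one, dotProduct, hS, Finset.mul_sum]
    refine (norm_sum_le _ _).trans (Finset.sum_le_sum fun k _ => ?_)
    rw [norm_mul, Pi.star_apply, norm_star, mul_comm]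
    exact mul_le_mul_of_nonneg_right (hEb k i) (norm_nonneg _)
  have bE (a : Fin n) : ‖E.mulVec v a‖ ≤ ε * S := by
    rw [Matrix.mulVec, dotProduct, hS, Finset.mul_sum]
    refine (norm_sum_le _ _).trans (Finset.sum_le_sum fun k _ => ?_)
    rw [norm_mul]
    exact mul_le_mul_of_nonneg_right (hEb a k) (norm_nonneg _)
  have b2 : ‖star (Pi.single i (1 : ℂ)) ⬝ᵥ E.mulVec v‖ ≤ ε * S := by
    have h1 : star (Pi.single i (1 : ℂ) : Fin n → ℂ) = Pi.single i 1 := by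
      rw [Pi.star_def]; ext k; by_cases h : k = i
      · subst h; simp
      · simp [h]
    rw [h1, single_one_dotProduct]
    exact bE i
  have b3 : ‖star v ⬝ᵥ E.mulVec v‖ ≤ ε * S ^ 2 := by
    rw [dotProduct]
    calc _ ≤ ∑ k, ‖v k‖ * (ε * S) := by
          refine (norm_sum_le _ _).trans (Finset.sum_le_sum fun k _ => ?_)
          rw [norm_mul, Pi.star_apply, norm_star]
          exact mul_le_mul_of_nonneg_left (bE k) (norm_nonneg _)
      _ = ε * S ^ 2 := by rw [← Finset.sum_mul, ← hS]; ring
  have e4 : (star v ⬝ᵥ v).re = ∑ k, ‖v k‖ ^ 2 := by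
    rw [dotProduct, Complex.re_sum]
    refine Finset.sum_congr rfl fun k _ => ?_
    rw [Pi.star_apply, Complex.star_def, mul_comm, Complex.mul_conj, Complex.ofReal_re,
      Complex.normSq_eq_norm_sq]
  have c1 := (abs_le.1 ((Complex.abs_re_le_norm _).trans b1)).1
  have c2 := (abs_le.1 ((Complex.abs_re_le_norm _).trans b2)).1
  have c3 := (abs_le.1 ((Complex.abs_re_le_norm _).trans b3)).1
  have c5 : 2 * ε * S ≤ (1 / 2) * ∑ k, ‖v k‖ ^ 2 + 2 * n * ε ^ 2 := by
    have : (2 * n * ε ^ 2 : ℝ) = ∑ _k : Fin n, 2 * ε ^ 2 := by simp; ring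
    rw [this, hS, Finset.mul_sum, Finset.mul_sum, ← Finset.sum_add_distrib]
    exact Finset.sum_le_sum fun k _ => by nlinarith [sq_nonneg (‖v k‖ - 2 * ε)]
  have c6 : ε * S ^ 2 ≤ (1 / 2) * ∑ k, ‖v k‖ ^ 2 := by
    have h0 : 0 ≤ ∑ k, ‖v k‖ ^ 2 := Finset.sum_nonneg fun k _ => by positivity
    nlinarith [mul_le_mul_of_nonneg_left hS2 hε]
  rw [e1]
  simp only [Complex.add_re, e4]
  linarith

end LDL

/-! ### Elementary symmetric functions and their tangent inequalities -/

section Esym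

variable {n : ℕ}

/-- The elementary symmetric function `σ_k`. -/
def esym (k : ℕ) (μ : Fin n → ℝ) : ℝ := ∑ J ∈ Finset.univ.powersetCard k, ∏ i ∈ J, μ i

/-- The logarithmic derivative `μᵢ ∂σ_k/∂μᵢ`, i.e. the part of `σ_k` that involves `μᵢ`. -/
def esymAt (k : ℕ) (μ : Fin n → ℝ) (i : Fin n) : ℝ :=
  ∑ J ∈ Finset.univ.powersetCard k, if i ∈ J then ∏ j ∈ J, μ j else 0

lemma esymAt_nonneg {k : ℕ} {μ : Fin n → ℝ} (hμ : ∀ i, 0 < μ i) (i : Fin n) :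
    0 ≤ esymAt k μ i :=
  Finset.sum_nonneg fun J _ => by
    split_ifs
    · exact Finset.prod_nonneg fun j _ => (hμ j).le
    · exact le_rfl

lemma esymAt_le {k : ℕ} {μ : Fin n → ℝ} (hμ : ∀ i, 0 < μ i) (i : Fin n) :
    esymAt k μ i ≤ esym k μ :=
  Finset.sum_le_sum fun J _ => by
    split_ifs
    · exact le_rfl
    · exact Finset.prod_nonneg fun j _ => (hμ j).le

lemma sum_esymAt_mul (k : ℕ) (μ x : Fin n → ℝ) :
    ∑ i, esymAt k μ i * x i
      = ∑ J ∈ Finset.univ.powersetCard k, (∏ j ∈ J, μ j) * ∑ i ∈ J, x i := by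
  simp only [esymAt, Finset.sum_mul]
  rw [Finset.sum_comm]
  refine Finset.sum_congr rfl fun J _ => ?_
  rw [Finset.mul_sum]
  simp [ite_mul, Finset.sum_ite_mem]

lemma sum_esymAt (k : ℕ) (μ : Fin n → ℝ) : ∑ i, esymAt k μ i = k * esym k μ := by
  have := sum_esymAt_mul k μ (fun _ => 1)
  simp only [mul_one] at this
  rw [this, esym, Finset.mul_sum]
  refine Finset.sum_congr rfl fun J hJ => ?_
  rw [Finset.sum_const, (Finset.mem_powersetCard.1 hJ).2, nsmul_eq_mul]
  ring

/-- `σ_k` is convex in the logarithms of its arguments; this is the tangent inequality. -/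
lemma esym_add_sum_log_le (k : ℕ) {μ x : Fin n → ℝ} (hμ : ∀ i, 0 < μ i) (hx : ∀ i, 0 < x i) :
    esym k μ + ∑ i, esymAt k μ i * (Real.log (x i) - Real.log (μ i)) ≤ esym k x := by
  rw [sum_esymAt_mul, esym, esym, ← Finset.sum_add_distrib]
  refine Finset.sum_le_sum fun J _ => ?_
  have h1 : ∏ j ∈ J, x j
      = (∏ j ∈ J, μ j) * Real.exp (∑ i ∈ J, (Real.log (x i) - Real.log (μ i))) := by
    rw [Real.exp_sum, ← Finset.prod_mul_distrib]
    refine Finset.prod_congr rfl fun i _ => ?_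
    rw [Real.exp_sub, Real.exp_log (hx i), Real.exp_log (hμ i)]
    field_simp [(hμ i).ne']
  rw [h1]
  have h2 := Real.add_one_le_exp (∑ i ∈ J, (Real.log (x i) - Real.log (μ i)))
  have h3 : 0 ≤ ∏ j ∈ J, μ j := Finset.prod_nonneg fun j _ => (hμ j).le
  nlinarith

lemma mixedDet_diagonal_one (k : ℕ) {lam : Fin n → ℝ} (hlam : ∀ i, 0 < lam i) :
    mixedDet k (Matrix.diagonal fun i => (lam i : ℂ)) 1
      = ((esym k fun i => (lam i)⁻¹ : ℝ) : ℂ) * (Matrix.diagonal fun i => (lam i : ℂ)).det := by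
  rw [mixedDet, esym, Complex.ofReal_sum, Finset.sum_mul]
  refine Finset.sum_congr rfl fun J _ => ?_
  have : replaceRows J (1 : Matrix (Fin n) (Fin n) ℂ) (Matrix.diagonal fun i => (lam i : ℂ))
      = Matrix.diagonal (J.piecewise (fun _ => 1) fun i => (lam i : ℂ)) := by
    ext i j
    by_cases hi : i ∈ J <;> simp [replaceRows_apply, hi, Matrix.diagonal_apply, Matrix.one_apply]
  rw [this, Matrix.det_diagonal, Matrix.det_diagonal, Finset.prod_piecewise]
  have h2 : ∏ i, (lam i : ℂ) = (∏ i ∈ J, (lam i : ℂ)) * ∏ i ∈ Finset.univ \ J, (lam i : ℂ) := by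
    rw [mul_comm]; exact (Finset.prod_sdiff (Finset.subset_univ J)).symm
  rw [h2, Complex.ofReal_prod]
  have h3 : (∏ i ∈ J, (((lam i)⁻¹ : ℝ) : ℂ)) * ∏ i ∈ J, (lam i : ℂ) = 1 := by
    rw [← Finset.prod_mul_distrib]
    refine Finset.prod_eq_one fun i _ => ?_
    have : (lam i : ℂ) ≠ 0 := by exact_mod_cast (hlam i).ne'
    push_cast
    field_simp
  rw [← mul_assoc, h3]
  simp

/-- The consequence of the cone condition at a solution, in a frame where the metric is the
identity and the solution is `diag lam`: `P` is a form below the level of the equation. -/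
lemma add_le_sum_esymAt_mul_of_mixedDet_le {k : ℕ} (hk : k ≤ n) {lam : Fin n → ℝ}
    (hlam : ∀ i, 0 < lam i) {P : Matrix (Fin n) (Fin n) ℂ} (hP : P.PosDef) {θ : ℝ}
    (h : (mixedDet k P 1).re ≤ (1 - θ) * (esym k fun i => (lam i)⁻¹) * P.det.re) :
    (k + θ) * (esym k fun i => (lam i)⁻¹)
      ≤ ∑ i, esymAt k (fun i => (lam i)⁻¹) i * ((lam i)⁻¹ * (P i i).re) := by
  have hμ (i : Fin n) : 0 < (lam i)⁻¹ := inv_pos.2 (hlam i)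
  have hPi (i : Fin n) : 0 < (P i i).re := posDef_diag_pos hP i
  have hdet : 0 < P.det.re := (Complex.lt_def.1 hP.det_pos).1
  have h1 := det_mul_sum_prod_le_mixedDet hk hP (isUnipotentUpper_one (n := n))
    isUnipotentUpper_one (G := 1) (δ := fun _ => 1) (fun _ => one_pos) (by simp)
  simp only [Matrix.conjTranspose_one, Matrix.one_mul, Matrix.mul_one] at h1
  have h2 : (∑ J ∈ Finset.univ.powersetCard k, ∏ i ∈ J, 1 / (P i i).re)
      ≤ (1 - θ) * (esym k fun i => (lam i)⁻¹) := by
    refine le_of_mul_le_mul_left ?_ hdet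
    linarith
  have h3 := esym_add_sum_log_le k hμ (fun i => one_div_pos.2 (hPi i))
  have h4 : ∑ i, esymAt k (fun i => (lam i)⁻¹) i * (1 - (lam i)⁻¹ * (P i i).re)
      ≤ ∑ i, esymAt k (fun i => (lam i)⁻¹) i
        * (Real.log (1 / (P i i).re) - Real.log ((lam i)⁻¹)) := by
    refine Finset.sum_le_sum fun i _ => mul_le_mul_of_nonneg_left ?_ (esymAt_nonneg hμ i)
    have := Real.log_le_sub_one_of_pos (mul_pos (hμ i) (hPi i))
    rw [Real.log_mul (hμ i).ne' (hPi i).ne'] at this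
    rw [one_div, Real.log_inv (P i i).re]
    linarith
  simp only [mul_sub, mul_one, Finset.sum_sub_distrib, sum_esymAt] at h4
  simp only [mul_sub, Finset.sum_sub_distrib] at h3
  change _ ≤ ∑ J ∈ Finset.univ.powersetCard k, ∏ i ∈ J, 1 / (P i i).re at h3
  linarith

end Esym

/-! ### Second order jets along real lines -/

section Jets

open Filter Topology

variable {F : Type*} [NormedAddCommGroup F] [NormedSpace ℝ F]

/-- `f` is of class `C²` at `0` with value `a`, first derivative `b` and second derivative `c`. -/
structure HasJet2 (f : ℝ → F) (a b c : F) : Prop where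
  contDiffAt : ContDiffAt ℝ 2 f 0
  val : f 0 = a
  d1 : deriv f 0 = b
  d2 : deriv (deriv f) 0 = c

lemma _root_.ContDiffAt.eventually_differentiableAt {f : ℝ → F} (hf : ContDiffAt ℝ 2 f 0) :
    ∀ᶠ s in 𝓝 (0 : ℝ), DifferentiableAt ℝ f s :=
  (hf.eventually (by simp)).mono fun _ h => h.differentiableAt (by simp)

lemma _root_.ContDiffAt.differentiableAt_deriv {f : ℝ → F} (hf : ContDiffAt ℝ 2 f 0) :
    DifferentiableAt ℝ (deriv f) 0 := by
  have h : ContDiffAt ℝ 1 (fderiv ℝ f) 0 := hf.fderiv_right (by norm_num)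
  exact (h.clm_apply contDiffAt_const).differentiableAt one_ne_zero

lemma hasJet2_const (a : F) : HasJet2 (fun _ : ℝ => a) a 0 0 :=
  ⟨contDiffAt_const, rfl, by simp, by simp⟩

lemma hasJet2_id : HasJet2 (fun s : ℝ => s) 0 1 0 :=
  ⟨contDiffAt_id, rfl, by simp, by
    have : deriv (fun s : ℝ => s) = fun _ => 1 := by ext; simp
    rw [this]; simp⟩

lemma HasJet2.add {f g : ℝ → F} {a b c a' b' c' : F} (hf : HasJet2 f a b c)
    (hg : HasJet2 g a' b' c') : HasJet2 (fun s => f s + g s) (a + a') (b + b') (c + c') := by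
  have h : deriv (fun s => f s + g s) =ᶠ[𝓝 0] fun s => deriv f s + deriv g s := by
    filter_upwards [hf.1.eventually_differentiableAt, hg.1.eventually_differentiableAt]
      with s h1 h2 using deriv_fun_add h1 h2
  refine ⟨hf.1.add hg.1, by rw [hf.2, hg.2], ?_, ?_⟩
  · rw [h.eq_of_nhds, hf.3, hg.3]
  · rw [h.deriv_eq, deriv_fun_add hf.1.differentiableAt_deriv hg.1.differentiableAt_deriv,
      hf.4, hg.4]

lemma HasJet2.clm_comp {F' : Type*} [NormedAddCommGroup F'] [NormedSpace ℝ F'] {f : ℝ → F}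
    {a b c : F} (hf : HasJet2 f a b c) (L : F →L[ℝ] F') :
    HasJet2 (fun s => L (f s)) (L a) (L b) (L c) := by
  have h : deriv (fun s => L (f s)) =ᶠ[𝓝 0] fun s => L (deriv f s) := by
    filter_upwards [hf.1.eventually_differentiableAt] with s h1
    exact (L.hasFDerivAt.comp_hasDerivAt s h1.hasDerivAt).deriv
  refine ⟨L.contDiff.contDiffAt.comp 0 hf.1, by rw [hf.2], ?_, ?_⟩
  · rw [h.eq_of_nhds, hf.3]
  · rw [h.deriv_eq]
    have := (L.hasFDerivAt.comp_hasDerivAt 0 hf.1.differentiableAt_deriv.hasDerivAt).deriv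
    rw [hf.4] at this
    exact this

lemma HasJet2.neg {f : ℝ → F} {a b c : F} (hf : HasJet2 f a b c) :
    HasJet2 (fun s => -f s) (-a) (-b) (-c) :=
  hf.clm_comp (-ContinuousLinearMap.id ℝ F)

lemma HasJet2.sub {f g : ℝ → F} {a b c a' b' c' : F} (hf : HasJet2 f a b c)
    (hg : HasJet2 g a' b' c') : HasJet2 (fun s => f s - g s) (a - a') (b - b') (c - c') := by
  simpa only [sub_eq_add_neg] using hf.add hg.neg

lemma HasJet2.sum {ι : Type*} (t : Finset ι) {f : ι → ℝ → F} {a b c : ι → F}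
    (hf : ∀ i, HasJet2 (f i) (a i) (b i) (c i)) :
    HasJet2 (fun s => ∑ i ∈ t, f i s) (∑ i ∈ t, a i) (∑ i ∈ t, b i) (∑ i ∈ t, c i) := by
  classical
  induction t using Finset.induction_on with
  | empty => simpa using hasJet2_const (0 : F)
  | insert i t hi ih => simpa only [Finset.sum_insert hi] using (hf i).add ih

lemma HasJet2.mul {A : Type*} [NormedCommRing A] [NormedAlgebra ℝ A] {f g : ℝ → A}
    {a b c a' b' c' : A} (hf : HasJet2 f a b c) (hg : HasJet2 g a' b' c') :
    HasJet2 (fun s => f s * g s) (a * a') (b * a' + a * b') (c * a' + 2 * (b * b') + a * c') := by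
  have h : deriv (fun s => f s * g s) =ᶠ[𝓝 0] fun s => deriv f s * g s + f s * deriv g s := by
    filter_upwards [hf.1.eventually_differentiableAt, hg.1.eventually_differentiableAt]
      with s h1 h2 using deriv_fun_mul h1 h2
  have f1 := hf.1.differentiableAt (by simp)
  have g1 := hg.1.differentiableAt (by simp)
  have f2 := hf.1.differentiableAt_deriv
  have g2 := hg.1.differentiableAt_deriv
  refine ⟨hf.1.mul hg.1, by rw [hf.2, hg.2], ?_, ?_⟩
  · rw [h.eq_of_nhds, hf.2, hf.3, hg.2, hg.3]
  · rw [h.deriv_eq, deriv_fun_add (f2.fun_mul g1) (f1.fun_mul g2), deriv_fun_mul f2 g1,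
      deriv_fun_mul f1 g2, hf.2, hf.3, hf.4, hg.2, hg.3, hg.4]
    ring

/-- Second order chain rule for a function of one real variable. -/
lemma HasJet2.comp_real {f φ φ' : ℝ → ℝ} {a b c d2 : ℝ} (hf : HasJet2 f a b c)
    (hφ : ContDiffAt ℝ 2 φ a) (hφ' : ∀ᶠ x in 𝓝 a, HasDerivAt φ (φ' x) x)
    (hφ'' : HasDerivAt φ' d2 a) :
    HasJet2 (fun s => φ (f s)) (φ a) (φ' a * b) (d2 * b ^ 2 + φ' a * c) := by
  have hfa : f 0 = a := hf.2
  have hcont : Tendsto f (𝓝 0) (𝓝 a) := by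
    have := hf.1.continuousAt; rwa [ContinuousAt, hfa] at this
  have h : deriv (fun s => φ (f s)) =ᶠ[𝓝 0] fun s => φ' (f s) * deriv f s := by
    filter_upwards [hf.1.eventually_differentiableAt, hcont.eventually hφ'] with s h1 h2
    exact (h2.comp s h1.hasDerivAt).deriv
  have f1 := hf.1.differentiableAt (by simp)
  have f2 := hf.1.differentiableAt_deriv
  subst hfa
  refine ⟨hφ.comp 0 hf.1, rfl, ?_, ?_⟩
  · rw [h.eq_of_nhds, hf.3]
  · have h3 : HasDerivAt (fun s => φ' (f s)) (d2 * b) 0 := by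
      have := hφ''.comp 0 f1.hasDerivAt
      rwa [hf.3] at this
    have h4 := h3.mul f2.hasDerivAt
    rw [hf.4, hf.3] at h4
    rw [h.deriv_eq]
    refine h4.deriv.trans (by ring)

lemma HasJet2.log {f : ℝ → ℝ} {a b c : ℝ} (hf : HasJet2 f a b c) (ha : 0 < a) :
    HasJet2 (fun s => Real.log (f s)) (Real.log a) (b / a) (c / a - b ^ 2 / a ^ 2) := by
  have := hf.comp_real (φ := Real.log) (φ' := fun x => x⁻¹) (Real.contDiffAt_log.2 ha.ne')
    ((eventually_ne_nhds ha.ne').mono fun x hx => Real.hasDerivAt_log hx) (hasDerivAt_inv ha.ne')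
  convert this using 1
  · field_simp
  · field_simp; ring

lemma HasJet2.exp {f : ℝ → ℝ} {a b c : ℝ} (hf : HasJet2 f a b c) :
    HasJet2 (fun s => Real.exp (f s)) (Real.exp a) (Real.exp a * b)
      (Real.exp a * b ^ 2 + Real.exp a * c) :=
  hf.comp_real Real.contDiff_exp.contDiffAt
    (Eventually.of_forall fun x => Real.hasDerivAt_exp x) (Real.hasDerivAt_exp a)

lemma HasJet2.d2_nonneg_of_isLocalMin {f : ℝ → ℝ} {a b c : ℝ} (hf : HasJet2 f a b c)
    (hmin : IsLocalMin f 0) : b = 0 ∧ 0 ≤ c := by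
  have h1 : deriv f 0 = 0 := hmin.deriv_eq_zero
  refine ⟨by rw [← hf.3, h1], ?_⟩
  by_contra! hc
  have hmax : IsLocalMax f 0 := isLocalMax_of_deriv_deriv_neg (by rw [hf.4]; exact hc) h1
    hf.1.continuousAt
  have hconst : f =ᶠ[𝓝 0] fun _ => f 0 := by
    filter_upwards [hmin, hmax] with s h2 h3 using le_antisymm h3 h2
  have h2 : deriv f =ᶠ[𝓝 0] fun _ => 0 := hconst.deriv.trans (by simp)
  have h3 := h2.deriv_eq
  rw [hf.4] at h3
  simp at h3
  exact hc.ne h3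

lemma HasJet2.d2_nonpos_of_isLocalMax {f : ℝ → ℝ} {a b c : ℝ} (hf : HasJet2 f a b c)
    (hmax : IsLocalMax f 0) : b = 0 ∧ c ≤ 0 := by
  have := hf.neg.d2_nonneg_of_isLocalMin hmax.neg
  exact ⟨neg_eq_zero.1 this.1, neg_nonneg.1 this.2⟩

lemma HasJet2.eventually_norm_sub_le {f : ℝ → F} {a b c : F} (hf : HasJet2 f a b c) {K : ℝ}
    (hb : ‖b‖ ≤ K) : ∀ᶠ s in 𝓝 (0 : ℝ), ‖f s - a‖ ≤ (K + 1) * |s| := by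
  have h1 := (hf.1.differentiableAt (by simp)).hasDerivAt
  rw [hf.3] at h1
  have h2 := (hasDerivAt_iff_isLittleO.1 h1).bound one_pos
  filter_upwards [h2] with s hs
  rw [hf.2] at hs
  simp only [sub_zero, one_mul, Real.norm_eq_abs] at hs
  calc ‖f s - a‖ = ‖(f s - a - s • b) + s • b‖ := by rw [sub_add_cancel]
    _ ≤ ‖f s - a - s • b‖ + ‖s • b‖ := norm_add_le _ _
    _ ≤ |s| + |s| * K := by
      rw [norm_smul, Real.norm_eq_abs]
      exact add_le_add hs (mul_le_mul_of_nonneg_left hb (abs_nonneg _))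
    _ = _ := by ring

end Jets

/-! ### Directional Wirtinger calculus -/

section Wirtinger

open Filter Topology

variable {n : ℕ} {F : Type*} [NormedAddCommGroup F] [NormedSpace ℝ F]

/-- The real directional derivative of `f` in the direction `a`. -/
def pd (a : Cn n) (f : Cn n → F) (z : Cn n) : F := fderiv ℝ f z a

lemma _root_.ContDiffAt.pd {f : Cn n → F} {z : Cn n} {k m : WithTop ℕ∞} (hf : ContDiffAt ℝ k f z)
    (a : Cn n) (h : m + 1 ≤ k) : ContDiffAt ℝ m (pd a f) z :=
  (hf.fderiv_right h).clm_apply contDiffAt_const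

lemma eventuallyEq_pd {f g : Cn n → F} {z : Cn n} (h : f =ᶠ[𝓝 z] g) (a : Cn n) :
    pd a f =ᶠ[𝓝 z] pd a g :=
  h.fderiv.fun_comp fun L => L a

lemma pd_pd_eq {f : Cn n → F} {z : Cn n} (hf : ContDiffAt ℝ 2 f z) (a b : Cn n) :
    pd a (pd b f) z = fderiv ℝ (fderiv ℝ f) z a b := by
  have h : DifferentiableAt ℝ (fderiv ℝ f) z :=
    (hf.fderiv_right (m := 1) (by norm_num)).differentiableAt one_ne_zero
  change fderiv ℝ (fun w => fderiv ℝ f w b) z a = _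
  rw [fderiv_clm_apply h (differentiableAt_const b)]
  simp

lemma pd_comm {f : Cn n → F} {z : Cn n} (hf : ContDiffAt ℝ 2 f z) (a b : Cn n) :
    pd a (pd b f) z = pd b (pd a f) z := by
  rw [pd_pd_eq hf, pd_pd_eq hf]
  exact (hf.isSymmSndFDerivAt (by simp)).eq a b

lemma pd_comm_eventually {f : Cn n → F} {z : Cn n} (hf : ContDiffAt ℝ 2 f z) (a b : Cn n) :
    pd a (pd b f) =ᶠ[𝓝 z] pd b (pd a f) :=
  (hf.eventually (by simp)).mono fun _ h => pd_comm h a b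

lemma pd_add {f g : Cn n → F} {z : Cn n} (hf : DifferentiableAt ℝ f z)
    (hg : DifferentiableAt ℝ g z) (a : Cn n) :
    pd a (fun w => f w + g w) z = pd a f z + pd a g z := by
  simp [pd, fderiv_fun_add hf hg]

lemma pd_clm_comp {F' : Type*} [NormedAddCommGroup F'] [NormedSpace ℝ F'] (L : F →L[ℝ] F')
    {f : Cn n → F} {z : Cn n} (hf : DifferentiableAt ℝ f z) (a : Cn n) :
    pd a (fun w => L (f w)) z = L (pd a f z) := by
  have := (L.hasFDerivAt.comp z hf.hasFDerivAt).fderiv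
  change fderiv ℝ (L ∘ f) z a = _
  rw [this]; rfl

lemma pd_const_mul {f : Cn n → ℂ} {z : Cn n} (hf : DifferentiableAt ℝ f z) (c : ℂ) (a : Cn n) :
    pd a (fun w => c * f w) z = c * pd a f z :=
  pd_clm_comp (ContinuousLinearMap.mul ℝ ℂ c) hf a

lemma pd_pd_clm_comp {F' : Type*} [NormedAddCommGroup F'] [NormedSpace ℝ F'] (L : F →L[ℝ] F')
    {f : Cn n → F} {z : Cn n} (hf : ContDiffAt ℝ 2 f z) (a b : Cn n) :
    pd a (pd b fun w => L (f w)) z = L (pd a (pd b f) z) := by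
  have h : (pd b fun w => L (f w)) =ᶠ[𝓝 z] fun w => L (pd b f w) :=
    (hf.eventually (by simp)).mono fun _ h => pd_clm_comp L (h.differentiableAt (by simp)) b
  rw [(eventuallyEq_pd h a).eq_of_nhds]
  exact pd_clm_comp L ((hf.pd b (m := 1) (by norm_num)).differentiableAt one_ne_zero) a

lemma hasJet2_line {f : Cn n → F} {z : Cn n} (hf : ContDiffAt ℝ 2 f z) (a : Cn n) :
    HasJet2 (fun s : ℝ => f (z + s • a)) (f z) (pd a f z) (pd a (pd a f) z) := by
  have hl (s : ℝ) : HasDerivAt (fun s : ℝ => z + s • a) a s := by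
    simpa using ((hasDerivAt_id s).smul_const a).const_add z
  have hl0 : z + (0 : ℝ) • a = z := by simp
  have hcont : Tendsto (fun s : ℝ => z + s • a) (𝓝 0) (𝓝 z) := by
    have := (hl 0).continuousAt; rwa [ContinuousAt, hl0] at this
  have h1 {g : Cn n → F} {s : ℝ} (hg : DifferentiableAt ℝ g (z + s • a)) :
      deriv (fun s : ℝ => g (z + s • a)) s = pd a g (z + s • a) :=
    (hg.hasFDerivAt.comp_hasDerivAt s (hl s)).deriv
  have h : deriv (fun s : ℝ => f (z + s • a)) =ᶠ[𝓝 0] fun s => pd a f (z + s • a) := by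
    filter_upwards [hcont.eventually (hf.eventually (by simp))] with s hs
    exact h1 (hs.differentiableAt (by simp))
  refine ⟨?_, by rw [hl0], ?_, ?_⟩
  · refine ContDiffAt.comp (g := f) 0 (by rwa [hl0]) ?_
    exact contDiffAt_const.add (contDiffAt_id.smul contDiffAt_const)
  · rw [h.eq_of_nhds, hl0]
  · have hd := (hf.pd a (m := 1) (by norm_num)).differentiableAt one_ne_zero
    rw [h.deriv_eq, h1 (by rwa [hl0]), hl0]

/-- The derivative `∑ Xᵢ ∂/∂zⁱ` of type `(1,0)`. -/
def wd (X : Cn n) (f : Cn n → ℂ) (z : Cn n) : ℂ :=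
  (1 / 2 : ℂ) * (pd X f z - Complex.I * pd (Complex.I • X) f z)

/-- The derivative `∑ conj Xⱼ ∂/∂z̄ʲ` of type `(0,1)`. -/
def wdbar (X : Cn n) (f : Cn n → ℂ) (z : Cn n) : ℂ :=
  (1 / 2 : ℂ) * (pd X f z + Complex.I * pd (Complex.I • X) f z)

/-- The complex Hessian in the direction `X`, as a quarter of the Laplacian on the complex line
spanned by `X`. -/
def lev (X : Cn n) (f : Cn n → F) (z : Cn n) : F :=
  (1 / 4 : ℝ) • (pd X (pd X f) z + pd (Complex.I • X) (pd (Complex.I • X) f) z)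

lemma smul_I_single (i : Fin n) : Complex.I • (EuclideanSpace.single i 1 : Cn n)
    = EuclideanSpace.single i Complex.I := by
  ext j; by_cases h : j = i
  · subst h; simp
  · simp [h]

lemma dZ_eq_wd (i : Fin n) : dZ (n := n) i = wd (EuclideanSpace.single i 1) := by
  ext f z; rw [wd, smul_I_single]; rfl

lemma dZbar_eq_wdbar (i : Fin n) : dZbar (n := n) i = wdbar (EuclideanSpace.single i 1) := by
  ext f z; rw [wdbar, smul_I_single]; rfl

lemma _root_.ContDiffAt.wd {f : Cn n → ℂ} {z : Cn n} {k m : WithTop ℕ∞} (hf : ContDiffAt ℝ k f z)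
    (X : Cn n) (h : m + 1 ≤ k) : ContDiffAt ℝ m (wd X f) z :=
  contDiffAt_const.mul ((hf.pd X h).sub (contDiffAt_const.mul (hf.pd _ h)))

lemma _root_.ContDiffAt.wdbar {f : Cn n → ℂ} {z : Cn n} {k m : WithTop ℕ∞} (hf : ContDiffAt ℝ k f z)
    (X : Cn n) (h : m + 1 ≤ k) : ContDiffAt ℝ m (wdbar X f) z :=
  contDiffAt_const.mul ((hf.pd X h).add (contDiffAt_const.mul (hf.pd _ h)))

lemma eventuallyEq_wdbar {f g : Cn n → ℂ} {z : Cn n} (h : f =ᶠ[𝓝 z] g) (X : Cn n) :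
    wdbar X f =ᶠ[𝓝 z] wdbar X g := by
  filter_upwards [eventuallyEq_pd h X, eventuallyEq_pd h (Complex.I • X)] with w h1 h2
  simp only [wdbar, h1, h2]

lemma eventuallyEq_lev {f g : Cn n → F} {z : Cn n} (h : f =ᶠ[𝓝 z] g) (X : Cn n) :
    lev X f =ᶠ[𝓝 z] lev X g := by
  filter_upwards [eventuallyEq_pd (eventuallyEq_pd h X) X,
    eventuallyEq_pd (eventuallyEq_pd h (Complex.I • X)) (Complex.I • X)] with w h1 h2
  simp only [lev, h1, h2]

lemma pd_wd {f : Cn n → ℂ} {z : Cn n} (hf : ContDiffAt ℝ 2 f z) (a X : Cn n) :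
    pd a (wd X f) z
      = (1 / 2 : ℂ) * (pd a (pd X f) z - Complex.I * pd a (pd (Complex.I • X) f) z) := by
  have h1 (b : Cn n) := (hf.pd b (m := 1) (by norm_num)).differentiableAt one_ne_zero
  have h2 : wd X f = fun w => (1 / 2 : ℂ) * pd X f w
      + (-(1 / 2) * Complex.I) * pd (Complex.I • X) f w := by ext w; rw [wd]; ring
  rw [h2, pd_add ((h1 _).const_mul _) ((h1 _).const_mul _), pd_const_mul (h1 _),
    pd_const_mul (h1 _)]
  ring

lemma pd_wdbar {f : Cn n → ℂ} {z : Cn n} (hf : ContDiffAt ℝ 2 f z) (a X : Cn n) :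
    pd a (wdbar X f) z
      = (1 / 2 : ℂ) * (pd a (pd X f) z + Complex.I * pd a (pd (Complex.I • X) f) z) := by
  have h1 (b : Cn n) := (hf.pd b (m := 1) (by norm_num)).differentiableAt one_ne_zero
  have h2 : wdbar X f = fun w => (1 / 2 : ℂ) * pd X f w
      + ((1 / 2) * Complex.I) * pd (Complex.I • X) f w := by ext w; rw [wdbar]; ring
  rw [h2, pd_add ((h1 _).const_mul _) ((h1 _).const_mul _), pd_const_mul (h1 _),
    pd_const_mul (h1 _)]
  ring

lemma wd_comm {f : Cn n → ℂ} {z : Cn n} (hf : ContDiffAt ℝ 2 f z) (X Y : Cn n) :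
    wd X (wd Y f) z = wd Y (wd X f) z := by
  rw [wd, pd_wd hf, pd_wd hf, wd, pd_wd hf, pd_wd hf, pd_comm hf X Y,
    pd_comm hf X (Complex.I • Y), pd_comm hf (Complex.I • X) Y,
    pd_comm hf (Complex.I • X) (Complex.I • Y)]
  ring

lemma wd_wdbar_comm {f : Cn n → ℂ} {z : Cn n} (hf : ContDiffAt ℝ 2 f z) (X Y : Cn n) :
    wd X (wdbar Y f) z = wdbar Y (wd X f) z := by
  rw [wd, pd_wdbar hf, pd_wdbar hf, wdbar, pd_wd hf, pd_wd hf, pd_comm hf X Y,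
    pd_comm hf X (Complex.I • Y), pd_comm hf (Complex.I • X) Y,
    pd_comm hf (Complex.I • X) (Complex.I • Y)]
  ring

lemma wdbar_wd_self {f : Cn n → ℂ} {z : Cn n} (hf : ContDiffAt ℝ 2 f z) (X : Cn n) :
    wdbar X (wd X f) z = lev X f z := by
  rw [wdbar, pd_wd hf, pd_wd hf, lev, pd_comm hf X (Complex.I • X), Complex.real_smul]
  push_cast
  linear_combination (-1 / 4 * pd (Complex.I • X) (pd (Complex.I • X) f) z) * Complex.I_sq

lemma _root_.ContDiffAt.lev {f : Cn n → F} {z : Cn n} {k m : WithTop ℕ∞} (hf : ContDiffAt ℝ k f z)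
    (X : Cn n) (h : m + 2 ≤ k) : ContDiffAt ℝ m (lev X f) z := by
  have h' : m + 1 + 1 ≤ k := by rwa [add_assoc, one_add_one_eq_two]
  exact contDiffAt_const.smul (((hf.pd X h').pd X le_rfl).add ((hf.pd _ h').pd _ le_rfl))

lemma pd_pd_pd_comm {f : Cn n → F} {z : Cn n} (hf : ContDiffAt ℝ 3 f z) (a b : Cn n) :
    pd a (pd b (pd b f)) z = pd b (pd b (pd a f)) z := by
  rw [pd_comm (hf.pd b (m := 2) (by norm_num)) a b]
  exact (eventuallyEq_pd (pd_comm_eventually (hf.of_le (by norm_num)) a b) b).eq_of_nhds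

lemma pd_pd_pd_pd_comm {f : Cn n → F} {z : Cn n} (hf : ContDiffAt ℝ 4 f z) (a b : Cn n) :
    pd a (pd a (pd b (pd b f))) z = pd b (pd b (pd a (pd a f))) z := by
  have h : pd a (pd b (pd b f)) =ᶠ[𝓝 z] pd b (pd b (pd a f)) :=
    (hf.eventually (by simp)).mono fun w hw => pd_pd_pd_comm (hw.of_le (by norm_num)) a b
  rw [(eventuallyEq_pd h a).eq_of_nhds]
  exact pd_pd_pd_comm (hf.pd a (by norm_num)) a b

lemma pd_pd_lev {f : Cn n → F} {z : Cn n} (hf : ContDiffAt ℝ 4 f z) (a X : Cn n) :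
    pd a (pd a (lev X f)) z = (1 / 4 : ℝ) • (pd a (pd a (pd X (pd X f))) z
        + pd a (pd a (pd (Complex.I • X) (pd (Complex.I • X) f))) z) := by
  have h4 (b : Cn n) : ContDiffAt ℝ 2 (pd b (pd b f)) z :=
    (hf.pd b (m := 3) (by norm_num)).pd b (by norm_num)
  have h2 : pd a (fun w => pd X (pd X f) w + pd (Complex.I • X) (pd (Complex.I • X) f) w)
      =ᶠ[𝓝 z] fun w => pd a (pd X (pd X f)) w
        + pd a (pd (Complex.I • X) (pd (Complex.I • X) f)) w := by
    filter_upwards [(h4 X).eventually (by simp), (h4 (Complex.I • X)).eventually (by simp)]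
      with w h3 h5
    exact pd_add (h3.differentiableAt (by simp)) (h5.differentiableAt (by simp)) a
  refine (pd_pd_clm_comp ((1 / 4 : ℝ) • ContinuousLinearMap.id ℝ F)
    ((h4 X).add (h4 (Complex.I • X))) a a).trans ?_
  rw [(eventuallyEq_pd h2 a).eq_of_nhds, pd_add
    (((h4 _).pd a (m := 1) (by norm_num)).differentiableAt one_ne_zero)
    (((h4 _).pd a (m := 1) (by norm_num)).differentiableAt one_ne_zero)]
  rfl

/-- The complex Hessians in two directions commute. -/
lemma lev_comm {f : Cn n → F} {z : Cn n} (hf : ContDiffAt ℝ 4 f z) (X Y : Cn n) :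
    lev X (lev Y f) z = lev Y (lev X f) z := by
  rw [lev, pd_pd_lev hf, pd_pd_lev hf, lev, pd_pd_lev hf, pd_pd_lev hf,
    pd_pd_pd_pd_comm hf X Y, pd_pd_pd_pd_comm hf X, pd_pd_pd_pd_comm hf _ Y,
    pd_pd_pd_pd_comm hf (Complex.I • X) (Complex.I • Y)]
  module

/-- Third derivatives of type `(2,1)` are symmetric in the two `(1,0)`-directions. -/
lemma wd_wdbar_wd_comm {f : Cn n → ℂ} {z : Cn n} (hf : ContDiffAt ℝ 3 f z) (X Y Z : Cn n) :
    wd X (wdbar Z (wd Y f)) z = wd Y (wdbar Z (wd X f)) z := by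
  have h (A B : Cn n) : wd A (wdbar Z (wd B f)) z = wdbar Z (wd A (wd B f)) z :=
    wd_wdbar_comm (hf.wd B (by norm_num)) A Z
  have h2 : wd X (wd Y f) =ᶠ[𝓝 z] wd Y (wd X f) :=
    (hf.eventually (by simp)).mono fun w hw => wd_comm (hw.of_le (by norm_num)) X Y
  rw [h, h, (eventuallyEq_wdbar h2 Z).eq_of_nhds]

end Wirtinger

/-! ### The second variation of the equation -/

section SecondVariation

open Filter Topology

variable {n : ℕ}

lemma HasJet2.re {f : ℝ → ℂ} {a b c : ℂ} (hf : HasJet2 f a b c) :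
    HasJet2 (fun s => (f s).re) a.re b.re c.re :=
  hf.clm_comp Complex.reCLM

lemma HasJet2.const_mul {f : ℝ → ℂ} {a b c : ℂ} (hf : HasJet2 f a b c) (r : ℂ) :
    HasJet2 (fun s => r * f s) (r * a) (r * b) (r * c) :=
  hf.clm_comp (ContinuousLinearMap.mul ℝ ℂ r)

lemma HasJet2.real_const_mul {f : ℝ → ℝ} {a b c : ℝ} (hf : HasJet2 f a b c) (r : ℝ) :
    HasJet2 (fun s => r * f s) (r * a) (r * b) (r * c) :=
  hf.clm_comp (ContinuousLinearMap.mul ℝ ℝ r)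

/-- The value of a Hermitian matrix on `eᵢ - s bᵢ e₀`. -/
lemma re_conj_diag_eq [NeZero n] {H : Matrix (Fin n) (Fin n) ℂ} (hH : H.IsHermitian) (s : ℝ)
    (b : Fin n → ℂ) (i : Fin n) (Y : Matrix (Fin n) (Fin n) ℂ)
    (hY : Y = Matrix.of fun i j => (1 : Matrix (Fin n) (Fin n) ℂ) i j
      - if i = 0 then (s : ℂ) * b j else 0) :
    ((Y.conjTranspose * H * Y) i i).re
      = (H i i).re - 2 * (s * (b i * H i 0).re) + s * s * (‖b i‖ ^ 2 * (H 0 0).re) := by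
  have hcol : Y.col i = Pi.single i 1 + (-(s * b i)) • Pi.single 0 1 := by
    ext k
    simp only [hY, Matrix.col_apply, Matrix.of_apply, Matrix.one_apply, Pi.add_apply,
      Pi.single_apply, Pi.smul_apply, smul_eq_mul]
    split_ifs <;> ring
  have hstar (j : Fin n) : star (Pi.single j (1 : ℂ) : Fin n → ℂ) = Pi.single j 1 := by
    ext k; by_cases h : k = j
    · subst h; simp
    · simp [h]
  have hsym : H 0 i = star (H i 0) := (hH.apply 0 i).symm
  rw [conjTranspose_mul_mul_apply, hcol]
  simp only [star_add, star_smul, hstar, Matrix.mulVec_add, Matrix.mulVec_smul, add_dotProduct,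
    dotProduct_add, smul_dotProduct, dotProduct_smul, single_one_dotProduct,
    Matrix.mulVec_single_one, Matrix.col_apply, smul_eq_mul, hsym]
  have h00 : (H 0 0).im = 0 := Complex.conj_eq_iff_im.1 (hH.apply 0 0)
  simp only [Complex.star_def, map_neg, map_mul, Complex.conj_ofReal, Complex.add_re,
    Complex.add_im, Complex.mul_re, Complex.neg_re, Complex.neg_im, Complex.ofReal_re,
    Complex.ofReal_im,
    Complex.conj_re, Complex.conj_im, Complex.mul_im, h00, ← Complex.normSq_eq_norm_sq,
    Complex.normSq_apply]
  ring

/-- The second variation of the equation along a real line. The matrices are the coefficients of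
the solution and of the metric in a fixed frame which is orthonormal and diagonalises the solution
at the base point. The function `N = h + ∑ qᵢ (log dᵢ - log rᵢ)`, where `dᵢ` is the value of the
solution on `eᵢ - s bᵢ e₀` and `rᵢ` is `Gᵢᵢ` minus a quadratic error, has a minimum at `0` by the
triangular lower bound for mixed discriminants. -/
lemma second_variation_line [NeZero n] {k : ℕ} (hk : k ≤ n) {Hs Gs : ℝ → Matrix (Fin n) (Fin n) ℂ}
    {hs : ℝ → ℝ} {lam : Fin n → ℝ} (hlam : ∀ i, 0 < lam i)
    {H1 H2 G1 G2 : Matrix (Fin n) (Fin n) ℂ} {h0 h1 h2 : ℝ}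
    (hH : ∀ i j, HasJet2 (fun s => Hs s i j) ((Matrix.diagonal fun i => (lam i : ℂ)) i j)
      (H1 i j) (H2 i j))
    (hG : ∀ i j, HasJet2 (fun s => Gs s i j) ((1 : Matrix (Fin n) (Fin n) ℂ) i j)
      (G1 i j) (G2 i j))
    (hh : HasJet2 hs h0 h1 h2) (hHpos : ∀ᶠ s in 𝓝 (0 : ℝ), (Hs s).PosDef)
    (hGpos : ∀ᶠ s in 𝓝 (0 : ℝ), (Gs s).PosDef)
    (heq : ∀ᶠ s in 𝓝 (0 : ℝ), mixedDet k (Hs s) (Gs s) = hs s * (Hs s).det)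
    {K : ℝ} (hG1 : ∀ i j, ‖G1 i j‖ ≤ K) (b : Fin n → ℂ) (hb : b 0 = 0) :
    0 ≤ h2 + ∑ i, esymAt k (fun i => (lam i)⁻¹) i *
      (((H2 i i).re - 4 * (b i * H1 i 0).re + 2 * ‖b i‖ ^ 2 * lam 0) / lam i
        - (H1 i i).re ^ 2 / lam i ^ 2
        - ((G2 i i).re - 4 * n * (K + 1) ^ 2 - (G1 i i).re ^ 2)) := by
  have hμ (i : Fin n) : 0 < (lam i)⁻¹ := inv_pos.2 (hlam i)
  have hK : 0 ≤ K := (norm_nonneg _).trans (hG1 0 0)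
  set q := esymAt k (fun i => (lam i)⁻¹) with hq
  have hq0 (i : Fin n) : 0 ≤ q i := esymAt_nonneg hμ i
  set d : Fin n → ℝ → ℝ := fun i s => (Hs s i i).re - 2 * (s * (b i * Hs s i 0).re)
    + s * s * (‖b i‖ ^ 2 * (Hs s 0 0).re) with hd
  set r : Fin n → ℝ → ℝ := fun i s => (Gs s i i).re - 2 * n * (K + 1) ^ 2 * (s * s) with hr
  have hoff (i : Fin n) : b i * (Matrix.diagonal fun i => (lam i : ℂ)) i 0 = 0 := by
    by_cases hi : i = 0
    · subst hi; rw [hb, zero_mul]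
    · rw [Matrix.diagonal_apply_ne _ hi, mul_zero]
  have hss : HasJet2 (fun s : ℝ => s * s) 0 0 2 := by
    simpa using hasJet2_id.mul hasJet2_id
  have jd (i : Fin n) : HasJet2 (d i) (lam i) (H1 i i).re
      ((H2 i i).re - 4 * (b i * H1 i 0).re + 2 * ‖b i‖ ^ 2 * lam 0) := by
    have j1 := (hH i i).re
    have j2 := (hasJet2_id.mul ((hH i 0).const_mul (b i)).re).real_const_mul 2
    have j3 := hss.mul ((hH 0 0).re.real_const_mul (‖b i‖ ^ 2))
    have j := (j1.sub j2).add j3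
    simp only [hoff, Matrix.diagonal_apply_eq, Complex.ofReal_re, Complex.zero_re] at j
    convert j using 1 <;> ring
  have jr (i : Fin n) : HasJet2 (r i) 1 (G1 i i).re ((G2 i i).re - 4 * n * (K + 1) ^ 2) := by
    have j := (hG i i).re.sub (hss.real_const_mul (2 * n * (K + 1) ^ 2))
    simp only [Matrix.one_apply_eq, Complex.one_re] at j
    convert j using 1 <;> ring
  have jN := hh.add (HasJet2.sum Finset.univ fun i =>
    (((jd i).log (hlam i)).sub ((jr i).log one_pos)).real_const_mul (q i))
  -- the equation at the base point
  have hh0 : h0 = esym k fun i => (lam i)⁻¹ := by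
    have hH0 : Hs 0 = Matrix.diagonal fun i => (lam i : ℂ) := by ext i j; exact (hH i j).val
    have hG0 : Gs 0 = 1 := by ext i j; exact (hG i j).val
    have h := heq.self_of_nhds
    rw [hH0, hG0, mixedDet_diagonal_one k hlam, hh.val] at h
    have hne : (Matrix.diagonal fun i => (lam i : ℂ)).det ≠ 0 := by
      rw [Matrix.det_diagonal]
      exact Finset.prod_ne_zero_iff.2 fun i _ => by exact_mod_cast (hlam i).ne'
    exact_mod_cast (mul_right_cancel₀ hne h).symm
  have hrpos : ∀ᶠ s in 𝓝 (0 : ℝ), ∀ i, 0 < r i s := by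
    refine eventually_all.2 fun i => (jr i).contDiffAt.continuousAt.eventually_const_lt ?_
    rw [(jr i).val]; exact one_pos
  have hGe : ∀ᶠ s in 𝓝 (0 : ℝ), ∀ i j,
      ‖Gs s i j - (1 : Matrix (Fin n) (Fin n) ℂ) i j‖ ≤ (K + 1) * |s| :=
    eventually_all.2 fun i => eventually_all.2 fun j => (hG i j).eventually_norm_sub_le (hG1 i j)
  have hsmall : ∀ᶠ s in 𝓝 (0 : ℝ), n * ((K + 1) * |s|) < 1 / 2 := by
    have : ContinuousAt (fun s : ℝ => n * ((K + 1) * |s|)) 0 := by fun_prop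
    exact this.eventually_lt_const (by simp)
  have hmin : IsLocalMin (fun s => hs s
      + ∑ i, q i * (Real.log (d i s) - Real.log (r i s))) 0 := by
    filter_upwards [hHpos, hGpos, heq, hrpos, hGe, hsmall] with s hP hGP he hrs hGs hsm
    obtain ⟨M, δ, hM, hδ, hMG⟩ := exists_unipotentUpper_conj_eq_diagonal hGP
    set Y : Matrix (Fin n) (Fin n) ℂ := Matrix.of fun i j =>
      (1 : Matrix (Fin n) (Fin n) ℂ) i j - if i = 0 then (s : ℂ) * b j else 0 with hY
    have hYu : IsUnipotentUpper Y := by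
      refine ⟨fun i => ?_, fun i j hij => ?_⟩
      · simp only [hY, Matrix.of_apply, Matrix.one_apply_eq]
        split_ifs with hi
        · rw [hi, hb]; simp
        · simp
      · have hi : i ≠ 0 := fun h => by
          rw [h] at hij; exact absurd hij (not_lt.2 (Fin.zero_le _))
        simp [hY, Matrix.of_apply, Matrix.one_apply_ne hij.ne', hi]
    have hYd (i : Fin n) : ((Y.conjTranspose * Hs s * Y) i i).re = d i s :=
      re_conj_diag_eq hP.isHermitian s b i Y hY
    have hdpos (i : Fin n) : 0 < d i s := by
      rw [← hYd]; exact posDef_diag_pos (posDef_conj hP (by rw [hYu.det]; exact one_ne_zero)) i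
    have hrδ (i : Fin n) : r i s ≤ δ i := by
      have h3 := diag_sub_le_dotProduct_mulVec (by positivity) hsm.le hGs (M.col i) i (hM.1 i)
      rw [← conjTranspose_mul_mul_apply, hMG, Matrix.diagonal_apply_eq, Complex.ofReal_re,
        mul_pow, sq_abs] at h3
      refine le_trans (le_of_eq ?_) h3
      simp only [hr]; ring
    have h3 := det_mul_sum_prod_le_mixedDet hk hP hM hYu hδ hMG
    rw [he, Complex.re_ofReal_mul, mul_comm (hs s)] at h3
    have h4 := le_of_mul_le_mul_left h3 (Complex.lt_def.1 hP.det_pos).1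
    simp only [hYd] at h4
    have h5 : esym k (fun i => r i s / d i s)
        ≤ ∑ J ∈ Finset.univ.powersetCard k, ∏ i ∈ J, δ i / d i s :=
      Finset.sum_le_sum fun J _ => Finset.prod_le_prod
        (fun i _ => div_nonneg (hrs i).le (hdpos i).le)
        fun i _ => div_le_div_of_nonneg_right (hrδ i) (hdpos i).le
    have h6 := esym_add_sum_log_le k hμ (fun i => div_pos (hrs i) (hdpos i))
    simp only [hh.val, (jd _).val, (jr _).val, Real.log_one, sub_zero, hh0]
    simp only [Real.log_div (hrs _).ne' (hdpos _).ne', Real.log_inv] at h6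
    have h7 : ∑ i, q i * (Real.log (r i s) - Real.log (d i s) - -Real.log (lam i))
        = ∑ i, q i * Real.log (lam i) - ∑ i, q i * (Real.log (d i s) - Real.log (r i s)) := by
      rw [← Finset.sum_sub_distrib]
      exact Finset.sum_congr rfl fun i _ => by ring
    rw [← hq, h7] at h6
    linarith
  have hfin := (jN.d2_nonneg_of_isLocalMin hmin).2
  simpa using hfin

end SecondVariation

section PointwiseEstimate

open Filter Topology

variable {n : ℕ} {F : Type*} [NormedAddCommGroup F] [NormedSpace ℝ F]

/-- The first and the pure second derivatives of `f` at `z` in the two real directions of the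
complex line spanned by `X` are bounded by `K`. -/
def JetBound (K : ℝ) (X : Cn n) (f : Cn n → F) (z : Cn n) : Prop :=
  (‖pd X f z‖ ≤ K ∧ ‖pd X (pd X f) z‖ ≤ K) ∧
    ‖pd (Complex.I • X) f z‖ ≤ K ∧ ‖pd (Complex.I • X) (pd (Complex.I • X) f) z‖ ≤ K

lemma JetBound.norm_wd_le {K : ℝ} {X : Cn n} {f : Cn n → ℂ} {z : Cn n} (h : JetBound K X f z) :
    ‖wd X f z‖ ≤ K := by
  rw [wd, norm_mul]
  have h1 : ‖pd X f z - Complex.I * pd (Complex.I • X) f z‖ ≤ K + K := by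
    refine (norm_sub_le _ _).trans (add_le_add h.1.1 ?_)
    rw [norm_mul, Complex.norm_I, one_mul]
    exact h.2.1
  have h2 : ‖(1 / 2 : ℂ)‖ = 1 / 2 := by norm_num
  rw [h2]
  linarith

lemma JetBound.norm_lev_le {K : ℝ} {X : Cn n} {f : Cn n → F} {z : Cn n} (h : JetBound K X f z) :
    ‖lev X f z‖ ≤ K / 2 := by
  rw [lev, norm_smul]
  have h1 := (norm_add_le (pd X (pd X f) z) (pd (Complex.I • X) (pd (Complex.I • X) f) z)).trans
    (add_le_add h.1.2 h.2.2)
  have h2 : ‖(1 / 4 : ℝ)‖ = 1 / 4 := by norm_num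
  rw [h2]
  linarith

lemma pd_im_eq_zero {f : Cn n → ℂ} {z : Cn n} (hf : DifferentiableAt ℝ f z)
    (him : ∀ᶠ w in 𝓝 z, (f w).im = 0) (a : Cn n) : (pd a f z).im = 0 := by
  have h1 := pd_clm_comp Complex.imCLM hf a
  have h2 : (fun w => Complex.imCLM (f w)) =ᶠ[𝓝 z] fun _ => 0 := him
  rw [(eventuallyEq_pd h2 a).eq_of_nhds] at h1
  simpa [pd] using h1.symm

lemma norm_wd_sq_of_im_eq_zero {f : Cn n → ℂ} {z X : Cn n} (h1 : (pd X f z).im = 0)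
    (h2 : (pd (Complex.I • X) f z).im = 0) :
    ‖wd X f z‖ ^ 2 = ((pd X f z).re ^ 2 + (pd (Complex.I • X) f z).re ^ 2) / 4 := by
  rw [← Complex.normSq_eq_norm_sq, wd, Complex.normSq_mul, Complex.normSq_apply (_ - _)]
  simp only [Complex.sub_re, Complex.sub_im, Complex.mul_re, Complex.mul_im, Complex.I_re,
    Complex.I_im, h1, h2]
  norm_num [Complex.normSq_apply]
  ring

lemma lev_re_eq (X : Cn n) (f : Cn n → ℂ) (z : Cn n) :
    4 * (lev X f z).re = (pd X (pd X f) z).re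
      + (pd (Complex.I • X) (pd (Complex.I • X) f) z).re := by
  rw [lev, Complex.real_smul, Complex.re_ofReal_mul, Complex.add_re]
  ring

/-- The second variation of the equation on a complex line, in the frame of
`second_variation_line`. The good third order terms `‖∂_X H_{i0̄}‖²` are the ones produced by the
first row of the triangular matrix, i.e. by the choice of `b` in `second_variation_line`. -/
lemma second_variation [NeZero n] {k : ℕ} (hk : k ≤ n) {Hf Gf : Cn n → Matrix (Fin n) (Fin n) ℂ}
    {h : Cn n → ℝ} {lam : Fin n → ℝ} {z X : Cn n} (hlam : ∀ i, 0 < lam i)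
    (hH : ∀ i j, ContDiffAt ℝ 2 (fun w => Hf w i j) z)
    (hG : ∀ i j, ContDiffAt ℝ 2 (fun w => Gf w i j) z) (hh : ContDiffAt ℝ 2 h z)
    (hH0 : Hf z = Matrix.diagonal fun i => (lam i : ℂ)) (hG0 : Gf z = 1)
    (hHpos : ∀ᶠ w in 𝓝 z, (Hf w).PosDef) (hGpos : ∀ᶠ w in 𝓝 z, (Gf w).PosDef)
    (heq : ∀ᶠ w in 𝓝 z, mixedDet k (Hf w) (Gf w) = h w * (Hf w).det) {K : ℝ}
    (hGK : ∀ i j, JetBound K X (fun w => Gf w i j) z) (hhK : JetBound K X h z) :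
    -(K + k * (esym k fun i => (lam i)⁻¹) * (K + 4 * n * (K + 1) ^ 2 + K ^ 2)) / 2 ≤
      ∑ i, esymAt k (fun i => (lam i)⁻¹) i * ((lev X (fun w => Hf w i i) z).re / lam i
        - ‖wd X (fun w => Hf w i 0) z‖ ^ 2 / (lam 0 * lam i)) := by
  have hμ (i : Fin n) : 0 < (lam i)⁻¹ := inv_pos.2 (hlam i)
  set q := esymAt k (fun i => (lam i)⁻¹) with hq
  have hq0 (i : Fin n) : 0 ≤ q i := esymAt_nonneg hμ i
  set ξ : Fin n → ℂ := fun i => wd X (fun w => Hf w i 0) z with hξ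
  set κ : Fin n → ℂ := fun i => if i = 0 then 0 else conj (ξ i) / lam 0 with hκ
  set K2 := K + 4 * n * (K + 1) ^ 2 + K ^ 2
  have line (a : Cn n) (ha : ∀ i j, ‖pd a (fun w => Gf w i j) z‖ ≤ K ∧
      ‖pd a (pd a fun w => Gf w i j) z‖ ≤ K) (hha : ‖pd a (pd a h) z‖ ≤ K) (c : ℂ) :
      0 ≤ K + ∑ i, q i * ((((pd a (pd a fun w => Hf w i i) z).re
        - 4 * (c * κ i * pd a (fun w => Hf w i 0) z).re + 2 * ‖c * κ i‖ ^ 2 * lam 0) / lam i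
        - (pd a (fun w => Hf w i i) z).re ^ 2 / lam i ^ 2) + K2) := by
    have hcont : Tendsto (fun s : ℝ => z + s • a) (𝓝 0) (𝓝 z) := by
      have : ContinuousAt (fun s : ℝ => z + s • a) 0 := by fun_prop
      simpa [ContinuousAt] using this
    have := second_variation_line hk (Hs := fun s => Hf (z + s • a)) (Gs := fun s => Gf (z + s • a))
      (hs := fun s => h (z + s • a)) hlam
      (H1 := Matrix.of fun i j => pd a (fun w => Hf w i j) z)
      (H2 := Matrix.of fun i j => pd a (pd a fun w => Hf w i j) z)
      (G1 := Matrix.of fun i j => pd a (fun w => Gf w i j) z)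
      (G2 := Matrix.of fun i j => pd a (pd a fun w => Gf w i j) z)
      (fun i j => by rw [← hH0]; exact hasJet2_line (hH i j) a)
      (fun i j => by rw [← hG0]; exact hasJet2_line (hG i j) a)
      (hasJet2_line hh a) (hcont.eventually hHpos) (hcont.eventually hGpos)
      (hcont.eventually heq) (K := K) (fun i j => (ha i j).1) (fun i => c * κ i) (by simp [hκ])
    refine this.trans (add_le_add ((Real.le_norm_self _).trans hha)
      (Finset.sum_le_sum fun i _ => mul_le_mul_of_nonneg_left ?_ (hq0 i)))
    rw [sub_eq_add_neg]
    refine add_le_add le_rfl ?_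
    simp only [Matrix.of_apply]
    have h1 := (abs_le.1 ((Complex.abs_re_le_norm _).trans (ha i i).2)).1
    have h2 := abs_le.1 ((Complex.abs_re_le_norm _).trans (ha i i).1)
    have h3 : (pd a (fun w => Gf w i i) z).re ^ 2 ≤ K ^ 2 := sq_le_sq' h2.1 h2.2
    simp only [K2]
    linarith
  have l1 := line X (fun i j => (hGK i j).1) hhK.1.2 1
  have l2 := line (Complex.I • X) (fun i j => (hGK i j).2) hhK.2.2 (-Complex.I)
  have hre : ∀ᶠ w in 𝓝 z, (Hf w 0 0).im = 0 := hHpos.mono fun w hw =>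
    Complex.conj_eq_iff_im.1 (hw.isHermitian.apply 0 0)
  have hd (i j : Fin n) := (hH i j).differentiableAt (by simp)
  -- the two real directions combine to `∂∂̄`, and the choice of `κ` completes the square
  have key (i : Fin n) :
      (((pd X (pd X fun w => Hf w i i) z).re
        - 4 * (1 * κ i * pd X (fun w => Hf w i 0) z).re + 2 * ‖1 * κ i‖ ^ 2 * lam 0) / lam i
        - (pd X (fun w => Hf w i i) z).re ^ 2 / lam i ^ 2)
      + (((pd (Complex.I • X) (pd (Complex.I • X) fun w => Hf w i i) z).re
        - 4 * (-Complex.I * κ i * pd (Complex.I • X) (fun w => Hf w i 0) z).re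
          + 2 * ‖-Complex.I * κ i‖ ^ 2 * lam 0) / lam i
        - (pd (Complex.I • X) (fun w => Hf w i i) z).re ^ 2 / lam i ^ 2)
      ≤ 4 * ((lev X (fun w => Hf w i i) z).re / lam i
        - ‖ξ i‖ ^ 2 / (lam 0 * lam i)) := by
    have h4 := lev_re_eq X (fun w => Hf w i i) z
    have hli := hlam i
    have hl0 := hlam 0
    rcases eq_or_ne i 0 with rfl | hi
    · have h5 := norm_wd_sq_of_im_eq_zero (pd_im_eq_zero (hd 0 0) hre X)
        (pd_im_eq_zero (hd 0 0) hre (Complex.I • X))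
      simp only [hκ, if_true, mul_zero, zero_mul, Complex.zero_re, norm_zero, hξ, h5]
      rw [mul_sub, ← mul_div_assoc, h4]
      refine le_of_eq ?_
      field_simp
      ring
    · have h6 : (1 * κ i * pd X (fun w => Hf w i 0) z).re
          + (-Complex.I * κ i * pd (Complex.I • X) (fun w => Hf w i 0) z).re
          = 2 * ‖ξ i‖ ^ 2 / lam 0 := by
        have : 1 * κ i * pd X (fun w => Hf w i 0) z
            + -Complex.I * κ i * pd (Complex.I • X) (fun w => Hf w i 0) z
            = ((2 / lam 0 : ℝ) : ℂ) * (ξ i * conj (ξ i)) := by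
          simp only [hκ, if_neg hi]
          have hx : ξ i = wd X (fun w => Hf w i 0) z := rfl
          nth_rewrite 3 [hx]
          rw [wd]
          push_cast
          ring
        rw [← Complex.add_re, this, Complex.mul_conj, ← Complex.ofReal_mul, Complex.ofReal_re,
          Complex.normSq_eq_norm_sq]
        ring
      have h7 : ‖κ i‖ ^ 2 = ‖ξ i‖ ^ 2 / lam 0 ^ 2 := by
        simp [hκ, hi, div_pow]
      have h8 : ‖-Complex.I * κ i‖ = ‖κ i‖ := by simp
      rw [h8, one_mul (κ i), h7]
      rw [one_mul (κ i)] at h6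
      have s1 : 0 ≤ (pd X (fun w => Hf w i i) z).re ^ 2 / lam i ^ 2 := by positivity
      have s2 : 0 ≤ (pd (Complex.I • X) (fun w => Hf w i i) z).re ^ 2 / lam i ^ 2 := by positivity
      have h9 : ((pd X (pd X fun w => Hf w i i) z).re
            - 4 * (κ i * pd X (fun w => Hf w i 0) z).re
            + 2 * (‖ξ i‖ ^ 2 / lam 0 ^ 2) * lam 0) / lam i
          + ((pd (Complex.I • X) (pd (Complex.I • X) fun w => Hf w i i) z).re
            - 4 * (-Complex.I * κ i * pd (Complex.I • X) (fun w => Hf w i 0) z).re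
            + 2 * (‖ξ i‖ ^ 2 / lam 0 ^ 2) * lam 0) / lam i
          = (4 * (lev X (fun w => Hf w i i) z).re - 4 * (2 * ‖ξ i‖ ^ 2 / lam 0)
            + 4 * (‖ξ i‖ ^ 2 / lam 0 ^ 2) * lam 0) / lam i := by
        rw [h4, ← h6]; ring
      have h10 : (4 * (lev X (fun w => Hf w i i) z).re - 4 * (2 * ‖ξ i‖ ^ 2 / lam 0)
            + 4 * (‖ξ i‖ ^ 2 / lam 0 ^ 2) * lam 0) / lam i
          = 4 * ((lev X (fun w => Hf w i i) z).re / lam i - ‖ξ i‖ ^ 2 / (lam 0 * lam i)) := by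
        field_simp
        ring
      linarith
  have hsum : ∑ i, q i * K2 = k * (esym k fun i => (lam i)⁻¹) * K2 := by
    rw [← Finset.sum_mul, hq, sum_esymAt]
  simp only [mul_add, Finset.sum_add_distrib, hsum] at l1 l2
  have h11 := Finset.sum_le_sum fun i (_ : i ∈ Finset.univ) =>
    mul_le_mul_of_nonneg_left (key i) (hq0 i)
  simp only [mul_add, Finset.sum_add_distrib] at h11
  have h12 : ∑ i, q i * (4 * ((lev X (fun w => Hf w i i) z).re / lam i
      - ‖ξ i‖ ^ 2 / (lam 0 * lam i)))
      = 4 * ∑ i, q i * ((lev X (fun w => Hf w i i) z).re / lam i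
      - ‖ξ i‖ ^ 2 / (lam 0 * lam i)) := by
    rw [Finset.mul_sum]; exact Finset.sum_congr rfl fun i _ => by ring
  rw [h12] at h11
  linarith

end PointwiseEstimate

/-! ### The maximum principle at a maximum point -/

section MaxPoint

open Filter Topology

variable {n : ℕ} {F : Type*} [NormedAddCommGroup F] [NormedSpace ℝ F]

lemma lev_add {f g : Cn n → F} {z : Cn n} (hf : ContDiffAt ℝ 2 f z) (hg : ContDiffAt ℝ 2 g z)
    (X : Cn n) : lev X (fun w => f w + g w) z = lev X f z + lev X g z := by
  have h (a : Cn n) : pd a (pd a fun w => f w + g w) z = pd a (pd a f) z + pd a (pd a g) z := by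
    have h1 : (pd a fun w => f w + g w) =ᶠ[𝓝 z] fun w => pd a f w + pd a g w := by
      filter_upwards [hf.eventually (by simp), hg.eventually (by simp)] with w h1 h2
      exact pd_add (h1.differentiableAt (by simp)) (h2.differentiableAt (by simp)) a
    rw [(eventuallyEq_pd h1 a).eq_of_nhds]
    exact pd_add ((hf.pd a (m := 1) (by norm_num)).differentiableAt one_ne_zero)
      ((hg.pd a (m := 1) (by norm_num)).differentiableAt one_ne_zero) a
  simp only [lev, h]
  module

lemma lev_const (X : Cn n) (c : F) (z : Cn n) : lev X (fun _ => c) z = 0 := by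
  have h (a : Cn n) : pd a (fun _ : Cn n => c) = fun _ => 0 := by ext w; simp [pd]
  have h0 (a : Cn n) : pd a (fun _ : Cn n => (0 : F)) = fun _ => 0 := by ext w; simp [pd]
  simp [lev, h, h0]

lemma wd_add {f g : Cn n → ℂ} {z : Cn n} (hf : DifferentiableAt ℝ f z)
    (hg : DifferentiableAt ℝ g z) (X : Cn n) :
    wd X (fun w => f w + g w) z = wd X f z + wd X g z := by
  simp only [wd, pd_add hf hg]
  ring

lemma lev_clm_comp {F' : Type*} [NormedAddCommGroup F'] [NormedSpace ℝ F'] (L : F →L[ℝ] F')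
    {f : Cn n → F} {z : Cn n} (hf : ContDiffAt ℝ 2 f z) (X : Cn n) :
    lev X (fun w => L (f w)) z = L (lev X f z) := by
  simp only [lev, pd_pd_clm_comp L hf, map_smul, map_add]

/-- The coefficients of `χ_U = χ + (√-1/2) ∂∂̄U` with respect to the constant vector fields `X`. -/
def frameHess (chi : Cn n → Matrix (Fin n) (Fin n) ℂ) (U : Cn n → ℝ) (X : Fin n → Cn n)
    (w : Cn n) : Matrix (Fin n) (Fin n) ℂ :=
  Matrix.of fun i j => chi w i j + wdbar (X j) (wd (X i) fun y => (U y : ℂ)) w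

section

variable {chi : Cn n → Matrix (Fin n) (Fin n) ℂ} {U : Cn n → ℝ} {X : Fin n → Cn n} {z : Cn n}

lemma contDiffAt_frameHess (hchi : ∀ i j, ContDiffAt ℝ 2 (fun w => chi w i j) z)
    (hU : ContDiffAt ℝ 4 U z) (i j : Fin n) :
    ContDiffAt ℝ 2 (fun w => frameHess chi U X w i j) z := by
  have hUc : ContDiffAt ℝ 4 (fun y => (U y : ℂ)) z :=
    Complex.ofRealCLM.contDiff.contDiffAt.comp z hU
  exact (hchi i j).add ((hUc.wd (X i) (m := 3) (by norm_num)).wdbar (X j) (by norm_num))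

lemma frameHess_diag_eventuallyEq (hU : ContDiffAt ℝ 2 U z) (i : Fin n) :
    (fun w => frameHess chi U X w i i)
      =ᶠ[𝓝 z] fun w => chi w i i + lev (X i) (fun y => (U y : ℂ)) w := by
  have hUc : ContDiffAt ℝ 2 (fun y => (U y : ℂ)) z :=
    Complex.ofRealCLM.contDiff.contDiffAt.comp z hU
  filter_upwards [hUc.eventually (by simp)] with w hw
  simp only [frameHess, Matrix.of_apply, wdbar_wd_self hw]

/-- Fourth derivatives of `U` commute, so that `∂ₓ∂ₓ̄ H_{00̄}` and `∂₀∂₀̄ H_{iī}` differ by second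
derivatives of `χ` only. -/
lemma re_lev_frameHess_sub_le {K : ℝ} (hchi : ∀ i j, ContDiffAt ℝ 2 (fun w => chi w i j) z)
    (hU : ContDiffAt ℝ 4 U z) (hchiK : ∀ l i j, JetBound K (X l) (fun w => chi w i j) z)
    (i j : Fin n) :
    (lev (X j) (fun w => frameHess chi U X w i i) z).re - K
      ≤ (lev (X i) (fun w => frameHess chi U X w j j) z).re := by
  have hUc : ContDiffAt ℝ 4 (fun y => (U y : ℂ)) z :=
    Complex.ofRealCLM.contDiff.contDiffAt.comp z hU
  have h (a b : Fin n) : lev (X b) (fun w => frameHess chi U X w a a) z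
      = lev (X b) (fun w => chi w a a) z + lev (X b) (lev (X a) fun y => (U y : ℂ)) z := by
    rw [(eventuallyEq_lev (frameHess_diag_eventuallyEq (hU.of_le (by norm_num)) a) (X b)).eq_of_nhds]
    exact lev_add (hchi a a) (hUc.lev (X a) (by norm_num)) (X b)
  rw [h, h, lev_comm hUc (X i) (X j), Complex.add_re, Complex.add_re]
  have h1 := (abs_le.1 ((Complex.abs_re_le_norm _).trans (hchiK j i i).norm_lev_le)).2
  have h2 := (abs_le.1 ((Complex.abs_re_le_norm _).trans (hchiK i j j).norm_lev_le)).1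
  linarith

/-- Third derivatives of type `(2,1)` of `U` commute, so that `∂ᵢ H_{00̄}` and `∂₀ H_{i0̄}` differ
by the torsion terms coming from `χ` only. -/
lemma norm_wd_frameHess_le {K : ℝ} (hchi : ∀ i j, ContDiffAt ℝ 2 (fun w => chi w i j) z)
    (hU : ContDiffAt ℝ 4 U z) (hchiK : ∀ l i j, JetBound K (X l) (fun w => chi w i j) z)
    (i j : Fin n) :
    ‖wd (X i) (fun w => frameHess chi U X w j j) z‖
      ≤ ‖wd (X j) (fun w => frameHess chi U X w i j) z‖ + 2 * K := by
  have hUc : ContDiffAt ℝ 4 (fun y => (U y : ℂ)) z :=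
    Complex.ofRealCLM.contDiff.contDiffAt.comp z hU
  have h (a b : Fin n) : wd (X a) (fun w => frameHess chi U X w b j) z
      = wd (X a) (fun w => chi w b j) z
        + wd (X a) (wdbar (X j) (wd (X b) fun y => (U y : ℂ))) z :=
    wd_add ((hchi b j).differentiableAt (by simp))
      (((hUc.wd (X b) (m := 3) (by norm_num)).wdbar (X j) (m := 2) (by norm_num)).differentiableAt
        (by simp)) _
  have h1 : wd (X i) (fun w => frameHess chi U X w j j) z
      = wd (X j) (fun w => frameHess chi U X w i j) z
        + (wd (X i) (fun w => chi w j j) z - wd (X j) (fun w => chi w i j) z) := by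
    rw [h, h, wd_wdbar_wd_comm (hUc.of_le (by norm_num)) (X i) (X j) (X j)]
    ring
  rw [h1]
  refine (norm_add_le _ _).trans (add_le_add le_rfl ((norm_sub_le _ _).trans ?_))
  linarith [(hchiK i j j).norm_wd_le, (hchiK j i j).norm_wd_le]

end

lemma eq_esym_of_mixedDet_eq {k : ℕ} {lam : Fin n → ℝ} (hlam : ∀ i, 0 < lam i) {c : ℝ}
    (h : mixedDet k (Matrix.diagonal fun i => (lam i : ℂ)) 1
      = c * (Matrix.diagonal fun i => (lam i : ℂ)).det) : c = esym k fun i => (lam i)⁻¹ := by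
  rw [mixedDet_diagonal_one k hlam] at h
  have hne : (Matrix.diagonal fun i => (lam i : ℂ)).det ≠ 0 := by
    rw [Matrix.det_diagonal]
    exact Finset.prod_ne_zero_iff.2 fun i _ => by exact_mod_cast (hlam i).ne'
  exact_mod_cast (mul_right_cancel₀ hne h).symm

/-- Elementary inequality absorbing the torsion terms: `W` is the logarithmic gradient of the
largest eigenvalue, `T` that of `u - v`, and `e` the second derivative of the exponential part of
the auxiliary function. -/
lemma torsion_absorb {K A a e l W2 T ξ2 w : ℝ} (hA : 1 ≤ A) (he : 0 < e)
    (he1 : e ≤ 1) (ha : a = A + e) (hl : 0 < l) (hle : 9 * (K * (A + 1)) ^ 2 ≤ l ^ 2 * e)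
    (hW2 : W2 = w ^ 2 / l ^ 2) (hWT : W2 ≤ K ^ 2 + 2 * a ^ 2 * T)
    (hξ : w ^ 2 - 4 * K * w ≤ ξ2) :
    -(K ^ 2 + 1) ≤ ξ2 / l ^ 2 - W2 + e * T := by
  have ha1 : 1 ≤ a := by linarith
  have h1 : (w ^ 2 - 4 * K * w) / l ^ 2 ≤ ξ2 / l ^ 2 := by gcongr
  have h2 : (w ^ 2 - 4 * K * w) / l ^ 2 = W2 - 4 * K * w / l ^ 2 := by rw [hW2]; ring
  -- `4 K w / l² ≤ η (w / l)² + 4 K² / (l² η)` with `η = e / (2 a²)`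
  have h3 : 4 * K * w / l ^ 2 ≤ e / (2 * a ^ 2) * W2 + 8 * K ^ 2 * a ^ 2 / (l ^ 2 * e) := by
    rw [hW2, ← sub_nonneg]
    have : e / (2 * a ^ 2) * (w ^ 2 / l ^ 2) + 8 * K ^ 2 * a ^ 2 / (l ^ 2 * e) - 4 * K * w / l ^ 2
        = (e * w - 4 * K * a ^ 2) ^ 2 / (2 * a ^ 2 * l ^ 2 * e) := by
      field_simp; ring
    rw [this]; positivity
  have h4 : 8 * K ^ 2 * a ^ 2 / (l ^ 2 * e) ≤ 1 := by
    rw [div_le_one (by positivity)]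
    refine le_trans ?_ hle
    have : a ^ 2 ≤ (A + 1) ^ 2 := by gcongr; linarith
    nlinarith [mul_le_mul_of_nonneg_left this (sq_nonneg K),
      mul_nonneg (sq_nonneg K) (sq_nonneg (A + 1))]
  have h5 : e / (2 * a ^ 2) * W2 ≤ K ^ 2 + e * T := by
    have h6 := mul_le_mul_of_nonneg_left hWT (show 0 ≤ e / (2 * a ^ 2) by positivity)
    have h7 : e / (2 * a ^ 2) * (K ^ 2 + 2 * a ^ 2 * T) = e / (2 * a ^ 2) * K ^ 2 + e * T := by
      field_simp
    have h8 : e / (2 * a ^ 2) ≤ 1 := by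
      rw [div_le_one (by positivity)]; nlinarith
    nlinarith [mul_le_mul_of_nonneg_right h8 (sq_nonneg K)]
  linarith

lemma sq_add_mul_le {K g : ℝ} (a t : ℝ) (h1 : -K ≤ g) (h2 : g ≤ K) :
    (g + a * t) ^ 2 ≤ 2 * K ^ 2 + 2 * a ^ 2 * t ^ 2 := by
  have := sq_le_sq' h1 h2
  linarith [sq_nonneg (g - a * t), show (g + a * t) ^ 2 + (g - a * t) ^ 2
    = 2 * g ^ 2 + 2 * a ^ 2 * t ^ 2 by ring]

lemma add_div_four_le {K a g1 g2 t1 t2 x1 x2 : ℝ} (h1 : -K ≤ g1 ∧ g1 ≤ K) (h2 : -K ≤ g2 ∧ g2 ≤ K)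
    (e1 : x1 = g1 + a * t1) (e2 : x2 = g2 + a * t2) :
    (x1 ^ 2 + x2 ^ 2) / 4 ≤ K ^ 2 + 2 * a ^ 2 * ((t1 ^ 2 + t2 ^ 2) / 4) := by
  have c1 := sq_add_mul_le a t1 h1.1 h1.2
  have c2 := sq_add_mul_le a t2 h2.1 h2.2
  rw [e1, e2]
  linarith

lemma sq_sub_mul_le_sq {K w x : ℝ} (hK : 0 ≤ K) (hw : 0 ≤ w) (hx : 0 ≤ x) (h : w ≤ x + 2 * K) :
    w ^ 2 - 4 * K * w ≤ x ^ 2 := by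
  rcases le_or_gt w (2 * K) with h3 | h3
  · nlinarith
  · nlinarith

/-- The inequality obtained at an interior maximum of
`log H_{00̄} - log G_{00̄} - A s + exp (-s)`, with `s = U - V - m` and in a frame which is
orthonormal and diagonalises `χ_U` at the maximum. -/
lemma max_point_inequality [NeZero n] {k : ℕ} (hk : k ≤ n)
    {chi Gf : Cn n → Matrix (Fin n) (Fin n) ℂ} {U V h : Cn n → ℝ} {lam : Fin n → ℝ}
    {X : Fin n → Cn n} {z : Cn n} (hlam : ∀ i, 0 < lam i)
    (hchi : ∀ i j, ContDiffAt ℝ 2 (fun w => chi w i j) z)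
    (hG : ∀ i j, ContDiffAt ℝ 2 (fun w => Gf w i j) z) (hh : ContDiffAt ℝ 2 h z)
    (hU : ContDiffAt ℝ 4 U z) (hV : ContDiffAt ℝ 2 V z)
    (hH0 : frameHess chi U X z = Matrix.diagonal fun i => (lam i : ℂ)) (hG0 : Gf z = 1)
    (hHpos : ∀ᶠ w in 𝓝 z, (frameHess chi U X w).PosDef) (hGpos : ∀ᶠ w in 𝓝 z, (Gf w).PosDef)
    (heq : ∀ᶠ w in 𝓝 z, mixedDet k (frameHess chi U X w) (Gf w)
      = h w * (frameHess chi U X w).det)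
    {K : ℝ} (hGK : ∀ l i j, JetBound K (X l) (fun w => Gf w i j) z)
    (hchiK : ∀ l i j, JetBound K (X l) (fun w => chi w i j) z) (hhK : JetBound K (X 0) h z)
    (hhle : h z ≤ K) {A m : ℝ} (hA : 1 ≤ A) (hm : m ≤ U z - V z)
    (hmax : IsLocalMax (fun w => Real.log (frameHess chi U X w 0 0).re - Real.log (Gf w 0 0).re
      + (-A * (U w - V w - m) + Real.exp (-(U w - V w - m)))) z)
    (hlam1 : 1 ≤ lam 0)
    (hlamA : 3 * (K * (A + 1)) * Real.exp ((U z - V z - m) / 2) ≤ lam 0) :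
    (A + Real.exp (-(U z - V z - m)))
        * ∑ i, esymAt k (fun i => (lam i)⁻¹) i * (((chi z i i).re + lev (X i) V z) / lam i - 1)
      ≤ (K + k * K * (K + 4 * n * (K + 1) ^ 2 + K ^ 2)) / 2
        + (K ^ 2 + 2 * K + 1) * ∑ i, esymAt k (fun i => (lam i)⁻¹) i * (lam i)⁻¹ := by
  have hμ (i : Fin n) : 0 < (lam i)⁻¹ := inv_pos.2 (hlam i)
  set q := esymAt k (fun i => (lam i)⁻¹) with hq
  have hq0 (i : Fin n) : 0 ≤ q i := esymAt_nonneg hμ i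
  have hK : 0 ≤ K := (norm_nonneg _).trans (hGK 0 0 0).1.1
  set S : Cn n → ℝ := fun w => U w - V w - m with hS
  set e := Real.exp (-(U z - V z - m)) with he
  have he0 : 0 < e := Real.exp_pos _
  have he1 : e ≤ 1 := Real.exp_le_one_iff.2 (by linarith)
  have hSc : ContDiffAt ℝ 2 S z := ((hU.of_le (by norm_num)).sub hV).sub contDiffAt_const
  have hHc (i j : Fin n) := contDiffAt_frameHess (X := X) hchi hU i j
  have hle : 9 * (K * (A + 1)) ^ 2 ≤ lam 0 ^ 2 * e := by
    have h1 : (3 * (K * (A + 1)) * Real.exp ((U z - V z - m) / 2)) ^ 2 ≤ lam 0 ^ 2 := by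
      gcongr
    have h2 : Real.exp ((U z - V z - m) / 2) ^ 2 * e = 1 := by
      rw [he, ← Real.exp_nat_mul, ← Real.exp_add]
      simp; ring
    calc 9 * (K * (A + 1)) ^ 2
        = (3 * (K * (A + 1)) * Real.exp ((U z - V z - m) / 2)) ^ 2 * e := by
          rw [mul_pow _ (Real.exp _), mul_assoc _ _ e, h2]; ring
      _ ≤ lam 0 ^ 2 * e := by gcongr
  have hh0 : h z = esym k fun i => (lam i)⁻¹ := by
    have h1 := heq.self_of_nhds
    rw [hH0, hG0] at h1
    exact eq_esym_of_mixedDet_eq hlam h1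
  -- the second order condition along a real line
  have hH00 : (frameHess chi U X z 0 0).re = lam 0 := by rw [hH0]; simp
  have hG00 : (Gf z 0 0).re = 1 := by rw [hG0]; simp
  have line (a : Cn n) :
      (pd a (fun w => frameHess chi U X w 0 0) z).re / lam 0
        = (pd a (fun w => Gf w 0 0) z).re + (A + e) * pd a S z ∧
      (pd a (pd a fun w => frameHess chi U X w 0 0) z).re / lam 0
        - (pd a (fun w => frameHess chi U X w 0 0) z).re ^ 2 / lam 0 ^ 2
        - (pd a (pd a fun w => Gf w 0 0) z).re - (A + e) * pd a (pd a S) z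
        + e * pd a S z ^ 2 ≤ 0 := by
    have jH := (hasJet2_line (hHc 0 0) a).re.log (by rw [hH00]; exact hlam 0)
    have jG := (hasJet2_line (hG 0 0) a).re.log (by rw [hG00]; exact one_pos)
    have jS := hasJet2_line hSc a
    have jN := (jH.sub jG).add ((jS.real_const_mul (-A)).add jS.neg.exp)
    have hmax' : IsLocalMax (fun s : ℝ => Real.log (frameHess chi U X (z + s • a) 0 0).re
        - Real.log (Gf (z + s • a) 0 0).re
        + (-A * S (z + s • a) + Real.exp (-S (z + s • a)))) 0 := by
      have hcont : Tendsto (fun s : ℝ => z + s • a) (𝓝 0) (𝓝 z) := by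
        have : ContinuousAt (fun s : ℝ => z + s • a) 0 := by fun_prop
        simpa [ContinuousAt] using this
      filter_upwards [hcont.eventually hmax] with s hs
      simpa [hS] using hs
    obtain ⟨j1, j2⟩ := jN.d2_nonpos_of_isLocalMax hmax'
    have hSe : Real.exp (-S z) = e := rfl
    rw [hH00, hG00, hSe] at j1 j2
    refine ⟨by linarith, ?_⟩
    have : 0 ≤ (pd a (fun w => Gf w 0 0) z).re ^ 2 := sq_nonneg _
    norm_num at j2
    linarith
  have hre : ∀ᶠ w in 𝓝 z, (frameHess chi U X w 0 0).im = 0 := hHpos.mono fun w hw =>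
    Complex.conj_eq_iff_im.1 (hw.isHermitian.apply 0 0)
  have hd := (hHc 0 0).differentiableAt (by simp)
  have hlevU (i : Fin n) : lev (X i) U z = lam i - (chi z i i).re := by
    have h1 := (frameHess_diag_eventuallyEq (chi := chi) (X := X)
      (hU.of_le (by norm_num)) i).eq_of_nhds
    have h2 : lev (X i) (fun y => (U y : ℂ)) z = ((lev (X i) U z : ℝ) : ℂ) :=
      lev_clm_comp Complex.ofRealCLM (hU.of_le (by norm_num)) (X i)
    rw [hH0, Matrix.diagonal_apply_eq, h2] at h1
    have h3 := congrArg Complex.re h1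
    simp only [Complex.add_re, Complex.ofReal_re] at h3
    linarith
  have hlevS (i : Fin n) : lev (X i) S z = lam i - ((chi z i i).re + lev (X i) V z) := by
    have h1 : U = fun w => S w + (V w + m) := by ext w; simp [hS]
    have h2 : lev (X i) (fun w => V w + m) z = lev (X i) V z := by
      rw [lev_add hV contDiffAt_const, lev_const, add_zero]
    have h3 := lev_add hSc (hV.add (contDiffAt_const (c := m))) (X i)
    rw [← h1, hlevU, h2] at h3
    linarith
  -- the two real lines in the complex line of `X i` combine, and the torsion terms are absorbed
  have key (i : Fin n) :
      ((lev (X 0) (fun w => frameHess chi U X w i i) z).re / lam 0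
        - ‖wd (X 0) (fun w => frameHess chi U X w i 0) z‖ ^ 2 / lam 0 ^ 2)
        - (K ^ 2 + 2 * K + 1)
        + (A + e) * ((chi z i i).re + lev (X i) V z - lam i) ≤ 0 := by
    obtain ⟨f1, s1⟩ := line (X i)
    obtain ⟨f2, s2⟩ := line (Complex.I • X i)
    set T := (pd (X i) S z ^ 2 + pd (Complex.I • X i) S z ^ 2) / 4 with hT
    set w := ‖wd (X i) (fun w => frameHess chi U X w 0 0) z‖ with hw
    have hw2 := norm_wd_sq_of_im_eq_zero (pd_im_eq_zero hd hre (X i))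
      (pd_im_eq_zero hd hre (Complex.I • X i))
    have hG1 := abs_le.1 ((Complex.abs_re_le_norm _).trans (hGK i 0 0).1.1)
    have hG2 := abs_le.1 ((Complex.abs_re_le_norm _).trans (hGK i 0 0).2.1)
    have hW : w ^ 2 / lam 0 ^ 2 ≤ K ^ 2 + 2 * (A + e) ^ 2 * T := by
      have h1 : w ^ 2 / lam 0 ^ 2
          = (((pd (X i) (fun w => frameHess chi U X w 0 0) z).re / lam 0) ^ 2
            + ((pd (Complex.I • X i) (fun w => frameHess chi U X w 0 0) z).re / lam 0) ^ 2) / 4 := by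
        rw [hw, hw2]; ring
      rw [h1]
      exact add_div_four_le hG1 hG2 f1 f2
    have hξ : w ^ 2 - 4 * K * w ≤ ‖wd (X 0) (fun w => frameHess chi U X w i 0) z‖ ^ 2 := by
      exact sq_sub_mul_le_sq hK (norm_nonneg _) (norm_nonneg _)
        (norm_wd_frameHess_le hchi hU hchiK i 0)
    have habs := torsion_absorb hA he0 he1 rfl (hlam 0) hle rfl hW hξ
    have hlH := lev_re_eq (X i) (fun w => frameHess chi U X w 0 0) z
    have hlG := lev_re_eq (X i) (fun w => Gf w 0 0) z
    have hGb := (abs_le.1 ((Complex.abs_re_le_norm _).trans (hGK i 0 0).norm_lev_le)).2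
    have hlS : 4 * lev (X i) S z
        = pd (X i) (pd (X i) S) z + pd (Complex.I • X i) (pd (Complex.I • X i) S) z := by
      rw [lev, smul_eq_mul]; ring
    have hmain : (lev (X i) (fun w => frameHess chi U X w 0 0) z).re / lam 0
        - w ^ 2 / lam 0 ^ 2 - (lev (X i) (fun w => Gf w 0 0) z).re - (A + e) * lev (X i) S z
        + e * T ≤ 0 := by
      have h1 : (lev (X i) (fun w => frameHess chi U X w 0 0) z).re / lam 0
          = ((pd (X i) (pd (X i) fun w => frameHess chi U X w 0 0) z).re / lam 0
            + (pd (Complex.I • X i) (pd (Complex.I • X i)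
              fun w => frameHess chi U X w 0 0) z).re / lam 0) / 4 := by
        rw [← add_div, ← hlH]; ring
      have h2 : w ^ 2 / lam 0 ^ 2
          = ((pd (X i) (fun w => frameHess chi U X w 0 0) z).re ^ 2 / lam 0 ^ 2
            + (pd (Complex.I • X i) (fun w => frameHess chi U X w 0 0) z).re ^ 2 / lam 0 ^ 2) / 4 := by
        rw [hw, hw2]; ring
      have h3 : (A + e) * lev (X i) S z = ((A + e) * pd (X i) (pd (X i) S) z
          + (A + e) * pd (Complex.I • X i) (pd (Complex.I • X i) S) z) / 4 := by
        rw [← mul_add, ← hlS]; ring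
      rw [h1, h2, h3, hT]
      linarith
    have h4 := re_lev_frameHess_sub_le (X := X) hchi hU hchiK i 0
    have h5 : ((lev (X 0) (fun w => frameHess chi U X w i i) z).re - K) / lam 0
        ≤ (lev (X i) (fun w => frameHess chi U X w 0 0) z).re / lam 0 :=
      div_le_div_of_nonneg_right h4 (hlam 0).le
    have h6 : K / lam 0 ≤ K := div_le_self hK hlam1
    rw [sub_div] at h5
    rw [hlevS] at hmain
    linarith
  have hsv := second_variation hk (X := X 0) hlam hHc hG hh hH0 hG0 hHpos hGpos heq (hGK 0) hhK
  rw [← hh0, ← hq] at hsv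
  set E := K + k * K * (K + 4 * n * (K + 1) ^ 2 + K ^ 2) with hE
  have hE1 : K + k * h z * (K + 4 * n * (K + 1) ^ 2 + K ^ 2) ≤ E := by
    rw [hE]; gcongr
  have hE0 : 0 ≤ E := by positivity
  have hsum := Finset.sum_nonpos fun i (_ : i ∈ (Finset.univ : Finset (Fin n))) =>
    mul_nonpos_of_nonneg_of_nonpos (mul_nonneg (hq0 i) (hμ i).le) (key i)
  have hsplit : ∑ i, q i * (lam i)⁻¹ *
      (((lev (X 0) (fun w => frameHess chi U X w i i) z).re / lam 0
        - ‖wd (X 0) (fun w => frameHess chi U X w i 0) z‖ ^ 2 / lam 0 ^ 2)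
        - (K ^ 2 + 2 * K + 1)
        + (A + e) * ((chi z i i).re + lev (X i) V z - lam i))
      = (∑ i, q i * ((lev (X 0) (fun w => frameHess chi U X w i i) z).re / lam i
        - ‖wd (X 0) (fun w => frameHess chi U X w i 0) z‖ ^ 2 / (lam 0 * lam i))) / lam 0
        - (K ^ 2 + 2 * K + 1) * ∑ i, q i * (lam i)⁻¹
        + (A + e) * ∑ i, q i * (((chi z i i).re + lev (X i) V z) / lam i - 1) := by
    rw [Finset.sum_div, Finset.mul_sum, Finset.mul_sum, ← Finset.sum_sub_distrib,
      ← Finset.sum_add_distrib]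
    refine Finset.sum_congr rfl fun i _ => ?_
    have h1 := (hlam i).ne'
    have h2 := (hlam 0).ne'
    field_simp
  rw [hsplit] at hsum
  have h7 : -E / 2 ≤ (∑ i, q i * ((lev (X 0) (fun w => frameHess chi U X w i i) z).re / lam i
        - ‖wd (X 0) (fun w => frameHess chi U X w i 0) z‖ ^ 2 / (lam 0 * lam i))) / lam 0 := by
    rw [le_div_iff₀ (hlam 0)]
    nlinarith
  linarith

end MaxPoint

section MaxPointBound

open Filter Topology

variable {n : ℕ}

/-- The bound on the eigenvalue `lam 0` at a maximum point. The cone condition enters through the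
matrix `P`, which exceeds the reference form in the direction of the maximal eigenvector only; the
constant `A` is chosen so large that the resulting gain beats all error terms. -/
lemma max_point_bound [NeZero n] {k : ℕ} (hk : k ≤ n)
    {chi Gf : Cn n → Matrix (Fin n) (Fin n) ℂ} {U V h : Cn n → ℝ} {lam : Fin n → ℝ}
    {X : Fin n → Cn n} {z : Cn n} (hlam : ∀ i, 0 < lam i)
    (hchi : ∀ i j, ContDiffAt ℝ 2 (fun w => chi w i j) z)
    (hG : ∀ i j, ContDiffAt ℝ 2 (fun w => Gf w i j) z) (hh : ContDiffAt ℝ 2 h z)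
    (hU : ContDiffAt ℝ 4 U z) (hV : ContDiffAt ℝ 2 V z)
    (hH0 : frameHess chi U X z = Matrix.diagonal fun i => (lam i : ℂ)) (hG0 : Gf z = 1)
    (hHpos : ∀ᶠ w in 𝓝 z, (frameHess chi U X w).PosDef) (hGpos : ∀ᶠ w in 𝓝 z, (Gf w).PosDef)
    (heq : ∀ᶠ w in 𝓝 z, mixedDet k (frameHess chi U X w) (Gf w)
      = h w * (frameHess chi U X w).det)
    {K : ℝ} (hGK : ∀ l i j, JetBound K (X l) (fun w => Gf w i j) z)
    (hchiK : ∀ l i j, JetBound K (X l) (fun w => chi w i j) z) (hhK : JetBound K (X 0) h z)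
    (hhle : h z ≤ K) {A m : ℝ} (hA : 1 ≤ A) (hm : m ≤ U z - V z)
    (hmax : IsLocalMax (fun w => Real.log (frameHess chi U X w 0 0).re - Real.log (Gf w 0 0).re
      + (-A * (U w - V w - m) + Real.exp (-(U w - V w - m)))) z)
    {P : Matrix (Fin n) (Fin n) ℂ} (hP : P.PosDef) {θ ε N κ : ℝ} (hθ : 0 < θ) (hN : 0 ≤ N)
    (hκ : 0 < κ) (hκh : κ ≤ h z) (hcone : (mixedDet k P 1).re ≤ (1 - θ) * h z * P.det.re)
    (hPdiag : ∀ i, (P i i).re ≤ (chi z i i).re + lev (X i) V z - ε + if i = 0 then N else 0)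
    (hAε : (K + 1) ^ 2 ≤ A * ε)
    (hAθ : K + k * K * (K + 4 * n * (K + 1) ^ 2 + K ^ 2) < A * θ * κ) :
    lam 0 ≤ (1 + 2 * N / θ + 3 * (K * (A + 1))) * Real.exp ((U z - V z - m) / 2) := by
  have hμ (i : Fin n) : 0 < (lam i)⁻¹ := inv_pos.2 (hlam i)
  have hK : 0 ≤ K := (norm_nonneg _).trans (hGK 0 0 0).1.1
  have hA0 : 0 < A := by linarith
  have hexp : 1 ≤ Real.exp ((U z - V z - m) / 2) := Real.one_le_exp (by linarith)
  have hKA : 0 ≤ 3 * (K * (A + 1)) := by positivity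
  have hNθ : 0 ≤ 2 * N / θ := by positivity
  by_contra! hcon
  have hc1 : 1 + 2 * N / θ + 3 * (K * (A + 1)) ≤ lam 0 :=
    (le_mul_of_one_le_right (by positivity) hexp).trans hcon.le
  have hlam1 : 1 ≤ lam 0 := by linarith
  have hlamA : 3 * (K * (A + 1)) * Real.exp ((U z - V z - m) / 2) ≤ lam 0 :=
    le_trans (by gcongr; linarith) hcon.le
  have hlamN : 2 * N / θ ≤ lam 0 := by linarith
  have hmain := max_point_inequality hk hlam hchi hG hh hU hV hH0 hG0 hHpos hGpos heq hGK hchiK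
    hhK hhle hA hm hmax hlam1 hlamA
  have hh0 : h z = esym k fun i => (lam i)⁻¹ := by
    have h1 := heq.self_of_nhds
    rw [hH0, hG0] at h1
    exact eq_esym_of_mixedDet_eq hlam h1
  rw [hh0] at hcone hκh
  have hc := add_le_sum_esymAt_mul_of_mixedDet_le hk hlam hP hcone
  have hq0 (i : Fin n) : 0 ≤ esymAt k (fun i => (lam i)⁻¹) i := esymAt_nonneg hμ i
  have hsq := sum_esymAt k fun i => (lam i)⁻¹
  have hq1 := esymAt_le (k := k) hμ 0
  set q := esymAt k (fun i => (lam i)⁻¹) with hq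
  set c := esym k (fun i => (lam i)⁻¹) with hcdef
  set S := ∑ i, q i * (lam i)⁻¹ with hS
  have hS0 : 0 ≤ S := Finset.sum_nonneg fun i _ => mul_nonneg (hq0 i) (hμ i).le
  have h1 : ∑ i, q i * ((lam i)⁻¹ * (P i i).re)
      ≤ ∑ i, q i * (((chi z i i).re + lev (X i) V z) / lam i - 1) + k * c - ε * S
        + N * (q 0 * (lam 0)⁻¹) := by
    rw [← hsq, hS, Finset.mul_sum]
    have h2 : N * (q 0 * (lam 0)⁻¹) = ∑ i, if i = 0 then N * (q i * (lam i)⁻¹) else 0 := by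
      rw [Finset.sum_ite_eq' Finset.univ (0 : Fin n)]; simp
    rw [h2, ← Finset.sum_add_distrib, ← Finset.sum_sub_distrib, ← Finset.sum_add_distrib]
    refine Finset.sum_le_sum fun i _ => ?_
    have h3 := mul_le_mul_of_nonneg_left (hPdiag i) (mul_nonneg (hq0 i) (hμ i).le)
    refine le_of_eq_of_le (by ring) (h3.trans (le_of_eq ?_))
    split_ifs <;> ring
  -- the excess of `P` in the direction `X 0` is harmless because `q 0 / lam 0` is small
  have h4 : N * (q 0 * (lam 0)⁻¹) ≤ θ / 2 * c := by
    have h5 : N * (lam 0)⁻¹ ≤ θ / 2 := by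
      rw [← div_eq_mul_inv, div_le_iff₀ (hlam 0)]
      rw [div_le_iff₀ hθ] at hlamN
      linarith
    calc N * (q 0 * (lam 0)⁻¹) = N * (lam 0)⁻¹ * q 0 := by ring
      _ ≤ θ / 2 * c := by
        have := mul_nonneg hN (hμ 0).le
        have := hq0 0
        gcongr
  set Q := ∑ i, q i * (((chi z i i).re + lev (X i) V z) / lam i - 1) with hQ
  have h6 : θ / 2 * c + ε * S ≤ Q := by linarith
  have he0 : 0 ≤ Real.exp (-(U z - V z - m)) := (Real.exp_pos _).le
  have hε : 0 ≤ ε := by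
    by_contra! hneg
    nlinarith [mul_pos_of_neg_of_neg hneg (neg_lt_zero.2 hA0), sq_nonneg (K + 1)]
  have h7 : A * (θ / 2 * c + ε * S) ≤ (A + Real.exp (-(U z - V z - m))) * Q := by
    have : 0 ≤ θ / 2 * c + ε * S := by
      have : 0 < c := by linarith
      positivity
    exact mul_le_mul (by linarith) h6 this (by linarith)
  have h8 : (K + 1) ^ 2 * S ≤ A * ε * S := by gcongr
  have h9 : A * θ * κ ≤ A * θ * c := by gcongr
  nlinarith

end MaxPointBound

/-! ### Hermitian forms and simultaneous diagonalisation -/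

section HermForm

open Filter Topology Matrix

variable {n : ℕ}

/-- The real part of the sesquilinear form of `M` on the diagonal. -/
def herm (M : Matrix (Fin n) (Fin n) ℂ) (y : Fin n → ℂ) : ℝ := (star y ⬝ᵥ M *ᵥ y).re

lemma herm_add (M N : Matrix (Fin n) (Fin n) ℂ) (y : Fin n → ℂ) :
    herm (M + N) y = herm M y + herm N y := by
  simp [herm, Matrix.add_mulVec, dotProduct_add]

lemma herm_sub (M N : Matrix (Fin n) (Fin n) ℂ) (y : Fin n → ℂ) :
    herm (M - N) y = herm M y - herm N y := by
  simp [herm, Matrix.sub_mulVec, dotProduct_sub]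

lemma herm_smul (r : ℝ) (M : Matrix (Fin n) (Fin n) ℂ) (y : Fin n → ℂ) :
    herm ((r : ℂ) • M) y = r * herm M y := by
  simp [herm, Matrix.smul_mulVec, dotProduct_smul]

lemma herm_smul_vec (c : ℂ) (M : Matrix (Fin n) (Fin n) ℂ) (y : Fin n → ℂ) :
    herm M (c • y) = ‖c‖ ^ 2 * herm M y := by
  have h : star (c • y) ⬝ᵥ M *ᵥ (c • y) = ((‖c‖ ^ 2 : ℝ) : ℂ) * (star y ⬝ᵥ M *ᵥ y) := by
    rw [Matrix.mulVec_smul, star_smul, smul_dotProduct, dotProduct_smul, smul_eq_mul, smul_eq_mul,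
      ← mul_assoc]
    congr 1
    rw [← Complex.normSq_eq_norm_sq, Complex.normSq_eq_conj_mul_self]
    rfl
  rw [herm, h, Complex.re_ofReal_mul, herm]

lemma herm_conj (M Y : Matrix (Fin n) (Fin n) ℂ) (y : Fin n → ℂ) :
    herm (Yᴴ * M * Y) y = herm M (Y *ᵥ y) := by
  rw [herm, herm, ← mulVec_mulVec, ← mulVec_mulVec, star_mulVec, ← dotProduct_mulVec]

lemma re_conj_apply_self (M Y : Matrix (Fin n) (Fin n) ℂ) (i : Fin n) :
    ((Yᴴ * M * Y) i i).re = herm M (Y.col i) := by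
  rw [conjTranspose_mul_mul_apply, herm]

lemma herm_one (y : Fin n → ℂ) : herm 1 y = ∑ i, ‖y i‖ ^ 2 := by
  simp only [herm, one_mulVec, dotProduct, Complex.re_sum, Pi.star_apply]
  refine Finset.sum_congr rfl fun i _ => ?_
  rw [← Complex.normSq_eq_norm_sq]
  simp [Complex.normSq_apply]

lemma posDef_iff_herm {M : Matrix (Fin n) (Fin n) ℂ} :
    M.PosDef ↔ M.IsHermitian ∧ ∀ y, y ≠ 0 → 0 < herm M y := by
  rw [posDef_iff_dotProduct_mulVec]
  refine and_congr_right fun hM => forall_congr' fun y => imp_congr_right fun _ => ?_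
  have h : (star y ⬝ᵥ M *ᵥ y).im = 0 := by
    have := hM.im_star_dotProduct_mulVec_self y
    simpa using this
  rw [Complex.lt_def, herm]
  exact ⟨fun h => h.1, fun h' => ⟨h', h.symm⟩⟩

lemma eventually_herm_pos {T : Type*} [TopologicalSpace T] {t₀ : T}
    {M : T → Matrix (Fin n) (Fin n) ℂ} (hM : ContinuousAt M t₀)
    (h : ∀ y, y ≠ 0 → 0 < herm (M t₀) y) : ∀ᶠ t in 𝓝 t₀, ∀ y, y ≠ 0 → 0 < herm (M t) y := by
  have hev : ∀ᶠ t in 𝓝 t₀, ∀ y ∈ Metric.sphere (0 : Fin n → ℂ) 1, 0 < herm (M t) y := by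
    refine (isCompact_sphere 0 1).eventually_forall_of_forall_eventually fun y hy => ?_
    have hc : Continuous fun p : Matrix (Fin n) (Fin n) ℂ × (Fin n → ℂ) => herm p.1 p.2 := by
      unfold herm
      exact Complex.continuous_re.comp (Continuous.dotProduct (by fun_prop) (by fun_prop))
    have hc' : ContinuousAt (fun p : T × (Fin n → ℂ) => herm (M p.1) p.2) (t₀, y) :=
      hc.continuousAt.comp (x := (t₀, y)) (f := fun p : T × (Fin n → ℂ) => (M p.1, p.2))
        ((hM.comp continuousAt_fst).prodMk continuousAt_snd)
    refine hc'.eventually (lt_mem_nhds (h y ?_))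
    rintro rfl
    simp at hy
  filter_upwards [hev] with t ht y hy
  have hn : 0 < ‖y‖ := norm_pos_iff.2 hy
  have h1 := ht ((‖y‖⁻¹ : ℂ) • y) (by simp [norm_smul, hn.ne'])
  rw [herm_smul_vec] at h1
  exact pos_of_mul_pos_right h1 (by positivity)

lemma exists_herm_one_le {T : Type*} [TopologicalSpace T] {t₀ : T}
    {G : T → Matrix (Fin n) (Fin n) ℂ} (hG : ContinuousAt G t₀)
    (h : ∀ y, y ≠ 0 → 0 < herm (G t₀) y) :
    ∃ c : ℝ, 0 < c ∧ ∀ᶠ t in 𝓝 t₀, ∀ y, c * herm 1 y ≤ herm (G t) y := by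
  have hc : ContinuousAt (fun p : T × ℝ => G p.1 - (p.2 : ℂ) • (1 : Matrix (Fin n) (Fin n) ℂ))
      (t₀, 0) :=
    (hG.comp continuousAt_fst).sub
      ((Complex.continuous_ofReal.continuousAt.comp continuousAt_snd).smul continuousAt_const)
  have h1 := eventually_herm_pos hc (by simpa using h)
  rw [nhds_prod_eq] at h1
  obtain ⟨pa, ha, pb, hb, hab⟩ := eventually_prod_iff.1 h1
  obtain ⟨c, hc0, hc⟩ := ((frequently_gt_nhds (0 : ℝ)).and_eventually hb).exists
  refine ⟨c, hc0, ha.mono fun t ht y => ?_⟩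
  rcases eq_or_ne y 0 with rfl | hy
  · simp [herm]
  · have := hab ht hc y hy
    rw [herm_sub, herm_smul] at this
    linarith

/-- Simultaneous diagonalisation of two Hermitian matrices, the first of which is positive. -/
lemma exists_conj_eq_one_and_diagonal {G H : Matrix (Fin n) (Fin n) ℂ} (hG : G.PosDef)
    (hH : H.IsHermitian) :
    ∃ (Y : Matrix (Fin n) (Fin n) ℂ) (lam : Fin n → ℝ), Yᴴ * G * Y = 1 ∧
      Yᴴ * H * Y = diagonal fun i => (lam i : ℂ) := by
  obtain ⟨M, δ, -, hδ, hMG⟩ := exists_unipotentUpper_conj_eq_diagonal hG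
  set D : Matrix (Fin n) (Fin n) ℂ := diagonal fun i => (((√(δ i))⁻¹ : ℝ) : ℂ) with hD
  have hDh : Dᴴ = D := by
    rw [hD, diagonal_conjTranspose]
    congr 1
    ext i
    simp
  set Z := M * D with hZ
  have hZG : Zᴴ * G * Z = 1 := by
    have : Zᴴ * G * Z = Dᴴ * (Mᴴ * G * M) * D := by
      simp only [hZ, conjTranspose_mul, Matrix.mul_assoc]
    rw [this, hMG, hDh, hD, diagonal_mul_diagonal, diagonal_mul_diagonal, ← diagonal_one]
    congr 1
    ext i
    norm_cast
    have h1 := Real.mul_self_sqrt (hδ i).le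
    have h2 := (Real.sqrt_pos.2 (hδ i)).ne'
    rw [← h1]
    field_simp
    rw [Real.sqrt_sq (Real.sqrt_nonneg _)]
  have hA : (Zᴴ * H * Z).IsHermitian := isHermitian_conjTranspose_mul_mul _ hH
  set W : Matrix (Fin n) (Fin n) ℂ := hA.eigenvectorUnitary.1 with hW
  have hWW : Wᴴ * W = 1 := by
    have := (Matrix.mem_unitaryGroup_iff').1 hA.eigenvectorUnitary.2
    simpa [hW, star_eq_conjTranspose] using this
  refine ⟨Z * W, hA.eigenvalues, ?_, ?_⟩
  · have : (Z * W)ᴴ * G * (Z * W) = Wᴴ * (Zᴴ * G * Z) * W := by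
      simp only [conjTranspose_mul, Matrix.mul_assoc]
    rw [this, hZG, Matrix.mul_one, hWW]
  · have h1 : (Z * W)ᴴ * H * (Z * W) = Wᴴ * (Zᴴ * H * Z) * W := by
      simp only [conjTranspose_mul, Matrix.mul_assoc]
    have h2 := hA.spectral_theorem
    rw [Unitary.conjStarAlgAut_apply] at h2
    rw [h1]
    nth_rewrite 1 [h2]
    rw [star_eq_conjTranspose, ← hW]
    have h3 : Wᴴ * (W * diagonal (RCLike.ofReal ∘ hA.eigenvalues) * Wᴴ) * W
        = (Wᴴ * W) * diagonal (RCLike.ofReal ∘ hA.eigenvalues) * (Wᴴ * W) := by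
      simp only [Matrix.mul_assoc]
    rw [h3, hWW, Matrix.one_mul, Matrix.mul_one]
    rfl

/-- The trace of `G⁻¹ H` in a frame that is orthonormal for `G`. -/
lemma trace_inv_mul_eq {G H Y : Matrix (Fin n) (Fin n) ℂ} (hY : Yᴴ * G * Y = 1) :
    (G⁻¹ * H).trace = (Yᴴ * H * Y).trace := by
  have h1 : Yᴴ * (G * Y) = 1 := by rw [← Matrix.mul_assoc, hY]
  have h2 : G * (Y * Yᴴ) = 1 := by rw [← Matrix.mul_assoc]; exact mul_eq_one_comm.1 h1
  rw [Matrix.inv_eq_right_inv h2, Matrix.mul_assoc, trace_mul_comm, Matrix.mul_assoc]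

end HermForm

/-! ### Constant frames -/

section Frames

open Filter Topology Matrix

variable {n : ℕ}

/-- The complex Hessian `U_{i j̄}` of a real function on `ℂⁿ`. -/
def hess (U : Cn n → ℝ) (z : Cn n) : Matrix (Fin n) (Fin n) ℂ :=
  fun i j => dZbar j (dZ i fun y => (U y : ℂ)) z

/-- The `(1,0)`-vector with components `conj (Y a i)`; in the frame formed by these vectors a
Hermitian matrix `H` becomes `Yᴴ H Y`. -/
def frameVec (Y : Matrix (Fin n) (Fin n) ℂ) (i : Fin n) : Cn n := WithLp.toLp 2 (star (Y.col i))

lemma frameVec_apply (Y : Matrix (Fin n) (Fin n) ℂ) (i a : Fin n) :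
    frameVec Y i a = conj (Y a i) := rfl

lemma wd_add_smul (f : Cn n → ℂ) (z : Cn n) (c : ℂ) (X X' : Cn n) :
    wd (c • X + X') f z = c * wd X f z + wd X' f z := by
  have h1 : c • X = c.re • X + c.im • (Complex.I • X) := by
    conv_lhs => rw [← Complex.re_add_im c]
    rw [add_smul, mul_smul, Complex.coe_smul, Complex.coe_smul]
  have h2 : Complex.I • (c • X) = c.re • (Complex.I • X) - c.im • X := by
    rw [h1, smul_add, smul_comm Complex.I c.re, smul_comm Complex.I c.im, smul_smul Complex.I,
      Complex.I_mul_I]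
    module
  simp only [wd, pd, smul_add, h2]
  rw [h1]
  simp only [map_add, map_sub, map_smul, Complex.real_smul]
  conv_rhs => rw [← Complex.re_add_im c]
  linear_combination (1 / 2 * c.im * (fderiv ℝ f z (Complex.I • X))) * Complex.I_sq

lemma wdbar_add_smul (f : Cn n → ℂ) (z : Cn n) (c : ℂ) (X X' : Cn n) :
    wdbar (c • X + X') f z = conj c * wdbar X f z + wdbar X' f z := by
  have h1 : c • X = c.re • X + c.im • (Complex.I • X) := by
    conv_lhs => rw [← Complex.re_add_im c]
    rw [add_smul, mul_smul, Complex.coe_smul, Complex.coe_smul]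
  have h2 : Complex.I • (c • X) = c.re • (Complex.I • X) - c.im • X := by
    rw [h1, smul_add, smul_comm Complex.I c.re, smul_comm Complex.I c.im, smul_smul Complex.I,
      Complex.I_mul_I]
    module
  have h3 : conj c = c.re - c.im * Complex.I := by
    apply Complex.ext <;> simp
  simp only [wdbar, pd, smul_add, h2]
  rw [h1, h3]
  simp only [map_add, map_sub, map_smul, Complex.real_smul]
  linear_combination (1 / 2 * c.im * (fderiv ℝ f z (Complex.I • X))) * Complex.I_sq

lemma eq_sum_smul_single (X : Cn n) :
    X = ∑ a, X a • (EuclideanSpace.single a 1 : Cn n) := by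
  ext j
  simp [Finset.sum_apply, Pi.single_apply]

lemma wd_eq_sum (f : Cn n → ℂ) (z X : Cn n) :
    wd X f z = ∑ a, X a * dZ a f z := by
  have h (s : Finset (Fin n)) (x : Fin n → ℂ) :
      wd (∑ a ∈ s, x a • (EuclideanSpace.single a 1 : Cn n)) f z = ∑ a ∈ s, x a * dZ a f z := by
    induction s using Finset.cons_induction with
    | empty => simp [wd, pd]
    | cons a s ha ih => rw [Finset.sum_cons, Finset.sum_cons, wd_add_smul, ih, dZ_eq_wd]
  conv_lhs => rw [eq_sum_smul_single X]
  exact h _ _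

lemma wdbar_eq_sum (f : Cn n → ℂ) (z X : Cn n) :
    wdbar X f z = ∑ a, conj (X a) * dZbar a f z := by
  have h (s : Finset (Fin n)) (x : Fin n → ℂ) :
      wdbar (∑ a ∈ s, x a • (EuclideanSpace.single a 1 : Cn n)) f z
        = ∑ a ∈ s, conj (x a) * dZbar a f z := by
    induction s using Finset.cons_induction with
    | empty => simp [wdbar, pd]
    | cons a s ha ih => rw [Finset.sum_cons, Finset.sum_cons, wdbar_add_smul, ih, dZbar_eq_wdbar]
  conv_lhs => rw [eq_sum_smul_single X]
  exact h _ _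

lemma pd_sum {F ι : Type*} [NormedAddCommGroup F] [NormedSpace ℝ F] (s : Finset ι)
    {f : ι → Cn n → F} {z : Cn n} (hf : ∀ a ∈ s, DifferentiableAt ℝ (f a) z) (X : Cn n) :
    pd X (fun w => ∑ a ∈ s, f a w) z = ∑ a ∈ s, pd X (f a) z := by
  simp only [pd]
  rw [fderiv_fun_sum hf]
  simp

lemma wdbar_wd_frameVec {U : Cn n → ℝ} {z : Cn n} (hU : ContDiffAt ℝ 2 U z)
    (Y : Matrix (Fin n) (Fin n) ℂ) (i j : Fin n) :
    wdbar (frameVec Y j) (wd (frameVec Y i) fun y => (U y : ℂ)) z = (Yᴴ * hess U z * Y) i j := by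
  have hUc : ContDiffAt ℝ 2 (fun y => (U y : ℂ)) z :=
    Complex.ofRealCLM.contDiff.contDiffAt.comp z hU
  have hd (a : Fin n) : DifferentiableAt ℝ (dZ a fun y => (U y : ℂ)) z := by
    rw [dZ_eq_wd]
    exact (hUc.wd _ (m := 1) (by norm_num)).differentiableAt one_ne_zero
  have h1 : (wd (frameVec Y i) fun y => (U y : ℂ))
      = fun w => ∑ a, frameVec Y i a * dZ a (fun y => (U y : ℂ)) w := by
    ext w; exact wd_eq_sum _ _ _
  have hpd (X : Cn n) : pd X (fun w => ∑ a, frameVec Y i a * dZ a (fun y => (U y : ℂ)) w) z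
      = ∑ a, frameVec Y i a * pd X (dZ a fun y => (U y : ℂ)) z := by
    rw [pd_sum _ fun a _ => (hd a).const_mul _]
    exact Finset.sum_congr rfl fun a _ => pd_const_mul (hd a) _ _
  have h2 (X : Cn n) : wdbar X (fun w => ∑ a, frameVec Y i a * dZ a (fun y => (U y : ℂ)) w) z
      = ∑ a, frameVec Y i a * wdbar X (dZ a fun y => (U y : ℂ)) z := by
    simp only [wdbar]
    rw [hpd, hpd, Finset.mul_sum, ← Finset.sum_add_distrib, Finset.mul_sum]
    exact Finset.sum_congr rfl fun a _ => by ring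
  rw [h1, h2, Matrix.mul_apply]
  simp_rw [wdbar_eq_sum, Matrix.mul_apply, Finset.sum_mul, Finset.mul_sum]
  rw [Finset.sum_comm]
  refine Finset.sum_congr rfl fun b _ => Finset.sum_congr rfl fun a _ => ?_
  simp only [frameVec_apply, Matrix.conjTranspose_apply, hess, Complex.conj_conj,
    ← starRingEnd_apply]
  ring

lemma frameHess_conj {C : Cn n → Matrix (Fin n) (Fin n) ℂ} {U : Cn n → ℝ} {z : Cn n}
    (hU : ContDiffAt ℝ 2 U z) (Y : Matrix (Fin n) (Fin n) ℂ) :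
    frameHess (fun w => Yᴴ * C w * Y) U (frameVec Y) z = Yᴴ * (C z + hess U z) * Y := by
  ext i j
  rw [frameHess, Matrix.of_apply, wdbar_wd_frameVec hU, Matrix.mul_add, Matrix.add_mul]
  rfl

lemma herm_hess {U : Cn n → ℝ} {z : Cn n} (hU : ContDiffAt ℝ 2 U z) (X : Cn n) :
    herm (hess U z) (star X.ofLp) = lev X U z := by
  rcases Nat.eq_zero_or_pos n with rfl | hn
  · have : X = 0 := Subsingleton.elim _ _
    have h0 (f : Cn 0 → ℝ) : pd 0 f = fun _ => 0 := by ext w; simp [pd]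
    simp [this, herm, lev, h0]
  set i : Fin n := ⟨0, hn⟩
  set Y : Matrix (Fin n) (Fin n) ℂ := Matrix.of fun a _ => conj (X a) with hY
  have hX : frameVec Y i = X := by ext a; simp [frameVec_apply, hY]
  have hc : Y.col i = star X.ofLp := rfl
  have hUc : ContDiffAt ℝ 2 (fun y => (U y : ℂ)) z :=
    Complex.ofRealCLM.contDiff.contDiffAt.comp z hU
  have h2 : lev X (fun y => (U y : ℂ)) z = ((lev X U z : ℝ) : ℂ) :=
    lev_clm_comp Complex.ofRealCLM hU X
  rw [← hc, ← re_conj_apply_self, ← wdbar_wd_frameVec hU, hX, wdbar_wd_self hUc, h2,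
    Complex.ofReal_re]

lemma ContDiffAt.hess_apply {U : Cn n → ℝ} {z : Cn n} {k m : WithTop ℕ∞}
    (hU : ContDiffAt ℝ k U z) (h : m + 1 + 1 ≤ k) (i j : Fin n) :
    ContDiffAt ℝ m (fun w => hess U w i j) z := by
  have hUc : ContDiffAt ℝ k (fun y => (U y : ℂ)) z :=
    Complex.ofRealCLM.contDiff.contDiffAt.comp z hU
  simp only [hess, dZ_eq_wd, dZbar_eq_wdbar]
  exact (hUc.wd _ h).wdbar _ le_rfl

lemma continuousAt_hess {U : Cn n → ℝ} {z : Cn n} (hU : ContDiffAt ℝ 2 U z) :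
    ContinuousAt (hess U) z :=
  continuousAt_pi.2 fun i => continuousAt_pi.2 fun j =>
    (ContDiffAt.hess_apply hU (m := 0) (by norm_num) i j).continuousAt

/-! ### Local bounds for derivatives -/

variable {F : Type*} [NormedAddCommGroup F] [NormedSpace ℝ F]

lemma JetBound.mono {K K' : ℝ} {X : Cn n} {f : Cn n → F} {z : Cn n} (h : JetBound K X f z)
    (hK : K ≤ K') : JetBound K' X f z :=
  ⟨⟨h.1.1.trans hK, h.1.2.trans hK⟩, h.2.1.trans hK, h.2.2.trans hK⟩

lemma JetBound.const_mul {K r : ℝ} {X : Cn n} {f : Cn n → ℂ} {z : Cn n} (h : JetBound K X f z)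
    (hf : ContDiffAt ℝ 2 f z) {c : ℂ} (hc : ‖c‖ ≤ r) :
    JetBound (r * K) X (fun w => c * f w) z := by
  have h0 : 0 ≤ r := (norm_nonneg _).trans hc
  have h1 (a : Cn n) : pd a (fun w => c * f w) z = c * pd a f z :=
    pd_const_mul (hf.differentiableAt (by simp)) c a
  have h2 (a : Cn n) : pd a (pd a fun w => c * f w) z = c * pd a (pd a f) z :=
    pd_pd_clm_comp (ContinuousLinearMap.mul ℝ ℂ c) hf a a
  simp only [JetBound, h1, h2, norm_mul]
  obtain ⟨⟨a1, a2⟩, a3, a4⟩ := h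
  exact ⟨⟨by gcongr, by gcongr⟩, by gcongr, by gcongr⟩

lemma JetBound.sum {ι : Type*} (s : Finset ι) {K : ι → ℝ} {X : Cn n} {f : ι → Cn n → F} {z : Cn n}
    (h : ∀ a ∈ s, JetBound (K a) X (f a) z) (hf : ∀ a ∈ s, ContDiffAt ℝ 2 (f a) z) :
    JetBound (∑ a ∈ s, K a) X (fun w => ∑ a ∈ s, f a w) z := by
  have h1 (b : Cn n) : pd b (fun w => ∑ a ∈ s, f a w) z = ∑ a ∈ s, pd b (f a) z :=
    pd_sum s (fun a ha => (hf a ha).differentiableAt (by simp)) b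
  have h2 (b : Cn n) : pd b (pd b fun w => ∑ a ∈ s, f a w) z = ∑ a ∈ s, pd b (pd b (f a)) z := by
    have h3 : (pd b fun w => ∑ a ∈ s, f a w) =ᶠ[𝓝 z] fun w => ∑ a ∈ s, pd b (f a) w := by
      have : ∀ᶠ w in 𝓝 z, ∀ a ∈ s, ContDiffAt ℝ 2 (f a) w :=
        (Filter.eventually_all_finset s).2 fun a ha => (hf a ha).eventually (by simp)
      filter_upwards [this] with w hw
      exact pd_sum s (fun a ha => (hw a ha).differentiableAt (by simp)) b
    rw [(eventuallyEq_pd h3 b).eq_of_nhds]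
    exact pd_sum s (fun a ha =>
      ((hf a ha).pd b (m := 1) (by norm_num)).differentiableAt one_ne_zero) b
  simp only [JetBound, h1, h2]
  exact ⟨⟨norm_sum_le_of_le _ fun a ha => (h a ha).1.1,
      norm_sum_le_of_le _ fun a ha => (h a ha).1.2⟩,
    norm_sum_le_of_le _ fun a ha => (h a ha).2.1, norm_sum_le_of_le _ fun a ha => (h a ha).2.2⟩

lemma eventually_norm_fderiv_lt {E : Type*} [NormedAddCommGroup E] [NormedSpace ℝ E] {f : E → F}
    {z : E} (hf : ContDiffAt ℝ 2 f z) :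
    ∀ᶠ w in 𝓝 z, ‖fderiv ℝ f w‖ < ‖fderiv ℝ f z‖ + 1 ∧
      ‖fderiv ℝ (fderiv ℝ f) w‖ < ‖fderiv ℝ (fderiv ℝ f) z‖ + 1 := by
  have hf1 : ContDiffAt ℝ 1 (fderiv ℝ f) z := hf.fderiv_right (by norm_num)
  have hf2 : ContDiffAt ℝ 0 (fderiv ℝ (fderiv ℝ f)) z := hf1.fderiv_right (by norm_num)
  have h {G : Type _} [NormedAddCommGroup G] {g : E → G} (hg : ContinuousAt g z) :
      ∀ᶠ w in 𝓝 z, ‖g w‖ < ‖g z‖ + 1 := hg.norm.eventually (gt_mem_nhds (lt_add_one _))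
  exact (h hf1.continuousAt).and (h (G := E →L[ℝ] E →L[ℝ] F) hf2.continuousAt)

lemma exists_jetBound {f : Cn n → F} {z : Cn n} (hf : ContDiffAt ℝ 2 f z) (R : ℝ) :
    ∃ K : ℝ, ∀ᶠ w in 𝓝 z, ∀ X : Cn n, ‖X‖ ≤ R → JetBound K X f w := by
  refine ⟨(‖fderiv ℝ f z‖ + 1) * R + (‖fderiv ℝ (fderiv ℝ f) z‖ + 1) * R * R, ?_⟩
  filter_upwards [hf.eventually (by simp),
    eventually_norm_fderiv_lt hf] with w hw ⟨h1, h2⟩ X hX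
  have hR : 0 ≤ R := (norm_nonneg _).trans hX
  have key (a : Cn n) (ha : ‖a‖ ≤ R) :
      ‖pd a f w‖ ≤ (‖fderiv ℝ f z‖ + 1) * R + (‖fderiv ℝ (fderiv ℝ f) z‖ + 1) * R * R ∧
      ‖pd a (pd a f) w‖
        ≤ (‖fderiv ℝ f z‖ + 1) * R + (‖fderiv ℝ (fderiv ℝ f) z‖ + 1) * R * R := by
    rw [pd_pd_eq hw]
    constructor
    · have : ‖pd a f w‖ ≤ (‖fderiv ℝ f z‖ + 1) * R :=
        ((fderiv ℝ f w).le_opNorm a).trans (by gcongr)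
      exact this.trans (le_add_of_nonneg_right (by positivity))
    · have : ‖fderiv ℝ (fderiv ℝ f) w a a‖ ≤ (‖fderiv ℝ (fderiv ℝ f) z‖ + 1) * R * R :=
        ((fderiv ℝ (fderiv ℝ f) w).le_opNorm₂ a a).trans (by gcongr)
      exact this.trans (le_add_of_nonneg_left (by positivity))
  exact ⟨key X hX, key _ (by rwa [norm_smul, Complex.norm_I, one_mul])⟩

/-- The coefficients of a smooth matrix field in constant frames of bounded size have uniformly
bounded derivatives along bounded vectors. -/
lemma exists_jetBound_conj {M : Cn n → Matrix (Fin n) (Fin n) ℂ} {z : Cn n}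
    (hM : ∀ i j, ContDiffAt ℝ 2 (fun w => M w i j) z) (R : ℝ) :
    ∃ K : ℝ, ∀ᶠ w in 𝓝 z, ∀ (Y : Matrix (Fin n) (Fin n) ℂ) (X : Cn n), (∀ i j, ‖Y i j‖ ≤ R) →
      ‖X‖ ≤ R → ∀ i j, JetBound K X (fun w => (Yᴴ * M w * Y) i j) w := by
  choose K hK using fun i j => exists_jetBound (hM i j) R
  refine ⟨∑ b, ∑ a, R * R * K a b, ?_⟩
  have h1 : ∀ᶠ w in 𝓝 z, ∀ i j, (∀ X : Cn n, ‖X‖ ≤ R → JetBound (K i j) X (fun w => M w i j) w) ∧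
      ContDiffAt ℝ 2 (fun w => M w i j) w :=
    eventually_all.2 fun i => eventually_all.2 fun j =>
      (hK i j).and ((hM i j).eventually (by simp))
  filter_upwards [h1] with w hw Y X hY hX i j
  have h2 : (fun w => (Yᴴ * M w * Y) i j)
      = fun w => ∑ b, ∑ a, (Yᴴ i a * Y b j) * M w a b := by
    ext w
    simp only [Matrix.mul_apply, Finset.sum_mul]
    exact Finset.sum_congr rfl fun b _ => Finset.sum_congr rfl fun a _ => by ring
  rw [h2]
  have hc (a b : Fin n) : ‖Yᴴ i a * Y b j‖ ≤ R * R := by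
    rw [norm_mul, Matrix.conjTranspose_apply, norm_star]
    have := hY a i
    have := hY b j
    have : 0 ≤ R := (norm_nonneg _).trans this
    gcongr
  refine JetBound.sum _ (fun b _ => JetBound.sum _ (fun a _ => ?_) fun a _ => ?_) fun b _ => ?_
  · exact ((hw a b).1 X hX).const_mul (hw a b).2 (hc a b)
  · exact contDiffAt_const.mul (hw a b).2
  · exact ContDiffAt.sum fun a _ => contDiffAt_const.mul (hw a b).2

end Frames

/-! ### The local estimate -/

section LocalEstimate

open Filter Topology Matrix

variable {n : ℕ}

lemma star_dotProduct_vecMulVec (ξ y : Fin n → ℂ) :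
    star y ⬝ᵥ vecMulVec ξ (star ξ) *ᵥ y = ((‖star y ⬝ᵥ ξ‖ ^ 2 : ℝ) : ℂ) := by
  have h1 : star ξ ⬝ᵥ y = star (star y ⬝ᵥ ξ) := star_dotProduct _ _
  rw [vecMulVec_mulVec, h1]
  simp only [MulOpposite.smul_eq_mul_unop, dotProduct_smul,
    Complex.star_def, MulOpposite.unop_op]
  rw [Complex.mul_conj, Complex.normSq_eq_norm_sq]

lemma herm_vecMulVec (ξ y : Fin n → ℂ) :
    herm (vecMulVec ξ (star ξ)) y = ‖star y ⬝ᵥ ξ‖ ^ 2 := by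
  rw [herm, star_dotProduct_vecMulVec, Complex.ofReal_re]

lemma continuous_mixedDet (k : ℕ) :
    Continuous fun p : Matrix (Fin n) (Fin n) ℂ × Matrix (Fin n) (Fin n) ℂ =>
      mixedDet k p.1 p.2 := by
  unfold mixedDet
  refine continuous_finsetSum _ fun J _ => Continuous.matrix_det ?_
  refine continuous_pi fun i => continuous_pi fun j => ?_
  simp only [replaceRows_apply]
  split_ifs <;> fun_prop

/-- The cone condition at one point persists, with uniform constants and some room to spare, in a
neighbourhood of that point. -/
lemma exists_cone_constants {k : ℕ} {B G : Cn n → Matrix (Fin n) (Fin n) ℂ} {h : Cn n → ℝ}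
    {z₀ : Cn n} (hB : ContinuousAt B z₀) (hG : ContinuousAt G z₀) (hh : ContinuousAt h z₀)
    (hBpos : ∀ᶠ w in 𝓝 z₀, (B w).PosDef) (hGpos : ∀ᶠ w in 𝓝 z₀, (G w).PosDef)
    (hcone : ∀ ξ : Fin n → ℂ, ξ ≠ 0 → ∃ s : ℝ, 0 < s ∧
      0 < ((h z₀ : ℂ) * (B z₀ + (s : ℂ) • vecMulVec ξ (star ξ)).det
        - mixedDet k (B z₀ + (s : ℂ) • vecMulVec ξ (star ξ)) (G z₀)).re) :
    ∃ ε N : ℝ, 0 < ε ∧ 0 ≤ N ∧ ∀ᶠ z in 𝓝 z₀, ∀ ξ ∈ Metric.sphere (0 : Fin n → ℂ) 1,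
      ∃ s t : ℝ, 0 ≤ s ∧ s ≤ N ∧ ε ≤ t ∧
        (B z - (t : ℂ) • G z + (s : ℂ) • vecMulVec ξ (star ξ)).PosDef ∧
        (mixedDet k (B z - (t : ℂ) • G z + (s : ℂ) • vecMulVec ξ (star ξ)) (G z)).re
          ≤ (1 - t) * h z * (B z - (t : ℂ) • G z + (s : ℂ) • vecMulVec ξ (star ξ)).det.re := by
  refine (isCompact_sphere (0 : Fin n → ℂ) 1).induction_on (p := fun S => ∃ ε N : ℝ, 0 < ε ∧
    0 ≤ N ∧ ∀ᶠ z in 𝓝 z₀, ∀ ξ ∈ S, ∃ s t : ℝ, 0 ≤ s ∧ s ≤ N ∧ ε ≤ t ∧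
        (B z - (t : ℂ) • G z + (s : ℂ) • vecMulVec ξ (star ξ)).PosDef ∧
        (mixedDet k (B z - (t : ℂ) • G z + (s : ℂ) • vecMulVec ξ (star ξ)) (G z)).re
          ≤ (1 - t) * h z * (B z - (t : ℂ) • G z + (s : ℂ) • vecMulVec ξ (star ξ)).det.re)
    ⟨1, 0, one_pos, le_rfl, by simp⟩ ?_ ?_ ?_
  · rintro S T hST ⟨ε, N, hε, hN, h⟩
    exact ⟨ε, N, hε, hN, h.mono fun z hz ξ hξ => hz ξ (hST hξ)⟩
  · rintro S T ⟨ε, N, hε, hN, h⟩ ⟨ε', N', hε', hN', h'⟩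
    refine ⟨min ε ε', max N N', lt_min hε hε', hN.trans (le_max_left _ _), ?_⟩
    filter_upwards [h, h'] with z hz hz' ξ hξ
    rcases hξ with hξ | hξ
    · obtain ⟨s, t, h1, h2, h3, h4⟩ := hz ξ hξ
      exact ⟨s, t, h1, h2.trans (le_max_left _ _), (min_le_left _ _).trans h3, h4⟩
    · obtain ⟨s, t, h1, h2, h3, h4⟩ := hz' ξ hξ
      exact ⟨s, t, h1, h2.trans (le_max_right _ _), (min_le_right _ _).trans h3, h4⟩
  · intro ξ₀ hξ₀
    -- at `t = 0` both conditions are strict at `(z₀, ξ₀)`, hence they persist for small `t > 0`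
    have hne : ξ₀ ≠ 0 := by rintro rfl; simp at hξ₀
    obtain ⟨s, hs, hs'⟩ := hcone ξ₀ hne
    set Q : (Cn n × (Fin n → ℂ)) × ℝ → Matrix (Fin n) (Fin n) ℂ := fun p =>
      B p.1.1 - (p.2 : ℂ) • G p.1.1 + (s : ℂ) • vecMulVec p.1.2 (star p.1.2) with hQ
    have c1 : ContinuousAt (fun p : (Cn n × (Fin n → ℂ)) × ℝ => p.1.1) ((z₀, ξ₀), 0) :=
      continuousAt_fst.comp continuousAt_fst
    have cB : ContinuousAt (fun p : (Cn n × (Fin n → ℂ)) × ℝ => B p.1.1) ((z₀, ξ₀), 0) :=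
      ContinuousAt.comp (f := fun p : (Cn n × (Fin n → ℂ)) × ℝ => p.1.1) hB c1
    have cG : ContinuousAt (fun p : (Cn n × (Fin n → ℂ)) × ℝ => G p.1.1) ((z₀, ξ₀), 0) :=
      ContinuousAt.comp (f := fun p : (Cn n × (Fin n → ℂ)) × ℝ => p.1.1) hG c1
    have ch : ContinuousAt (fun p : (Cn n × (Fin n → ℂ)) × ℝ => h p.1.1) ((z₀, ξ₀), 0) :=
      ContinuousAt.comp (f := fun p : (Cn n × (Fin n → ℂ)) × ℝ => p.1.1) hh c1
    have ct : Continuous fun p : (Cn n × (Fin n → ℂ)) × ℝ => (p.2 : ℂ) :=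
      Complex.continuous_ofReal.comp continuous_snd
    have cV : Continuous fun p : (Cn n × (Fin n → ℂ)) × ℝ =>
        (s : ℂ) • vecMulVec p.1.2 (star p.1.2) := by
      have h1 : Continuous fun p : (Cn n × (Fin n → ℂ)) × ℝ => vecMulVec p.1.2 (star p.1.2) :=
        Continuous.matrix_vecMulVec (by fun_prop) (continuous_star.comp (by fun_prop))
      exact h1.const_smul (s : ℂ)
    have cQ : ContinuousAt Q ((z₀, ξ₀), 0) :=
      (cB.sub (ct.continuousAt.smul cG)).add cV.continuousAt
    have hQ0 : Q ((z₀, ξ₀), 0) = B z₀ + (s : ℂ) • vecMulVec ξ₀ (star ξ₀) := by simp [hQ]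
    have e1 := eventually_herm_pos cQ fun y hy => by
      rw [hQ0, herm_add, herm_smul, herm_vecMulVec]
      have := (posDef_iff_herm.1 hBpos.self_of_nhds).2 y hy
      positivity
    have c2 : ContinuousAt (fun p : (Cn n × (Fin n → ℂ)) × ℝ =>
        (1 - p.2) * h p.1.1 * (Q p).det.re - (mixedDet k (Q p) (G p.1.1)).re) ((z₀, ξ₀), 0) := by
      have d1 : ContinuousAt (fun p => (Q p).det.re) ((z₀, ξ₀), 0) :=
        ContinuousAt.comp (g := fun p : Matrix (Fin n) (Fin n) ℂ => p.det.re) (f := Q)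
          (Complex.continuous_re.comp continuous_id.matrix_det).continuousAt cQ
      have d2 : ContinuousAt (fun p => (mixedDet k (Q p) (G p.1.1)).re) ((z₀, ξ₀), 0) :=
        ContinuousAt.comp (g := fun p : Matrix (Fin n) (Fin n) ℂ × Matrix (Fin n) (Fin n) ℂ =>
          (mixedDet k p.1 p.2).re) (f := fun p => (Q p, G p.1.1))
          (Complex.continuous_re.comp (continuous_mixedDet k)).continuousAt (cQ.prodMk cG)
      exact (((continuousAt_const.sub continuousAt_snd).mul ch).mul d1).sub d2
    have e2 := c2.eventually (lt_mem_nhds (a := 0) (by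
      beta_reduce
      rw [hQ0]
      rw [Complex.sub_re, Complex.re_ofReal_mul] at hs'
      simpa using hs'))
    have e12 := e1.and e2
    rw [nhds_prod_eq] at e12
    obtain ⟨pa, ha, pb, hb, hab⟩ := eventually_prod_iff.1 e12
    obtain ⟨t, ht0, ht⟩ := ((frequently_gt_nhds (0 : ℝ)).and_eventually hb).exists
    rw [nhds_prod_eq] at ha
    obtain ⟨pz, hz, pξ, hξ, hzξ⟩ := eventually_prod_iff.1 ha
    refine ⟨{ξ | pξ ξ}, mem_nhdsWithin_of_mem_nhds hξ, t, s, ht0, hs.le, ?_⟩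
    filter_upwards [hz, hBpos, hGpos] with z hz hBz hGz ξ hξ
    obtain ⟨f1, f2⟩ := hab (hzξ hz hξ) ht
    refine ⟨s, t, hs.le, le_rfl, le_rfl, posDef_iff_herm.2 ⟨?_, f1⟩, ?_⟩
    · have hr (r : ℝ) : IsSelfAdjoint (r : ℂ) := Complex.conj_ofReal r
      have hv : (vecMulVec ξ (star ξ)).IsHermitian := by
        rw [IsHermitian, conjTranspose_vecMulVec, star_star]
      exact (hBz.isHermitian.sub (hGz.isHermitian.smul (hr t))).add (hv.smul (hr s))
    · exact (sub_pos.1 f2).le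

lemma conjTranspose_col_mulVec_eq {G Y : Matrix (Fin n) (Fin n) ℂ} (hY : Yᴴ * G * Y = 1)
    (i j : Fin n) : star (Y.col j) ⬝ᵥ (G * Y).col i = (1 : Matrix (Fin n) (Fin n) ℂ) j i := by
  rw [← hY, conjTranspose_mul_mul_apply]
  rfl

lemma norm_frameVec_sq (Y : Matrix (Fin n) (Fin n) ℂ) (i : Fin n) :
    ‖frameVec Y i‖ ^ 2 = herm 1 (Y.col i) := by
  rw [EuclideanSpace.norm_sq_eq, herm_one]
  refine Finset.sum_congr rfl fun a _ => ?_
  rw [frameVec_apply, RCLike.norm_conj]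
  rfl

set_option maxHeartbeats 1000000 in
/-- The bound on the largest eigenvalue at the maximum point of the auxiliary function, with
constants that are uniform in a neighbourhood of `z₀`. -/
lemma exists_local_bound [NeZero n] {k : ℕ} (hk : k ≤ n) {C G : Cn n → Matrix (Fin n) (Fin n) ℂ}
    {h V : Cn n → ℝ} {z₀ : Cn n} (hC : ∀ i j, ContDiffAt ℝ 2 (fun w => C w i j) z₀)
    (hG : ∀ i j, ContDiffAt ℝ 2 (fun w => G w i j) z₀) (hh : ContDiffAt ℝ 2 h z₀)
    (hV : ContDiffAt ℝ 2 V z₀) (hh0 : 0 < h z₀) (hGpos : ∀ᶠ w in 𝓝 z₀, (G w).PosDef)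
    (hBpos : ∀ᶠ w in 𝓝 z₀, (C w + hess V w).PosDef)
    (hcone : ∀ ξ : Fin n → ℂ, ξ ≠ 0 → ∃ s : ℝ, 0 < s ∧
      0 < ((h z₀ : ℂ) * (C z₀ + hess V z₀ + (s : ℂ) • vecMulVec ξ (star ξ)).det
        - mixedDet k (C z₀ + hess V z₀ + (s : ℂ) • vecMulVec ξ (star ξ)) (G z₀)).re) :
    ∃ (A₀ : ℝ) (D : ℝ → ℝ), ∀ᶠ z in 𝓝 z₀, ∀ A, A₀ ≤ A → ∀ (U : Cn n → ℝ)
      (Y : Matrix (Fin n) (Fin n) ℂ) (lam : Fin n → ℝ) (m : ℝ), ContDiffAt ℝ 4 U z →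
      m ≤ U z - V z → (∀ᶠ w in 𝓝 z, (C w + hess U w).PosDef) →
      (∀ᶠ w in 𝓝 z, mixedDet k (C w + hess U w) (G w) = h w * (C w + hess U w).det) →
      Yᴴ * G z * Y = 1 → Yᴴ * (C z + hess U z) * Y = (diagonal fun i => (lam i : ℂ)) →
      (∀ᶠ w in 𝓝 z, herm (C w + hess U w) (Y.col 0)
          * Real.exp (-A * (U w - V w - m) + Real.exp (-(U w - V w - m)))
        ≤ lam 0 * Real.exp (-A * (U z - V z - m) + Real.exp (-(U z - V z - m)))
          * herm (G w) (Y.col 0)) →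
      lam 0 ≤ D A * Real.exp ((U z - V z - m) / 2) := by
  have hGc : ContinuousAt G z₀ :=
    continuousAt_pi.2 fun i => continuousAt_pi.2 fun j => (hG i j).continuousAt
  have hCc : ContinuousAt C z₀ :=
    continuousAt_pi.2 fun i => continuousAt_pi.2 fun j => (hC i j).continuousAt
  obtain ⟨c, hc, hcG⟩ := exists_herm_one_le hGc (posDef_iff_herm.1 hGpos.self_of_nhds).2
  -- `R` bounds all frames which are orthonormal for `G` near `z₀`
  set R : ℝ := 1 / c + 1 with hR
  have hR0 : 0 < R := by positivity
  obtain ⟨KC, hKC⟩ := exists_jetBound_conj hC R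
  obtain ⟨KG, hKG⟩ := exists_jetBound_conj hG R
  obtain ⟨Kh, hKh⟩ := exists_jetBound hh R
  set K := |KC| + |KG| + |Kh| + (h z₀ + 1) with hK
  have hK0 : 0 ≤ K := by positivity
  have hKCK : KC ≤ K := by
    have := le_abs_self KC; have := abs_nonneg KG; have := abs_nonneg Kh; linarith
  have hKGK : KG ≤ K := by
    have := le_abs_self KG; have := abs_nonneg KC; have := abs_nonneg Kh; linarith
  have hKhK : Kh ≤ K := by
    have := le_abs_self Kh; have := abs_nonneg KC; have := abs_nonneg KG; linarith
  have hhK : h z₀ + 1 ≤ K := by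
    have := abs_nonneg Kh; have := abs_nonneg KC; have := abs_nonneg KG; linarith
  obtain ⟨ε, N, hε, hN, hcone'⟩ := exists_cone_constants
    (B := fun w => C w + hess V w) (hCc.add (continuousAt_hess hV)) hGc hh.continuousAt hBpos hGpos hcone
  set κ := h z₀ / 2 with hκ
  have hκ0 : 0 < κ := by positivity
  set E := K + k * K * (K + 4 * n * (K + 1) ^ 2 + K ^ 2) with hE
  have hE0 : 0 ≤ E := by positivity
  -- `A₀` is chosen such that the conditions on `A` in `max_point_bound` hold
  refine ⟨1 + (K + 1) ^ 2 / ε + (E + 1) / (ε * κ),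
    fun A => 1 + 2 * (N * (n * R) ^ 2) / ε + 3 * (K * (A + 1)), ?_⟩
  have hall {M : Cn n → Matrix (Fin n) (Fin n) ℂ}
      (hM : ∀ i j, ContDiffAt ℝ 2 (fun w => M w i j) z₀) :
      ∀ᶠ z in 𝓝 z₀, ∀ i j, ContDiffAt ℝ 2 (fun w => M w i j) z :=
    eventually_all.2 fun i => eventually_all.2 fun j => (hM i j).eventually (by simp)
  filter_upwards [hcG, hKC, hKG, hKh, hcone', hall hC, hall hG, hh.eventually (by simp),
    hV.eventually (by simp), hGpos.eventually_nhds,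
    hh.continuousAt.eventually (gt_mem_nhds (lt_add_one (h z₀))),
    hh.continuousAt.eventually (lt_mem_nhds (half_lt_self hh0))]
    with z hcGz hKCz hKGz hKhz hconez hCz hGz hhz hVz hGposz hhlt hhgt
    A hA U Y lam m hU hm hpos heq hY hYH hmax
  have hq1 : 0 ≤ (K + 1) ^ 2 / ε := by positivity
  have hq2 : 0 ≤ (E + 1) / (ε * κ) := by positivity
  have hA1 : 1 ≤ A := by linarith
  have hA2 : (K + 1) ^ 2 ≤ A * ε := by
    rw [← div_le_iff₀ hε]; linarith
  have hA3 : E < A * ε * κ := by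
    have : E + 1 ≤ A * (ε * κ) := by rw [← div_le_iff₀ (by positivity)]; linarith
    linarith
  have hdet : Yᴴ.det * (G z).det * Y.det = 1 := by rw [← det_mul, ← det_mul, hY, det_one]
  have hYdet : Y.det ≠ 0 := right_ne_zero_of_mul_eq_one hdet
  have hYG (i : Fin n) : herm (G z) (Y.col i) = 1 := by
    rw [← re_conj_apply_self, hY, one_apply_eq, Complex.one_re]
  have hnorm (i : Fin n) : ‖frameVec Y i‖ ≤ R := by
    refine le_of_sq_le_sq ?_ hR0.le
    rw [norm_frameVec_sq]
    have h1 := hcGz (Y.col i)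
    rw [hYG, mul_comm, ← le_div_iff₀ hc] at h1
    have h2 : 0 < 1 / c := by positivity
    nlinarith
  have hentry (a i : Fin n) : ‖Y a i‖ ≤ R := by
    have h1 := PiLp.norm_apply_le (frameVec Y i) a
    rw [frameVec_apply, RCLike.norm_conj] at h1
    exact h1.trans (hnorm i)
  have hU2 : ContDiffAt ℝ 2 U z := hU.of_le (by norm_num)
  have hfH : ∀ᶠ w in 𝓝 z, frameHess (fun w => Yᴴ * C w * Y) U (frameVec Y) w
      = Yᴴ * (C w + hess U w) * Y :=
    (hU2.eventually (by simp)).mono fun w hw => frameHess_conj hw Y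
  have hlam (i : Fin n) : 0 < lam i := by
    have := posDef_diag_pos (posDef_conj hpos.self_of_nhds hYdet) i
    rwa [hYH, diagonal_apply_eq, Complex.ofReal_re] at this
  have hconj {M : Cn n → Matrix (Fin n) (Fin n) ℂ}
      (hM : ∀ i j, ContDiffAt ℝ 2 (fun w => M w i j) z) (i j : Fin n) :
      ContDiffAt ℝ 2 (fun w => (Yᴴ * M w * Y) i j) z := by
    simp only [Matrix.mul_apply, Finset.sum_mul]
    exact ContDiffAt.sum fun a _ => ContDiffAt.sum fun b _ =>
      (contDiffAt_const.mul (hM _ _)).mul contDiffAt_const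
  -- the covector dual to the maximal direction: `Yᴴ η = e₀`
  set η := (G z * Y).col 0 with hη
  have hηY (i : Fin n) : star (Y.col i) ⬝ᵥ η = if i = 0 then 1 else 0 := by
    rw [hη, conjTranspose_col_mulVec_eq hY, one_apply]
  have hη1 : 1 ≤ n * R * ‖η‖ := by
    have h1 := congrArg norm (hηY 0)
    rw [if_pos rfl, norm_one] at h1
    rw [← h1]
    refine (norm_sum_le _ _).trans ?_
    have : ∀ a ∈ (Finset.univ : Finset (Fin n)), ‖star (Y.col 0) a * η a‖ ≤ R * ‖η‖ := by
      intro a _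
      rw [norm_mul, Pi.star_apply, norm_star]
      exact mul_le_mul (hentry a 0) (norm_le_pi_norm η a) (norm_nonneg _) hR0.le
    refine (Finset.sum_le_sum this).trans ?_
    rw [Finset.sum_const, Finset.card_univ, Fintype.card_fin, nsmul_eq_mul, mul_assoc]
  have hη0 : 0 < ‖η‖ := by
    by_contra! h0
    have : ‖η‖ = 0 := le_antisymm h0 (norm_nonneg _)
    rw [this] at hη1
    norm_num at hη1
  obtain ⟨s, t, hs0, hsN, hεt, hPpos, hPmix⟩ := hconez (((‖η‖⁻¹ : ℝ) : ℂ) • η) (by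
    rw [mem_sphere_zero_iff_norm, norm_smul, Complex.norm_real, norm_inv, norm_norm]
    exact inv_mul_cancel₀ hη0.ne')
  set ξ := ((‖η‖⁻¹ : ℝ) : ℂ) • η with hξ
  set P := C z + hess V z - (t : ℂ) • G z + (s : ℂ) • vecMulVec ξ (star ξ) with hP
  have ht0 : 0 < t := hε.trans_le hεt
  have hPmix' : (mixedDet k (Yᴴ * P * Y) 1).re ≤ (1 - t) * h z * (Yᴴ * P * Y).det.re := by
    have hd : Yᴴ.det * Y.det = ((‖Y.det‖ ^ 2 : ℝ) : ℂ) := by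
      rw [det_conjTranspose, ← Complex.normSq_eq_norm_sq, Complex.normSq_eq_conj_mul_self]
      rfl
    rw [← hY, mixedDet_conj hk, det_mul, det_mul,
      show Yᴴ.det * P.det * Y.det = Yᴴ.det * Y.det * P.det by ring, hd, Complex.re_ofReal_mul,
      Complex.re_ofReal_mul]
    have := mul_le_mul_of_nonneg_left hPmix (sq_nonneg ‖Y.det‖)
    linarith
  have hPdiag (i : Fin n) : ((Yᴴ * P * Y) i i).re ≤ ((Yᴴ * C z * Y) i i).re
      + lev (frameVec Y i) V z - t + if i = 0 then N * (n * R) ^ 2 else 0 := by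
    have hl : herm (hess V z) (Y.col i) = lev (frameVec Y i) V z := by
      rw [← herm_hess hVz, frameVec, star_star]
    rw [re_conj_apply_self, re_conj_apply_self, hP, herm_add, herm_sub, herm_add, herm_smul,
      herm_smul, hYG, hl, herm_vecMulVec, hξ, dotProduct_smul, hηY]
    split_ifs with hi
    · have h1 : ‖((‖η‖⁻¹ : ℝ) : ℂ) • (1 : ℂ)‖ ≤ n * R := by
        rw [norm_smul, Complex.norm_real, norm_inv, norm_norm, norm_one, mul_one,
          inv_le_iff_one_le_mul₀ hη0]
        exact hη1
      have h2 : s * ‖((‖η‖⁻¹ : ℝ) : ℂ) • (1 : ℂ)‖ ^ 2 ≤ N * (n * R) ^ 2 := by gcongr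
      linarith
    · simp
  have hres := max_point_bound hk (chi := fun w => Yᴴ * C w * Y) (Gf := fun w => Yᴴ * G w * Y)
    (U := U) (V := V) (h := h) (lam := lam) (X := frameVec Y) (z := z) hlam (hconj hCz)
    (hconj hGz) hhz hU hVz (by rw [hfH.self_of_nhds, hYH]) hY
    (by
      filter_upwards [hfH, hpos] with w h1 h2
      rw [h1]
      exact posDef_conj h2 hYdet)
    (hGposz.mono fun w hw => posDef_conj hw hYdet)
    (by
      filter_upwards [hfH, heq] with w h1 h2
      rw [h1, mixedDet_conj hk, h2, det_mul, det_mul]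
      ring)
    (K := K)
    (fun l i j => (hKGz Y _ hentry (hnorm l) i j).mono hKGK)
    (fun l i j => (hKCz Y _ hentry (hnorm l) i j).mono hKCK)
    ((hKhz _ (hnorm 0)).mono hKhK) (hhlt.le.trans hhK) hA1 hm
    (by
      have hz1 : (frameHess (fun w => Yᴴ * C w * Y) U (frameVec Y) z 0 0).re = lam 0 := by
        rw [hfH.self_of_nhds, hYH, diagonal_apply_eq, Complex.ofReal_re]
      have hz2 : ((Yᴴ * G z * Y) 0 0).re = 1 := by rw [hY, one_apply_eq, Complex.one_re]
      filter_upwards [hfH, hpos, hGposz, hmax] with w h1 h2 h3 h4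
      rw [hz1, hz2, h1]
      have h5 := posDef_diag_pos (posDef_conj h2 hYdet) 0
      have h6 := posDef_diag_pos (posDef_conj h3 hYdet) 0
      rw [← re_conj_apply_self, ← re_conj_apply_self] at h4
      have h7 := Real.log_le_log (by positivity) h4
      rw [Real.log_mul h5.ne' (Real.exp_pos _).ne', Real.log_mul (by have := hlam 0; positivity)
        h6.ne', Real.log_mul (hlam 0).ne' (Real.exp_pos _).ne', Real.log_exp, Real.log_exp] at h7
      rw [Real.log_one]
      linarith)
    (posDef_conj hPpos hYdet) ht0 (N := N * (n * R) ^ 2) (by positivity) hκ0 hhgt.le hPmix' hPdiag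
    (hA2.trans (by gcongr)) (hA3.trans_le (by gcongr))
  refine hres.trans ?_
  gcongr

end LocalEstimate

/-! ### Change of holomorphic coordinates -/

section Coordinates

open Filter Topology Matrix

variable {n : ℕ}

/-- The complex Hessian is a form of type `(1,1)`: under a holomorphic change of coordinates the
second derivatives of the map cancel. -/
lemma lev_comp {f : Cn n → ℝ} {Φ : Cn n → Cn n} {z : Cn n} (hf : ContDiffAt ℝ 2 f (Φ z))
    (hΦ : ContDiffAt ℂ 2 Φ z) (X : Cn n) :
    lev X (fun w => f (Φ w)) z = lev (fderiv ℂ Φ z X) f (Φ z) := by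
  have hfd : DifferentiableAt ℝ (fderiv ℝ f) (Φ z) :=
    (hf.fderiv_right (m := 1) (by norm_num)).differentiableAt one_ne_zero
  have hΦd : DifferentiableAt ℂ (fderiv ℂ Φ) z :=
    (hΦ.fderiv_right (m := 1) (by norm_num)).differentiableAt one_ne_zero
  have hΦ1 : HasFDerivAt Φ ((fderiv ℂ Φ z).restrictScalars ℝ) z :=
    (hΦ.differentiableAt (by simp)).hasFDerivAt.restrictScalars ℝ
  have first (a : Cn n) : (pd a fun w => f (Φ w))
      =ᶠ[𝓝 z] fun w => fderiv ℝ f (Φ w) (fderiv ℂ Φ w a) := by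
    filter_upwards [hΦ.continuousAt.eventually (hf.eventually (by simp)),
      hΦ.eventually (by simp)] with w h1 h2
    have h3 := (h1.differentiableAt (by simp)).hasFDerivAt.comp w
      ((h2.differentiableAt (by simp)).hasFDerivAt.restrictScalars ℝ)
    have h4 : fderiv ℝ (fun w => f (Φ w)) w = _ := h3.fderiv
    rw [pd, h4]
    rfl
  have second (a : Cn n) : pd a (pd a fun w => f (Φ w)) z
      = fderiv ℝ (fderiv ℝ f) (Φ z) (fderiv ℂ Φ z a) (fderiv ℂ Φ z a)
        + fderiv ℝ f (Φ z) (fderiv ℂ (fderiv ℂ Φ) z a a) := by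
    rw [(eventuallyEq_pd (first a) a).eq_of_nhds]
    have h1 : HasFDerivAt (fun w => fderiv ℝ f (Φ w)) _ z := hfd.hasFDerivAt.comp z hΦ1
    have h2 : HasFDerivAt (fun w => fderiv ℂ Φ w a) _ z :=
      (hΦd.hasFDerivAt.clm_apply (hasFDerivAt_const a z)).restrictScalars ℝ
    have h3 := (h1.clm_apply h2).fderiv
    rw [pd, h3]
    simp [add_comm]
  have hI : fderiv ℂ (fderiv ℂ Φ) z (Complex.I • X) (Complex.I • X)
      = -fderiv ℂ (fderiv ℂ Φ) z X X := by
    rw [map_smul, map_smul, _root_.smul_apply, smul_smul, Complex.I_mul_I, neg_smul,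
      one_smul]
  rw [lev, lev, second, second, pd_pd_eq hf, pd_pd_eq hf, hI, map_smul, map_neg]
  congr 1
  ring

lemma jac_mulVec {M : Type*} [TopologicalSpace M]
    (e e' : OpenPartialHomeomorph M (Cn n)) (x : M) (X : Cn n) :
    jac e e' x *ᵥ X.ofLp = (fderiv ℂ (fun z => e' (e.symm z)) (e x) X).ofLp := by
  conv_rhs => rw [eq_sum_smul_single X]
  ext k
  simp [mulVec, dotProduct, jac, Finset.sum_apply, mul_comm]

end Coordinates

section Charts

open Filter Topology Matrix

variable {n : ℕ} {M : Type*} [TopologicalSpace M] [ChartedSpace (Cn n) M]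

lemma perturb_symm (χ : RealOneOneForm n M) (u : M → ℝ) {e : OpenPartialHomeomorph M (Cn n)}
    {w : Cn n} (hw : w ∈ e.target) :
    perturb χ u e (e.symm w) = χ.coeff e (e.symm w) + hess (fun z => u (e.symm z)) w := by
  have : complexHessian u e (e.symm w) = hess (fun z => u (e.symm z)) (e (e.symm w)) := rfl
  rw [perturb, this, e.right_inv hw]

lemma herm_coeff_eq (χ : RealOneOneForm n M) {e e' : OpenPartialHomeomorph M (Cn n)}
    (he : e ∈ holCharts n M) (he' : e' ∈ holCharts n M) {x : M} (hx : x ∈ e.source)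
    (hx' : x ∈ e'.source) (y : Fin n → ℂ) :
    herm (χ.coeff e x) y = herm (χ.coeff e' x) ((jac e e' x).map conj *ᵥ y) := by
  rw [χ.transform e he e' he' x ⟨hx, hx'⟩, ← herm_conj]
  congr 3
  ext i j
  simp

lemma contDiffOn_transition {e e' : OpenPartialHomeomorph M (Cn n)}
    [IsManifold 𝓘(ℂ, Cn n) ω M] (he : e ∈ holCharts n M) (he' : e' ∈ holCharts n M) :
    ContDiffOn ℂ ω (fun z => e' (e.symm z)) (e.symm ≫ₕ e').source := by
  have h := StructureGroupoid.compatible_of_mem_maximalAtlas he he'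
  have h1 := (mem_groupoid_of_pregroupoid.1 h).1
  simpa [contDiffPregroupoid, Function.comp_def] using h1

lemma isManifold_real [IsManifold 𝓘(ℂ, Cn n) ω M] : IsManifold 𝓘(ℝ, Cn n) ω M := by
  refine isManifold_of_contDiffOn _ _ _ fun e e' he he' => ?_
  have h := (contDiffOn_transition (IsManifold.subset_maximalAtlas he)
    (IsManifold.subset_maximalAtlas he') : ContDiffOn ℂ ω _ (e.symm ≫ₕ e').source)
  simpa [Function.comp_def] using h.restrict_scalars ℝ

variable [IsManifold 𝓘(ℂ, Cn n) ω M]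

lemma contDiffAt_comp_chart_symm {k : WithTop ℕ∞} {u : M → ℝ}
    (hu : ContMDiff 𝓘(ℝ, Cn n) 𝓘(ℝ, ℝ) k u) (p : M) {z : Cn n}
    (hz : z ∈ (chartAt (Cn n) p).target) :
    ContDiffAt ℝ k (fun w => u ((chartAt (Cn n) p).symm w)) z := by
  have := isManifold_real (n := n) (M := M)
  have : IsManifold 𝓘(ℝ, Cn n) k M := IsManifold.of_le (n := ω) le_top
  have h1 := hu.comp_contMDiffOn (contMDiffOn_chart_symm (I := 𝓘(ℝ, Cn n)) (n := k) (x := p))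
  exact (contMDiffOn_iff_contDiffOn.1 h1).contDiffAt
    ((chartAt (Cn n) p).open_target.mem_nhds hz)

lemma chartAt_mem_holCharts (p : M) : chartAt (Cn n) p ∈ holCharts n M :=
  IsManifold.chart_mem_maximalAtlas p

lemma herm_complexHessian_eq {u : M → ℝ} (hu : ContMDiff 𝓘(ℝ, Cn n) 𝓘(ℝ, ℝ) 2 u) {p q x : M}
    (hp : x ∈ (chartAt (Cn n) p).source) (hq : x ∈ (chartAt (Cn n) q).source) (y : Fin n → ℂ) :
    herm (complexHessian u (chartAt (Cn n) p) x) y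
      = herm (complexHessian u (chartAt (Cn n) q) x)
        ((jac (chartAt (Cn n) p) (chartAt (Cn n) q) x).map conj *ᵥ y) := by
  set e := chartAt (Cn n) p with he
  set e' := chartAt (Cn n) q with he'
  set Φ : Cn n → Cn n := fun z => e' (e.symm z) with hΦ
  set X : Cn n := WithLp.toLp 2 (star y) with hX
  have hy : y = star X.ofLp := by simp [hX]
  have hΦx : Φ (e x) = e' x := by simp [hΦ, e.left_inv hp]
  have hxs : e x ∈ (e.symm ≫ₕ e').source := by
    simp [e.map_source hp, e.left_inv hp, hq]
  have hΦc : ContDiffAt ℂ 2 Φ (e x) :=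
    ((contDiffOn_transition (chartAt_mem_holCharts p) (chartAt_mem_holCharts q)).contDiffAt
      ((e.symm ≫ₕ e').open_source.mem_nhds hxs)).of_le le_top
  have hu1 := contDiffAt_comp_chart_symm hu p (e.map_source hp)
  have hu2 := contDiffAt_comp_chart_symm hu q (e'.map_source hq)
  have hev : (fun z => u (e.symm z)) =ᶠ[𝓝 (e x)] fun z => u (e'.symm (Φ z)) := by
    filter_upwards [(e.symm ≫ₕ e').open_source.mem_nhds hxs] with z hz
    have : e.symm z ∈ e'.source := by simpa using hz.2
    rw [hΦ, e'.left_inv this]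
  have h1 : (jac e e' x).map conj *ᵥ y = star (fderiv ℂ Φ (e x) X).ofLp := by
    rw [← jac_mulVec, hy]
    ext k
    simp [mulVec, dotProduct, mul_comm]
  change herm (hess (fun z => u (e.symm z)) (e x)) y
    = herm (hess (fun z => u (e'.symm z)) (e' x)) _
  rw [h1, hy, herm_hess hu1, herm_hess hu2, (eventuallyEq_lev hev X).eq_of_nhds,
    lev_comp (f := fun z => u (e'.symm z)) (by rwa [hΦx]) hΦc, hΦx]

/-- The comparison `a χ_u < c ω` of forms at a point does not depend on the chart. -/
lemma herm_perturb_lt_of_chart (g : HermitianMetric n M) (χ : RealOneOneForm n M) {u : M → ℝ}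
    (hu : ContMDiff 𝓘(ℝ, Cn n) 𝓘(ℝ, ℝ) 2 u) {p q x : M}
    (hp : x ∈ (chartAt (Cn n) p).source) (hq : x ∈ (chartAt (Cn n) q).source) {a c : ℝ}
    (h : ∀ y, y ≠ 0 → a * herm (perturb χ u (chartAt (Cn n) q) x) y
      < c * herm (g.coeff (chartAt (Cn n) q) x) y) :
    ∀ y, y ≠ 0 → a * herm (perturb χ u (chartAt (Cn n) p) x) y
      < c * herm (g.coeff (chartAt (Cn n) p) x) y := by
  intro y hy
  have hG := herm_coeff_eq g.toRealOneOneForm (chartAt_mem_holCharts p) (chartAt_mem_holCharts q)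
    hp hq y
  -- the Jacobian is injective because the metric is positive
  have hne : (jac (chartAt (Cn n) p) (chartAt (Cn n) q) x).map conj *ᵥ y ≠ 0 := by
    intro h0
    have h1 := (posDef_iff_herm.1 (g.posDef _ (chartAt_mem_holCharts p) x hp)).2 y hy
    rw [hG, h0] at h1
    simp [herm] at h1
  have h2 := h _ hne
  rw [perturb, herm_add,
    ← herm_coeff_eq χ (chartAt_mem_holCharts p) (chartAt_mem_holCharts q) hp hq,
    ← herm_complexHessian_eq hu hp hq, ← hG, ← herm_add] at h2
  exact h2

lemma continuousAt_coeff (χ : RealOneOneForm n M) {p x : M}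
    (hx : x ∈ (chartAt (Cn n) p).source) : ContinuousAt (χ.coeff (chartAt (Cn n) p)) x := by
  set e := chartAt (Cn n) p
  refine continuousAt_pi.2 fun i => continuousAt_pi.2 fun j => ?_
  have h1 : ContinuousAt (fun z => χ.coeff e (e.symm z) i j) (e x) :=
    ((χ.smooth e (chartAt_mem_holCharts p) i j).contDiffAt
      (e.open_target.mem_nhds (e.map_source hx))).continuousAt
  refine (ContinuousAt.comp (f := e) h1 (e.continuousAt hx)).congr ?_
  filter_upwards [e.open_source.mem_nhds hx] with y hy
  simp [e.left_inv hy]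

lemma continuousAt_perturb (χ : RealOneOneForm n M) {u : M → ℝ}
    (hu : ContMDiff 𝓘(ℝ, Cn n) 𝓘(ℝ, ℝ) 2 u) {p x : M} (hx : x ∈ (chartAt (Cn n) p).source) :
    ContinuousAt (perturb χ u (chartAt (Cn n) p)) x :=
  (continuousAt_coeff χ hx).add (ContinuousAt.comp (f := chartAt (Cn n) p)
    (continuousAt_hess (contDiffAt_comp_chart_symm hu p ((chartAt (Cn n) p).map_source hx)))
    ((chartAt (Cn n) p).continuousAt hx))

end Charts

/-! ### The maximum principle on a compact manifold -/

section Global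

open Filter Topology Matrix

variable {n : ℕ}

/-- A monotone family of open conditions on a compact space has an optimal constant, and the
condition fails somewhere for that constant. -/
lemma exists_touching {M : Type*} [TopologicalSpace M] [CompactSpace M] [Nonempty M]
    {F : ℝ → M → Prop} (hopen : ∀ c x, F c x → ∃ c' < c, ∀ᶠ x' in 𝓝 x, F c' x')
    (hmono : ∀ c c' x, c ≤ c' → F c x → F c' x) (hex : ∀ x, ∃ c, F c x)
    (hpos : ∀ c x, F c x → 0 < c) :
    ∃ c, (∃ x, ¬ F c x) ∧ ∀ c', c < c' → ∀ x, F c' x := by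
  -- finitely many neighbourhoods suffice, and `F` is monotone in the constant
  have hcov (P : ℝ → Prop) (hP : ∀ a b, P a → P b → P (max a b)) (hP' : ∃ a, P a)
      (h : ∀ x, ∃ c, P c ∧ ∀ᶠ x' in 𝓝 x, F c x') : ∃ c, P c ∧ ∀ x, F c x := by
    have := isCompact_univ.induction_on (X := M) (p := fun S => ∃ c, P c ∧ ∀ x ∈ S, F c x)
      (by simpa using hP') (fun S T hST ⟨c, h1, h2⟩ => ⟨c, h1, fun x hx => h2 x (hST hx)⟩)
      (fun S T ⟨c, h1, h2⟩ ⟨c', h1', h2'⟩ => ⟨max c c', hP _ _ h1 h1', fun x hx =>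
        hx.elim (fun hx => hmono _ _ _ (le_max_left _ _) (h2 x hx))
          fun hx => hmono _ _ _ (le_max_right _ _) (h2' x hx)⟩)
      (fun x _ => by
        obtain ⟨c, h1, h2⟩ := h x
        exact ⟨{x' | F c x'}, mem_nhdsWithin_of_mem_nhds h2, c, h1, fun x hx => hx⟩)
    simpa using this
  obtain ⟨c₀, -, hc₀⟩ := hcov (fun _ => True) (fun _ _ _ _ => trivial) ⟨0, trivial⟩ fun x => by
    obtain ⟨c, hc⟩ := hex x
    obtain ⟨c', -, h⟩ := hopen c x hc
    exact ⟨c', trivial, h⟩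
  set S := {c | ∀ x, F c x} with hS
  have hbdd : BddBelow S := ⟨0, fun c hc => (hpos c (Classical.arbitrary M) (hc _)).le⟩
  refine ⟨sInf S, ?_, fun c' hc' x => ?_⟩
  · by_contra! hcon
    obtain ⟨c, hc, hF⟩ := hcov (fun c => c < sInf S) (fun a b ha hb => max_lt ha hb)
      ⟨sInf S - 1, by linarith⟩ fun x => by
        obtain ⟨c', h1, h2⟩ := hopen _ x (hcon x)
        exact ⟨c', h1, h2⟩
    exact absurd (csInf_le hbdd hF) (not_le.2 hc)
  · obtain ⟨c, hc, h⟩ := exists_lt_of_csInf_lt (s := S) ⟨c₀, hc₀⟩ hc'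
    exact hmono _ _ _ h.le (hc x)

/-- If `a H ≤ c G` as Hermitian forms, but not strictly, then `c` is an eigenvalue of `a H`
relative to `G`, and some orthonormal diagonalising frame starts with a vector where equality
holds. -/
lemma exists_frame_of_touching [NeZero n] {G H : Matrix (Fin n) (Fin n) ℂ} (hG : G.PosDef)
    (hH : H.IsHermitian) {a c : ℝ} (hle : ∀ y, a * herm H y ≤ c * herm G y)
    (hnot : ¬ ∀ y, y ≠ 0 → a * herm H y < c * herm G y) :
    ∃ (Y : Matrix (Fin n) (Fin n) ℂ) (lam : Fin n → ℝ), Yᴴ * G * Y = 1 ∧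
      Yᴴ * H * Y = (diagonal fun i => (lam i : ℂ)) ∧ a * lam 0 = c := by
  obtain ⟨Y, lam, hY, hYH⟩ := exists_conj_eq_one_and_diagonal hG hH
  have hYG (i : Fin n) : herm G (Y.col i) = 1 := by
    rw [← re_conj_apply_self, hY, one_apply_eq, Complex.one_re]
  have hYl (i : Fin n) : herm H (Y.col i) = lam i := by
    rw [← re_conj_apply_self, hYH, diagonal_apply_eq, Complex.ofReal_re]
  have hi : ∃ i, a * lam i = c := by
    by_contra! hcon
    refine hnot fun y hy => ?_
    have hlt (i : Fin n) : 0 < c - a * lam i := by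
      have := hle (Y.col i)
      rw [hYG, hYl, mul_one] at this
      exact sub_pos.2 (lt_of_le_of_ne this (hcon i))
    have hYY : Y * (Yᴴ * G) = 1 := mul_eq_one_comm.1 hY
    have hy' : Y *ᵥ ((Yᴴ * G) *ᵥ y) = y := by rw [mulVec_mulVec, hYY, one_mulVec]
    have hw : (Yᴴ * G) *ᵥ y ≠ 0 := by
      intro h0
      rw [h0, mulVec_zero] at hy'
      exact hy hy'.symm
    have hD : (diagonal fun i => ((c - a * lam i : ℝ) : ℂ)).PosDef :=
      PosDef.diagonal fun i => by exact_mod_cast hlt i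
    have hD' : Yᴴ * ((c : ℂ) • G - (a : ℂ) • H) * Y
        = diagonal fun i => ((c - a * lam i : ℝ) : ℂ) := by
      rw [Matrix.mul_sub, Matrix.sub_mul, Matrix.mul_smul, Matrix.mul_smul,
        Matrix.smul_mul, Matrix.smul_mul, hY, hYH,
        ← diagonal_one, ← diagonal_smul, ← diagonal_smul, diagonal_sub]
      congr 1
      ext i
      simp
    have h1 := (posDef_iff_herm.1 hD).2 _ hw
    rw [← hD', herm_conj, hy', herm_sub, herm_smul, herm_smul] at h1
    linarith
  obtain ⟨i, hi⟩ := hi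
  set σ := Equiv.swap 0 i with hσ
  have hperm (N : Matrix (Fin n) (Fin n) ℂ) :
      (Y.submatrix id σ)ᴴ * N * Y.submatrix id σ = (Yᴴ * N * Y).submatrix σ σ := by
    ext i j; simp [Matrix.mul_apply]
  refine ⟨Y.submatrix id σ, lam ∘ σ, ?_, ?_, by simpa [hσ] using hi⟩
  · rw [hperm, hY, submatrix_one_equiv]
  · rw [hperm, hYH, submatrix_diagonal_equiv]
    rfl

end Global

section Manifold

open Filter Topology Matrix

variable {n : ℕ} {M : Type*} [TopologicalSpace M] [ChartedSpace (Cn n) M]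

/-- The comparison `exp(φ) χ_u < c ω` at the point `x`. -/
def IsBelow (g : HermitianMetric n M) (χ : RealOneOneForm n M) (u φ : M → ℝ) (c : ℝ) (x : M) :
    Prop :=
  ∀ y, y ≠ 0 → Real.exp (φ x) * herm (perturb χ u (chartAt (Cn n) x) x) y
    < c * herm (g.coeff (chartAt (Cn n) x) x) y

/-- The function `-A s + exp (-s)` of `s = u - v - m` in the exponent of the auxiliary function. -/
def auxFun (A m : ℝ) (u v : M → ℝ) (x : M) : ℝ :=
  -A * (u x - v x - m) + Real.exp (-(u x - v x - m))

variable [IsManifold 𝓘(ℂ, Cn n) ω M]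

lemma isBelow_open (g : HermitianMetric n M) (χ : RealOneOneForm n M) {u φ : M → ℝ}
    (hu : ContMDiff 𝓘(ℝ, Cn n) 𝓘(ℝ, ℝ) 2 u) (hφ : Continuous φ) {c : ℝ} {x : M}
    (h : IsBelow g χ u φ c x) : ∃ c' < c, ∀ᶠ x' in 𝓝 x, IsBelow g χ u φ c' x' := by
  set e := chartAt (Cn n) x with he
  have hx : x ∈ e.source := mem_chart_source _ x
  have hc : ContinuousAt (fun p : M × ℝ => (p.2 : ℂ) • g.coeff e p.1
      - ((Real.exp (φ p.1) : ℝ) : ℂ) • perturb χ u e p.1) (x, c) := by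
    have c1 : ContinuousAt (fun p : M × ℝ => g.coeff e p.1) (x, c) :=
      ContinuousAt.comp (f := Prod.fst) (continuousAt_coeff g.toRealOneOneForm hx)
        continuousAt_fst
    have c2 : ContinuousAt (fun p : M × ℝ => perturb χ u e p.1) (x, c) :=
      ContinuousAt.comp (f := Prod.fst) (continuousAt_perturb χ hu hx) continuousAt_fst
    have c3 : Continuous fun p : M × ℝ => (p.2 : ℂ) :=
      Complex.continuous_ofReal.comp continuous_snd
    have c4 : Continuous fun p : M × ℝ => ((Real.exp (φ p.1) : ℝ) : ℂ) :=
      Complex.continuous_ofReal.comp (Real.continuous_exp.comp (hφ.comp continuous_fst))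
    exact (c3.continuousAt.smul c1).sub (c4.continuousAt.smul c2)
  have h1 := eventually_herm_pos hc fun y hy => by
    rw [herm_sub, herm_smul, herm_smul]
    exact sub_pos.2 (h y hy)
  rw [nhds_prod_eq] at h1
  obtain ⟨pa, ha, pb, hb, hab⟩ := eventually_prod_iff.1 h1
  obtain ⟨c', hc', hpb⟩ := ((frequently_lt_nhds c).and_eventually hb).exists
  refine ⟨c', hc', ?_⟩
  filter_upwards [ha, e.open_source.mem_nhds hx] with x' hx' hxe
  refine herm_perturb_lt_of_chart g χ hu (mem_chart_source _ x') hxe fun y hy => ?_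
  have := hab hx' hpb y hy
  rw [herm_sub, herm_smul, herm_smul] at this
  exact sub_pos.1 this

/-- The comparison with the optimal constant, and a point where it is attained. -/
lemma exists_optimal_isBelow [NeZero n] [CompactSpace M] [Nonempty M] (g : HermitianMetric n M)
    (χ : RealOneOneForm n M) {u φ : M → ℝ} (hu : ContMDiff 𝓘(ℝ, Cn n) 𝓘(ℝ, ℝ) 2 u)
    (hpos : IsPositive χ u) (hφ : Continuous φ) :
    ∃ c, (∃ x, ¬ IsBelow g χ u φ c x) ∧ ∀ p x, x ∈ (chartAt (Cn n) p).source → ∀ y,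
      Real.exp (φ x) * herm (perturb χ u (chartAt (Cn n) p) x) y
        ≤ c * herm (g.coeff (chartAt (Cn n) p) x) y := by
  have hG (p x : M) (hx : x ∈ (chartAt (Cn n) p).source) (y : Fin n → ℂ) (hy : y ≠ 0) :
      0 < herm (g.coeff (chartAt (Cn n) p) x) y :=
    (posDef_iff_herm.1 (g.posDef _ (chartAt_mem_holCharts p) x hx)).2 y hy
  obtain ⟨c, h1, h2⟩ := exists_touching (F := IsBelow g χ u φ)
    (fun c x h => isBelow_open g χ hu hφ h)
    (fun c c' x hcc h y hy => (h y hy).trans_le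
      (mul_le_mul_of_nonneg_right hcc (hG x x (mem_chart_source _ x) y hy).le))
    (fun x => by
      have hc : Continuous fun t : ℝ => g.coeff (chartAt (Cn n) x) x - (t : ℂ) •
          perturb χ u (chartAt (Cn n) x) x :=
        continuous_const.sub (Complex.continuous_ofReal.smul continuous_const)
      have h1 := eventually_herm_pos (hc.continuousAt (x := 0)) fun y hy => by
        simpa using hG x x (mem_chart_source _ x) y hy
      obtain ⟨t, ht, h⟩ := ((frequently_gt_nhds (0 : ℝ)).and_eventually h1).exists
      have ht' : 0 < t := ht
      refine ⟨Real.exp (φ x) / t, fun y hy => ?_⟩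
      have h3 := h y hy
      rw [herm_sub, herm_smul] at h3
      rw [div_mul_eq_mul_div, lt_div_iff₀ ht', mul_assoc]
      exact mul_lt_mul_of_pos_left (by linarith) (Real.exp_pos _))
    (fun c x h => by
      have hy : (Pi.single 0 1 : Fin n → ℂ) ≠ 0 := by simp
      have h1 := h _ hy
      have h2 := (posDef_iff_herm.1 (hpos _ (chartAt_mem_holCharts x) x
        (mem_chart_source _ x))).2 _ hy
      have h3 := hG x x (mem_chart_source _ x) _ hy
      have h4 := (mul_pos (Real.exp_pos (φ x)) h2).trans h1
      exact pos_of_mul_pos_left h4 h3.le)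
  refine ⟨c, h1, fun p x hx y => ?_⟩
  rcases eq_or_ne y 0 with rfl | hy
  · simp [herm]
  · -- if the inequality fails, the quotient of the two sides is a constant larger than `c` for
    -- which the strict comparison fails as well
    by_contra! hcon
    have hgy := hG p x hx y hy
    have := herm_perturb_lt_of_chart g χ hu hx (mem_chart_source _ x)
      (h2 _ ((lt_div_iff₀ hgy).2 hcon) x) y hy
    rw [div_mul_cancel₀ _ hgy.ne'] at this
    exact lt_irrefl _ this

/-- The estimate at a touching point, with constants uniform in a neighbourhood of `p`. -/
lemma exists_nhds_bound [NeZero n] (g : HermitianMetric n M) (χ : RealOneOneForm n M) {α : ℕ}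
    (hαn : α ≤ n) {ψ v : M → ℝ} (hψ : ContMDiff 𝓘(ℝ, Cn n) 𝓘(ℝ, ℝ) ∞ ψ) (hψpos : ∀ x, 0 < ψ x)
    (hv : ContMDiff 𝓘(ℝ, Cn n) 𝓘(ℝ, ℝ) 2 v) (hvpos : IsPositive χ v)
    (hcone : ∀ e ∈ holCharts n M, ∀ x ∈ e.source,
      IsPosCodimOne ((n : ℂ) • toForm (perturb χ v e x) ^ (n - 1)
        - (((n : ℂ) - (α : ℂ)) * (ψ x : ℂ)) •
          (toForm (perturb χ v e x) ^ (n - α - 1) * toForm (g.coeff e x) ^ α))) (p : M) :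
    ∃ (A₀ : ℝ) (D : ℝ → ℝ), ∀ᶠ x in 𝓝 p, ∀ A, A₀ ≤ A → ∀ (u : M → ℝ) (m c : ℝ),
      ContMDiff 𝓘(ℝ, Cn n) 𝓘(ℝ, ℝ) 4 u → IsSolution g χ α ψ u → (∀ x, m ≤ u x - v x) →
      (∀ q x, x ∈ (chartAt (Cn n) q).source → ∀ y,
        Real.exp (auxFun A m u v x) * herm (perturb χ u (chartAt (Cn n) q) x) y
          ≤ c * herm (g.coeff (chartAt (Cn n) q) x) y) →
      ¬ IsBelow g χ u (auxFun A m u v) c x →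
      c ≤ D A * Real.exp ((u x - v x - m) / 2) * Real.exp (auxFun A m u v x) := by
  set e := chartAt (Cn n) p with he
  have hp : p ∈ e.source := mem_chart_source _ p
  have hehol : e ∈ holCharts n M := chartAt_mem_holCharts p
  have hcoeff (χ : RealOneOneForm n M) (i j : Fin n) :
      ContDiffAt ℝ 2 (fun w => χ.coeff e (e.symm w) i j) (e p) :=
    ((χ.smooth e hehol i j).contDiffAt (e.open_target.mem_nhds (e.map_source hp))).of_le
      (WithTop.coe_le_coe.2 le_top)
  have htarget : ∀ᶠ w in 𝓝 (e p), w ∈ e.target := e.open_target.mem_nhds (e.map_source hp)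
  have hψc : ContDiffAt ℝ 2 (fun w => n.choose α / ψ (e.symm w)) (e p) :=
    contDiffAt_const.div ((contDiffAt_comp_chart_symm hψ p (e.map_source hp)).of_le
      (WithTop.coe_le_coe.2 le_top)) (hψpos _).ne'
  obtain ⟨A₀, D, hev⟩ := exists_local_bound hαn (C := fun w => χ.coeff e (e.symm w))
    (G := fun w => g.coeff e (e.symm w)) (h := fun w => n.choose α / ψ (e.symm w))
    (V := fun w => v (e.symm w)) (z₀ := e p) (hcoeff χ) (hcoeff g.toRealOneOneForm) hψc
    (contDiffAt_comp_chart_symm hv p (e.map_source hp))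
    (div_pos (by exact_mod_cast Nat.choose_pos hαn) (hψpos _))
    (htarget.mono fun w hw => g.posDef e hehol _ (e.map_target hw))
    (htarget.mono fun w hw => by
      rw [← perturb_symm χ v hw]
      exact hvpos e hehol _ (e.map_target hw))
    (fun ξ hξ => by
      rw [← perturb_symm χ v (e.map_source hp), e.left_inv hp]
      exact exists_mixedDet_lt_of_isPosCodimOne hαn (hψpos p) (hcone e hehol p hp) hξ)
  refine ⟨A₀, D, ?_⟩
  filter_upwards [(e.continuousAt hp).eventually hev, e.open_source.mem_nhds hp]
    with x hx hxe A hA u m c hu hsol hm hle hnot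
  have hu2 : ContMDiff 𝓘(ℝ, Cn n) 𝓘(ℝ, ℝ) 2 u := hu.of_le (by norm_num)
  have htx : ∀ᶠ w in 𝓝 (e x), w ∈ e.target := e.open_target.mem_nhds (e.map_source hxe)
  have hHx := hsol.positive e hehol x hxe
  obtain ⟨Y, lam, hY, hYH, hlc⟩ := exists_frame_of_touching (g.posDef e hehol x hxe)
    hHx.isHermitian (hle p x hxe) (fun hlt => hnot
      (herm_perturb_lt_of_chart g χ hu2 (mem_chart_source _ x) hxe hlt))
  have hpx : χ.coeff e (e.symm (e x)) + hess (fun z => u (e.symm z)) (e x) = perturb χ u e x := by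
    rw [← perturb_symm χ u (e.map_source hxe), e.left_inv hxe]
  have hres := hx A hA (fun w => u (e.symm w)) Y lam m
    (contDiffAt_comp_chart_symm hu p (e.map_source hxe)) (hm _)
    (htx.mono fun w hw => by
      rw [← perturb_symm χ u hw]
      exact hsol.positive e hehol _ (e.map_target hw))
    (htx.mono fun w hw => by
      rw [← perturb_symm χ u hw]
      exact mixedDet_of_toForm_eq hαn (hψpos _) (hsol.equation e hehol _ (e.map_target hw)))
    (by rw [e.left_inv hxe, hY]) (by rw [hpx, hYH])
    (htx.mono fun w hw => by
      have h1 := hle p (e.symm w) (e.map_target hw) (Y.col 0)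
      rw [← hlc, auxFun, auxFun] at h1
      rw [← perturb_symm χ u hw, e.left_inv hxe]
      linarith)
  rw [e.left_inv hxe] at hres
  rw [← hlc, mul_comm]
  exact mul_le_mul_of_nonneg_right hres (Real.exp_pos _).le

lemma trace_le_of_herm_le {G H : Matrix (Fin n) (Fin n) ℂ} (hG : G.PosDef) (hH : H.IsHermitian)
    {c : ℝ} (h : ∀ y, herm H y ≤ c * herm G y) : (G⁻¹ * H).trace.re ≤ n * c := by
  obtain ⟨Y, lam, hY, hYH⟩ := exists_conj_eq_one_and_diagonal hG hH
  rw [trace_inv_mul_eq hY, Matrix.trace, Complex.re_sum]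
  have hi (i : Fin n) : ((Yᴴ * H * Y).diag i).re ≤ c := by
    have h1 := h (Y.col i)
    rw [← re_conj_apply_self, ← re_conj_apply_self, hY, one_apply_eq, Complex.one_re,
      mul_one] at h1
    exact h1
  refine (Finset.sum_le_sum fun i _ => hi i).trans ?_
  simp

/-- The a priori estimate in any positive dimension: at the touching point for the optimal constant
`c` the local estimate bounds `c`, which bounds the eigenvalues of `χ_u` everywhere. -/
lemma exists_laplacian_bound [NeZero n] [CompactSpace M] (g : HermitianMetric n M)
    (χ : RealOneOneForm n M) {α : ℕ} (hαn : α ≤ n) {ψ : M → ℝ}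
    (hψ : ContMDiff 𝓘(ℝ, Cn n) 𝓘(ℝ, ℝ) ∞ ψ) (hψpos : ∀ x, 0 < ψ x)
    (hcone : ConeCondition g χ α ψ) :
    ∃ C A : ℝ, 0 < C ∧ 0 < A ∧ ∀ u : M → ℝ, ContMDiff 𝓘(ℝ, Cn n) 𝓘(ℝ, ℝ) 4 u →
      IsSolution g χ α ψ u → ∀ x : M, laplacian g u x + traceForm g χ x
        ≤ C * Real.exp (A * (u x - ⨅ y, u y)) := by
  obtain ⟨v, hv, hvpos, hcone⟩ := hcone
  have hunif := isCompact_univ.induction_on (X := M) (p := fun S => ∃ (A₀ : ℝ) (D : ℝ → ℝ),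
      ∀ x ∈ S, ∀ A, A₀ ≤ A → ∀ (u : M → ℝ) (m c : ℝ),
      ContMDiff 𝓘(ℝ, Cn n) 𝓘(ℝ, ℝ) 4 u → IsSolution g χ α ψ u → (∀ x, m ≤ u x - v x) →
      (∀ q x, x ∈ (chartAt (Cn n) q).source → ∀ y,
        Real.exp (auxFun A m u v x) * herm (perturb χ u (chartAt (Cn n) q) x) y
          ≤ c * herm (g.coeff (chartAt (Cn n) q) x) y) →
      ¬ IsBelow g χ u (auxFun A m u v) c x →
      c ≤ D A * Real.exp ((u x - v x - m) / 2) * Real.exp (auxFun A m u v x))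
    ⟨0, 0, by simp⟩ (fun S T hST ⟨A₀, D, h⟩ => ⟨A₀, D, fun x hx => h x (hST hx)⟩)
    (fun S T ⟨A₀, D, h⟩ ⟨A₀', D', h'⟩ => ⟨max A₀ A₀', fun A => max (D A) (D' A),
      fun x hx A hA u m c h1 h2 h3 h4 h5 => hx.elim
        (fun hx => (h x hx A ((le_max_left _ _).trans hA) u m c h1 h2 h3 h4 h5).trans
          (by gcongr; exact le_max_left _ _))
        (fun hx => (h' x hx A ((le_max_right _ _).trans hA) u m c h1 h2 h3 h4 h5).trans
          (by gcongr; exact le_max_right _ _))⟩)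
    (fun p _ => by
      obtain ⟨A₀, D, h⟩ := exists_nhds_bound g χ hαn hψ hψpos hv hvpos hcone p
      exact ⟨_, mem_nhdsWithin_of_mem_nhds h, A₀, D, fun x hx => hx⟩)
  obtain ⟨A₀, D, hD⟩ := hunif
  set A := max 1 A₀ with hA
  have hA1 : 1 ≤ A := le_max_left _ _
  obtain ⟨b, hb⟩ := isCompact_univ.exists_bound_of_continuousOn hv.continuous.continuousOn
  have hb' (x : M) : |v x| ≤ b := hb x trivial
  refine ⟨n * ((|D A| + 1) * Real.exp 1 * Real.exp (A * (2 * b))), A, ?_, by linarith,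
    fun u hu hsol x => ?_⟩
  · have : 0 < n := Nat.pos_of_ne_zero (NeZero.ne n)
    positivity
  have : Nonempty M := ⟨x⟩
  have hu2 : ContMDiff 𝓘(ℝ, Cn n) 𝓘(ℝ, ℝ) 2 u := hu.of_le (by norm_num)
  have hbdd : BddBelow (Set.range u) := (isCompact_range hu.continuous).bddBelow
  -- any lower bound of `u - v` serves as `m`; this one is comparable with `inf u`
  set m := (⨅ y, u y) - b with hm
  have hms (x : M) : m ≤ u x - v x := by
    have h1 := ciInf_le hbdd x
    have h2 := (abs_le.1 (hb' x)).2
    linarith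
  set φ := auxFun A m u v with hφ
  have hφc : Continuous φ := by
    have := hu.continuous
    have := hv.continuous
    simp only [hφ]
    unfold auxFun
    fun_prop
  obtain ⟨c, ⟨x₀, hx₀⟩, hc⟩ := exists_optimal_isBelow g χ hu2 hsol.positive hφc
  have hcD : c ≤ (|D A| + 1) * Real.exp 1 := by
    have hs : 0 ≤ u x₀ - v x₀ - m := by linarith [hms x₀]
    refine (hD x₀ trivial A (le_max_right _ _) u m c hu hsol hms hc hx₀).trans ?_
    rw [mul_assoc, ← Real.exp_add]
    have h1 : (u x₀ - v x₀ - m) / 2 + auxFun A m u v x₀ ≤ 1 := by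
      have : Real.exp (-(u x₀ - v x₀ - m)) ≤ 1 := Real.exp_le_one_iff.2 (by linarith)
      rw [auxFun]
      nlinarith
    have h2 : D A ≤ |D A| + 1 := by linarith [le_abs_self (D A)]
    gcongr
  set e := chartAt (Cn n) x with he
  have hx : x ∈ e.source := mem_chart_source _ x
  have hGx := g.posDef e (chartAt_mem_holCharts x) x hx
  have hsum : laplacian g u x + traceForm g χ x
      = ((g.coeff e x)⁻¹ * perturb χ u e x).trace.re := by
    rw [laplacian, traceForm, perturb, Matrix.mul_add, trace_add, Complex.add_re, add_comm]
  rw [hsum, mul_assoc]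
  refine trace_le_of_herm_le hGx (hsol.positive e (chartAt_mem_holCharts x) x hx).isHermitian
    fun y => ?_
  have hG0 : 0 ≤ herm (g.coeff e x) y := by
    rcases eq_or_ne y 0 with rfl | hy
    · simp [herm]
    · exact ((posDef_iff_herm.1 hGx).2 y hy).le
  have h1 : herm (perturb χ u e x) y ≤ Real.exp (-φ x) * (c * herm (g.coeff e x) y) := by
    have h2 := mul_le_mul_of_nonneg_left (hc x x hx y) (Real.exp_pos (-φ x)).le
    rwa [← mul_assoc, ← Real.exp_add, neg_add_cancel, Real.exp_zero, one_mul] at h2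
  have h3 : -φ x ≤ A * (2 * b) + A * (u x - ⨅ y, u y) := by
    have h4 := (Real.exp_pos (-(u x - v x - m))).le
    have h5 := (abs_le.1 (hb' x)).1
    have h6 : u x - v x - m ≤ 2 * b + (u x - ⨅ y, u y) := by linarith
    have h7 := mul_le_mul_of_nonneg_left h6 (show 0 ≤ A by linarith)
    rw [hφ, auxFun]
    linarith
  calc herm (perturb χ u e x) y ≤ Real.exp (-φ x) * (c * herm (g.coeff e x) y) := h1
    _ ≤ Real.exp (A * (2 * b) + A * (u x - ⨅ y, u y))
        * ((|D A| + 1) * Real.exp 1 * herm (g.coeff e x) y) := by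
      refine mul_le_mul (Real.exp_le_exp.2 h3) (by gcongr) ?_ (Real.exp_pos _).le
      have hc0 : 0 ≤ Real.exp (φ x) * herm (perturb χ u e x) y := by
        refine mul_nonneg (Real.exp_pos _).le ?_
        rcases eq_or_ne y 0 with rfl | hy
        · simp [herm]
        · exact ((posDef_iff_herm.1
            (hsol.positive e (chartAt_mem_holCharts x) x hx)).2 y hy).le
      exact hc0.trans (hc x x hx y)
    _ = (|D A| + 1) * Real.exp 1 * Real.exp (A * (2 * b)) * Real.exp (A * (u x - ⨅ y, u y))
        * herm (g.coeff e x) y := by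
      rw [Real.exp_add]; ring

end Manifold

end HermitianPDE

end

theorem mainTheorem4 {n : ℕ} (hn : 2 ≤ n)
    {M : Type*} [TopologicalSpace M] [T2Space M] [CompactSpace M]
    [ChartedSpace (HermitianPDE.Cn n) M] [IsManifold 𝓘(ℂ, HermitianPDE.Cn n) ω M]
    (g : HermitianPDE.HermitianMetric n M) (χ : HermitianPDE.RealOneOneForm n M)
    (α : ℕ) (hα : 1 ≤ α) (hαn : α ≤ n)
    (ψ : M → ℝ) (hψ : ContMDiff 𝓘(ℝ, HermitianPDE.Cn n) 𝓘(ℝ, ℝ) ∞ ψ) (hψpos : ∀ x, 0 < ψ x)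
    (hcone : HermitianPDE.ConeCondition g χ α ψ) :
    ∃ C A : ℝ, 0 < C ∧ 0 < A ∧
      ∀ u : M → ℝ, ContMDiff 𝓘(ℝ, HermitianPDE.Cn n) 𝓘(ℝ, ℝ) 4 u →
        HermitianPDE.IsSolution g χ α ψ u →
        ∀ x : M, HermitianPDE.laplacian g u x + HermitianPDE.traceForm g χ x
          ≤ C * Real.exp (A * (u x - ⨅ y, u y)) := by
  have : NeZero n := ⟨by lia⟩
  exact HermitianPDE.exists_laplacian_bound g χ hαn hψ hψpos hcone
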